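/- Let $\mathcal C$ be a symmetric monoidal category with unit object $\mathbb 1$ such that: (0) $\mathcal C$ has all equalizers and coequalizers; (1) the monoidal structure is bistable, i.e. the functors sending a left (right) action $(A,\alpha,X)$ of a bimonoid to its stabilized object (the coequalizer of $\alpha$ and the trivial action $A\otimes X\to X$), and a left (right) coaction $(B,\beta,Y)$ of a bimonoid to its stabilized object (the equalizer of $\beta$ and the trivial coaction), are strongly monoidal for their canonical structure morphisms; (2) the category $\mathsf{Hopf}^{bc}(\mathcal C)$ of bicommutative Hopf monoids in $\mathcal C$ and bimonoid homomorphisms is abelian. A bimonoid $A$ is small if for every left or right action of $A$ on an object $X$ the invariant object (the universal $Z\to X$ on which the action is trivial) and the stabilized object exist and the canonical morphism from the first to the second is an isomorphism; it is cosmall if the dual condition on coactions holds, and bismall if it is small and cosmall. A bismall bimonoid $A$ has a unique normalized integral $\sigma_A:\mathbb 1\to A$ and a unique normalized cointegral $\sigma^A:A\to\mathbb 1$; put $vol^{-1}(A)=\sigma^A\circ\sigma_A\in End_{\mathcal C}(\mathbb 1)$. Let $M_{\mathcal C}$ be the smallest submonoid of $End_{\mathcal C}(\mathbb 1)$ containing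 $vol^{-1}(A)$, and its inverse whenever it is invertible, for every bismall bicommutative Hopf monoid $A$, and let $M^{-1}_{\mathcal C}=M_{\mathcal C}\cap Aut_{\mathcal C}(\mathbb 1)$. A homomorphism $\xi:A\to B$ of bicommutative Hopf monoids is Fredholm if its kernel $Ker(\xi)$ and cokernel $Cok(\xi)$ in $\mathsf{Hopf}^{bc}(\mathcal C)$ are bismall and $vol^{-1}(Ker(\xi))$, $vol^{-1}(Cok(\xi))$ are invertible in $M_{\mathcal C}$; its index is then $Ind(\xi)=vol^{-1}(Cok(\xi))\circ vol^{-1}(Ker(\xi))^{-1}$. It is finite if its image is bismall and the inverse volume of its image is invertible in $M_{\mathcal C}$. Then: 1. For every bicommutative Hopf monoid $A$, the identity $id_A$ is Fredholm and $Ind(id_A)=id_{\mathbb 1}\in M^{-1}_{\mathcal C}$. 2. For Fredholm homomorphisms $\xi:A\to B$ and $\xi':B\to C$ between bicommutative Hopf monoids, the composition $\xi'\circ\xi$ is Fredholm and $Ind(\xi'\circ\xi)=Ind(\xi')\circ Ind(\xi)\in M^{-1}_{\mathcal C}$. 3. For a Fredholm homomorphism $\xi:A\to B$ and a finite homomorphism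 $\varepsilon:A\to B$ between bicommutative Hopf monoids, the convolution $\xi*\varepsilon=\nabla_B\circ(\xi\otimes\varepsilon)\circ\Delta_A$ is Fredholm and $Ind(\xi*\varepsilon)=Ind(\xi)\in M^{-1}_{\mathcal C}$. -/

import Mathlib

universe v u

open CategoryTheory CategoryTheory.Limits CategoryTheory.MonoidalCategory
open scoped CategoryTheory.MonObj CategoryTheory.ComonObj

namespace HopfFredholm

variable {C : Type u} [Category.{v} C] [MonoidalCategory C] [SymmetricCategory C]

section Actions

/-! ### Actions and coactions of a bimonoid, in `C` -/

/-- `α : A ⊗ X ⟶ X` is a left action of the bimonoid `A` on the object `X`. -/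
structure IsLeftAction {A X : C} [BimonObj A] (α : A ⊗ X ⟶ X) : Prop where
  assoc : μ[A] ▷ X ≫ α = (α_ A A X).hom ≫ A ◁ α ≫ α
  unit : η[A] ▷ X ≫ α = (λ_ X).hom

/-- `α : X ⊗ A ⟶ X` is a right action of the bimonoid `A` on the object `X`. -/
structure IsRightAction {A X : C} [BimonObj A] (α : X ⊗ A ⟶ X) : Prop where
  assoc : X ◁ μ[A] ≫ α = (α_ X A A).inv ≫ α ▷ A ≫ α
  unit : X ◁ η[A] ≫ α = (ρ_ X).hom

/-- `β : Y ⟶ B ⊗ Y` is a left coaction of the bimonoid `B` on the object `Y`. -/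
structure IsLeftCoaction {B Y : C} [BimonObj B] (β : Y ⟶ B ⊗ Y) : Prop where
  coassoc : β ≫ Δ[B] ▷ Y = β ≫ B ◁ β ≫ (α_ B B Y).inv
  counit : β ≫ ε[B] ▷ Y = (λ_ Y).inv

/-- `β : Y ⟶ Y ⊗ B` is a right coaction of the bimonoid `B` on the object `Y`. -/
structure IsRightCoaction {B Y : C} [BimonObj B] (β : Y ⟶ Y ⊗ B) : Prop where
  coassoc : β ≫ Y ◁ Δ[B] = β ≫ β ▷ B ≫ (α_ Y B B).hom
  counit : β ≫ Y ◁ ε[B] = (ρ_ Y).inv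

/-- The trivial left action `A ⊗ X ⟶ 𝟙 ⊗ X ≅ X`. -/
def trivLeftAct (A X : C) [ComonObj A] : A ⊗ X ⟶ X := ε[A] ▷ X ≫ (λ_ X).hom

/-- The trivial right action `X ⊗ A ⟶ X ⊗ 𝟙 ≅ X`. -/
def trivRightAct (A X : C) [ComonObj A] : X ⊗ A ⟶ X := X ◁ ε[A] ≫ (ρ_ X).hom

/-- The trivial left coaction `Y ≅ 𝟙 ⊗ Y ⟶ B ⊗ Y`. -/
def trivLeftCoact (B Y : C) [MonObj B] : Y ⟶ B ⊗ Y := (λ_ Y).inv ≫ η[B] ▷ Y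

/-- The trivial right coaction `Y ≅ Y ⊗ 𝟙 ⟶ Y ⊗ B`. -/
def trivRightCoact (B Y : C) [MonObj B] : Y ⟶ Y ⊗ B := (ρ_ Y).inv ≫ Y ◁ η[B]

/-! ### Stabilized objects and invariant objects -/

/-- `p : X ⟶ Q` is a stabilized object of the left action `α`:
a coequalizer of `α` and the trivial action. -/
def IsLeftActStabilized {A X Q : C} [BimonObj A] (α : A ⊗ X ⟶ X) (p : X ⟶ Q) : Prop :=
  ∃ w : α ≫ p = trivLeftAct A X ≫ p, Nonempty (IsColimit (Cofork.ofπ p w))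

/-- `p : X ⟶ Q` is a stabilized object of the right action `α`. -/
def IsRightActStabilized {A X Q : C} [BimonObj A] (α : X ⊗ A ⟶ X) (p : X ⟶ Q) : Prop :=
  ∃ w : α ≫ p = trivRightAct A X ≫ p, Nonempty (IsColimit (Cofork.ofπ p w))

/-- `i : E ⟶ Y` is a stabilized object of the left coaction `β`:
an equalizer of `β` and the trivial coaction. -/
def IsLeftCoactStabilized {B Y E : C} [BimonObj B] (β : Y ⟶ B ⊗ Y) (i : E ⟶ Y) : Prop :=
  ∃ w : i ≫ β = i ≫ trivLeftCoact B Y, Nonempty (IsLimit (Fork.ofι i w))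

/-- `i : E ⟶ Y` is a stabilized object of the right coaction `β`. -/
def IsRightCoactStabilized {B Y E : C} [BimonObj B] (β : Y ⟶ Y ⊗ B) (i : E ⟶ Y) : Prop :=
  ∃ w : i ≫ β = i ≫ trivRightCoact B Y, Nonempty (IsLimit (Fork.ofι i w))

/-- `i : I ⟶ X` is an invariant object of the left action `α`: it intertwines the trivial action
with `α`, and it is universal with this property. -/
structure IsLeftActInvariant {A X I : C} [BimonObj A] (α : A ⊗ X ⟶ X) (i : I ⟶ X) : Prop where
  condition : A ◁ i ≫ α = trivLeftAct A I ≫ i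
  universal : ∀ {Z : C} (f : Z ⟶ X), A ◁ f ≫ α = trivLeftAct A Z ≫ f →
    ∃! g : Z ⟶ I, g ≫ i = f

/-- `i : I ⟶ X` is an invariant object of the right action `α`. -/
structure IsRightActInvariant {A X I : C} [BimonObj A] (α : X ⊗ A ⟶ X) (i : I ⟶ X) : Prop where
  condition : i ▷ A ≫ α = trivRightAct A I ≫ i
  universal : ∀ {Z : C} (f : Z ⟶ X), f ▷ A ≫ α = trivRightAct A Z ≫ f →
    ∃! g : Z ⟶ I, g ≫ i = f

/-- `p : Y ⟶ Q` is an invariant object of the left coaction `β` (dual of the case of actions). -/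
structure IsLeftCoactInvariant {B Y Q : C} [BimonObj B] (β : Y ⟶ B ⊗ Y) (p : Y ⟶ Q) : Prop where
  condition : β ≫ B ◁ p = p ≫ trivLeftCoact B Q
  universal : ∀ {Z : C} (f : Y ⟶ Z), β ≫ B ◁ f = f ≫ trivLeftCoact B Z →
    ∃! g : Q ⟶ Z, p ≫ g = f

/-- `p : Y ⟶ Q` is an invariant object of the right coaction `β`. -/
structure IsRightCoactInvariant {B Y Q : C} [BimonObj B] (β : Y ⟶ Y ⊗ B) (p : Y ⟶ Q) : Prop where
  condition : β ≫ p ▷ B = p ≫ trivRightCoact B Q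
  universal : ∀ {Z : C} (f : Y ⟶ Z), β ≫ f ▷ B = f ≫ trivRightCoact B Z →
    ∃! g : Q ⟶ Z, p ≫ g = f

/-! ### Small, cosmall and bismall bimonoids -/

/-- A bimonoid is small if every left (right) action has an invariant object and a stabilized
object, and the canonical morphism from the former to the latter is an isomorphism.
(Both objects are unique up to a unique compatible isomorphism.) -/
structure IsSmall (A : C) [BimonObj A] : Prop where
  left : ∀ {X : C} (α : A ⊗ X ⟶ X), IsLeftAction α →
    ∃ (I Q : C) (i : I ⟶ X) (p : X ⟶ Q),
      IsLeftActInvariant α i ∧ IsLeftActStabilized α p ∧ IsIso (i ≫ p)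
  right : ∀ {X : C} (α : X ⊗ A ⟶ X), IsRightAction α →
    ∃ (I Q : C) (i : I ⟶ X) (p : X ⟶ Q),
      IsRightActInvariant α i ∧ IsRightActStabilized α p ∧ IsIso (i ≫ p)

/-- A bimonoid is cosmall if every left (right) coaction has a stabilized object and an invariant
object, and the canonical morphism from the former to the latter is an isomorphism. -/
structure IsCosmall (B : C) [BimonObj B] : Prop where
  left : ∀ {Y : C} (β : Y ⟶ B ⊗ Y), IsLeftCoaction β →
    ∃ (E Q : C) (i : E ⟶ Y) (p : Y ⟶ Q),
      IsLeftCoactStabilized β i ∧ IsLeftCoactInvariant β p ∧ IsIso (i ≫ p)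
  right : ∀ {Y : C} (β : Y ⟶ Y ⊗ B), IsRightCoaction β →
    ∃ (E Q : C) (i : E ⟶ Y) (p : Y ⟶ Q),
      IsRightCoactStabilized β i ∧ IsRightCoactInvariant β p ∧ IsIso (i ≫ p)

/-- A bimonoid is bismall if it is small and cosmall. -/
structure IsBismall (A : C) [BimonObj A] : Prop where
  small : IsSmall A
  cosmall : IsCosmall A

end Actions

section Integrals

/-! ### Normalized integrals and cointegrals, inverse volume -/

/-- `σ : 𝟙 ⟶ A` is a normalized (two-sided) integral of the bimonoid `A`. -/
structure IsNormalizedIntegral {A : C} [BimonObj A] (σ : 𝟙_ C ⟶ A) : Prop where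
  left : (σ ⊗ₘ 𝟙 A) ≫ μ[A] = (σ ⊗ₘ ε[A]) ≫ (ρ_ A).hom
  right : (𝟙 A ⊗ₘ σ) ≫ μ[A] = (ε[A] ⊗ₘ σ) ≫ (λ_ A).hom
  normalized : σ ≫ ε[A] = 𝟙 (𝟙_ C)

/-- `τ : A ⟶ 𝟙` is a normalized (two-sided) cointegral of the bimonoid `A`. -/
structure IsNormalizedCointegral {A : C} [BimonObj A] (τ : A ⟶ 𝟙_ C) : Prop where
  left : Δ[A] ≫ (τ ⊗ₘ 𝟙 A) = (ρ_ A).inv ≫ (τ ⊗ₘ η[A])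
  right : Δ[A] ≫ (𝟙 A ⊗ₘ τ) = (λ_ A).inv ≫ (η[A] ⊗ₘ τ)
  normalized : η[A] ≫ τ = 𝟙 (𝟙_ C)

/-- A normalized left and a normalized right integral agree. -/
theorem eq_of_left_right_integral {A : C} [BimonObj A] {σ σ' : 𝟙_ C ⟶ A}
    (hl : (σ ⊗ₘ 𝟙 A) ≫ μ[A] = (σ ⊗ₘ ε[A]) ≫ (ρ_ A).hom) (hn : σ ≫ ε[A] = 𝟙 (𝟙_ C))
    (hr : (𝟙 A ⊗ₘ σ') ≫ μ[A] = (ε[A] ⊗ₘ σ') ≫ (λ_ A).hom) (hn' : σ' ≫ ε[A] = 𝟙 (𝟙_ C)) :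
    σ = σ' := by
  have h1 : (σ ⊗ₘ σ') ≫ μ[A] = (λ_ _).hom ≫ σ := by
    have := congrArg (fun f => (𝟙 (𝟙_ C) ⊗ₘ σ') ≫ f) hl
    simp only [← Category.assoc, tensorHom_comp_tensorHom, Category.id_comp, Category.comp_id,
      hn'] at this
    rw [this]
    simp [unitors_equal]
  have h2 : (σ ⊗ₘ σ') ≫ μ[A] = (λ_ _).hom ≫ σ' := by
    have := congrArg (fun f => (σ ⊗ₘ 𝟙 (𝟙_ C)) ≫ f) hr
    simp only [← Category.assoc, tensorHom_comp_tensorHom, Category.id_comp, Category.comp_id,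
      hn] at this
    rw [this]
    simp
  rw [h1] at h2
  simpa using h2

/-- A normalized left and a normalized right cointegral agree. -/
theorem eq_of_left_right_cointegral {A : C} [BimonObj A] {τ τ' : A ⟶ 𝟙_ C}
    (hl : Δ[A] ≫ (τ ⊗ₘ 𝟙 A) = (ρ_ A).inv ≫ (τ ⊗ₘ η[A])) (hn : η[A] ≫ τ = 𝟙 (𝟙_ C))
    (hr : Δ[A] ≫ (𝟙 A ⊗ₘ τ') = (λ_ A).inv ≫ (η[A] ⊗ₘ τ')) (hn' : η[A] ≫ τ' = 𝟙 (𝟙_ C)) :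
    τ = τ' := by
  have h1 : Δ[A] ≫ (τ ⊗ₘ τ') = τ ≫ (λ_ _).inv := by
    have := congrArg (fun f => f ≫ (𝟙 (𝟙_ C) ⊗ₘ τ')) hl
    simp only [Category.assoc, tensorHom_comp_tensorHom, Category.id_comp, Category.comp_id,
      hn'] at this
    rw [this]
    simp [unitors_inv_equal]
  have h2 : Δ[A] ≫ (τ ⊗ₘ τ') = τ' ≫ (λ_ _).inv := by
    have := congrArg (fun f => f ≫ (τ ⊗ₘ 𝟙 (𝟙_ C))) hr
    simp only [Category.assoc, tensorHom_comp_tensorHom, Category.id_comp, Category.comp_id,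
      hn] at this
    rw [this]
    simp
  rw [h1] at h2
  simpa using h2

/-- A small bimonoid has a normalized integral. -/
theorem IsSmall.exists_normalizedIntegral {A : C} [BimonObj A] (h : IsSmall A) :
    ∃ σ : 𝟙_ C ⟶ A, IsNormalizedIntegral σ := by
  obtain ⟨I, Q, i, p, hi, ⟨w, ⟨hp⟩⟩, hiso⟩ := h.left (X := A) μ[A]
    ⟨by simp [MonObj.mul_assoc], by simp⟩
  obtain ⟨I', Q', i', p', hi', ⟨w', ⟨hp'⟩⟩, hiso'⟩ := h.right (X := A) μ[A]
    ⟨by simp, by simp⟩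
  have e1 : μ[A] ≫ ε[A] = trivLeftAct A A ≫ ε[A] := by
    rw [Bimon.mul_counit, trivLeftAct, MonoidalCategory.tensorHom_def]; simp
  have e2 : μ[A] ≫ ε[A] = trivRightAct A A ≫ ε[A] := by
    rw [Bimon.mul_counit, trivRightAct, MonoidalCategory.tensorHom_def']; simp [unitors_equal]
  let e : Q ⟶ 𝟙_ C := hp.desc (Cofork.ofπ ε[A] e1)
  have he : p ≫ e = ε[A] := hp.fac (Cofork.ofπ ε[A] e1) WalkingParallelPair.one
  let e' : Q' ⟶ 𝟙_ C := hp'.desc (Cofork.ofπ ε[A] e2)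
  have he' : p' ≫ e' = ε[A] := hp'.fac (Cofork.ofπ ε[A] e2) WalkingParallelPair.one
  have hn : ((η[A] ≫ p ≫ inv (i ≫ p)) ≫ i) ≫ ε[A] = 𝟙 _ := by
    simp only [Category.assoc]
    rw [← he, ← Category.assoc i p e, IsIso.inv_hom_id_assoc, he, BimonObj.one_counit]
  have hn' : ((η[A] ≫ p' ≫ inv (i' ≫ p')) ≫ i') ≫ ε[A] = 𝟙 _ := by
    simp only [Category.assoc]
    rw [← he', ← Category.assoc i' p' e', IsIso.inv_hom_id_assoc, he', BimonObj.one_counit]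
  have hr (q : 𝟙_ C ⟶ I) : (𝟙 A ⊗ₘ (q ≫ i)) ≫ μ[A] = (ε[A] ⊗ₘ (q ≫ i)) ≫ (λ_ A).hom := by
    rw [id_tensorHom, MonoidalCategory.whiskerLeft_comp, Category.assoc, hi.condition,
      trivLeftAct, Category.assoc, MonoidalCategory.tensorHom_def, Category.assoc,
      leftUnitor_naturality, whisker_exchange_assoc, leftUnitor_naturality_assoc]
  have hl (q : 𝟙_ C ⟶ I') : ((q ≫ i') ⊗ₘ 𝟙 A) ≫ μ[A] = ((q ≫ i') ⊗ₘ ε[A]) ≫ (ρ_ A).hom := by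
    rw [tensorHom_id, comp_whiskerRight, Category.assoc, hi'.condition,
      trivRightAct, Category.assoc, MonoidalCategory.tensorHom_def', Category.assoc,
      rightUnitor_naturality, ← whisker_exchange_assoc, rightUnitor_naturality_assoc]
  have heq := eq_of_left_right_integral (hl _) hn' (hr _) hn
  exact ⟨_, hl _, heq ▸ hr _, hn'⟩

/-- A cosmall bimonoid has a normalized cointegral. -/
theorem IsCosmall.exists_normalizedCointegral {A : C} [BimonObj A] (h : IsCosmall A) :
    ∃ τ : A ⟶ 𝟙_ C, IsNormalizedCointegral τ := by
  obtain ⟨E, Q, i, p, ⟨w, ⟨hi⟩⟩, hp, hiso⟩ := h.left (Y := A) Δ[A]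
    ⟨by simp, by simp⟩
  obtain ⟨E', Q', i', p', ⟨w', ⟨hi'⟩⟩, hp', hiso'⟩ := h.right (Y := A) Δ[A]
    ⟨by simp, by simp⟩
  have e1 : η[A] ≫ Δ[A] = η[A] ≫ trivLeftCoact A A := by
    rw [Bimon.one_comul, trivLeftCoact, MonoidalCategory.tensorHom_def']; simp
  have e2 : η[A] ≫ Δ[A] = η[A] ≫ trivRightCoact A A := by
    rw [Bimon.one_comul, trivRightCoact, MonoidalCategory.tensorHom_def]
    simp [unitors_inv_equal]
  let e : 𝟙_ C ⟶ E := hi.lift (Fork.ofι η[A] e1)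
  have he : e ≫ i = η[A] := hi.fac (Fork.ofι η[A] e1) WalkingParallelPair.zero
  let e' : 𝟙_ C ⟶ E' := hi'.lift (Fork.ofι η[A] e2)
  have he' : e' ≫ i' = η[A] := hi'.fac (Fork.ofι η[A] e2) WalkingParallelPair.zero
  have hn : η[A] ≫ p ≫ inv (i ≫ p) ≫ i ≫ ε[A] = 𝟙 _ := by
    have h3 : η[A] ≫ p ≫ inv (i ≫ p) = e := by
      rw [← he, Category.assoc, ← Category.assoc i p, IsIso.hom_inv_id, Category.comp_id]
    simp only [← Category.assoc] at h3 ⊢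
    rw [h3, he, BimonObj.one_counit]
  have hn' : η[A] ≫ p' ≫ inv (i' ≫ p') ≫ i' ≫ ε[A] = 𝟙 _ := by
    have h3 : η[A] ≫ p' ≫ inv (i' ≫ p') = e' := by
      rw [← he', Category.assoc, ← Category.assoc i' p', IsIso.hom_inv_id, Category.comp_id]
    simp only [← Category.assoc] at h3 ⊢
    rw [h3, he', BimonObj.one_counit]
  have hr (q : Q ⟶ 𝟙_ C) : Δ[A] ≫ (𝟙 A ⊗ₘ (p ≫ q)) = (λ_ A).inv ≫ (η[A] ⊗ₘ (p ≫ q)) := by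
    rw [id_tensorHom, MonoidalCategory.whiskerLeft_comp, reassoc_of% hp.condition,
      trivLeftCoact, MonoidalCategory.tensorHom_def', Category.assoc, ← whisker_exchange]
    simp only [← leftUnitor_inv_naturality_assoc, Category.assoc]
  have hl (q : Q' ⟶ 𝟙_ C) : Δ[A] ≫ ((p' ≫ q) ⊗ₘ 𝟙 A) = (ρ_ A).inv ≫ ((p' ≫ q) ⊗ₘ η[A]) := by
    rw [tensorHom_id, comp_whiskerRight, reassoc_of% hp'.condition,
      trivRightCoact, MonoidalCategory.tensorHom_def, Category.assoc, whisker_exchange]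
    simp only [← rightUnitor_inv_naturality_assoc, Category.assoc]
  have heq := eq_of_left_right_cointegral (hl _) hn' (hr _) hn
  exact ⟨_, hl _, heq ▸ hr _, hn'⟩

/-- The inverse volume `σ^A ∘ σ_A : 𝟙 ⟶ 𝟙` of a bimonoid `A` with a normalized integral `σ_A` and
a normalized cointegral `σ^A` (both of which are unique). -/
noncomputable def invVol (A : C) [BimonObj A] (hi : ∃ σ : 𝟙_ C ⟶ A, IsNormalizedIntegral σ)
    (hc : ∃ τ : A ⟶ 𝟙_ C, IsNormalizedCointegral τ) : End (𝟙_ C) :=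
  hi.choose ≫ hc.choose

/-- The inverse volume of a bismall bimonoid. -/
noncomputable def IsBismall.invVol {A : C} [BimonObj A] (h : IsBismall A) : End (𝟙_ C) :=
  HopfFredholm.invVol A h.small.exists_normalizedIntegral h.cosmall.exists_normalizedCointegral

end Integrals

section Stability

/-! ### Bistability of the monoidal structure -/

/-- The tensor product of two left actions. -/
def tensorLeftAct {A A' X X' : C} (α : A ⊗ X ⟶ X) (α' : A' ⊗ X' ⟶ X') :
    (A ⊗ A') ⊗ (X ⊗ X') ⟶ X ⊗ X' :=
  tensorμ A A' X X' ≫ (α ⊗ₘ α')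

/-- The tensor product of two right actions. -/
def tensorRightAct {A A' X X' : C} (α : X ⊗ A ⟶ X) (α' : X' ⊗ A' ⟶ X') :
    (X ⊗ X') ⊗ (A ⊗ A') ⟶ X ⊗ X' :=
  tensorμ X X' A A' ≫ (α ⊗ₘ α')

/-- The tensor product of two left coactions. -/
def tensorLeftCoact {B B' Y Y' : C} (β : Y ⟶ B ⊗ Y) (β' : Y' ⟶ B' ⊗ Y') :
    Y ⊗ Y' ⟶ (B ⊗ B') ⊗ (Y ⊗ Y') :=
  (β ⊗ₘ β') ≫ tensorμ B Y B' Y'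

/-- The tensor product of two right coactions. -/
def tensorRightCoact {B B' Y Y' : C} (β : Y ⟶ Y ⊗ B) (β' : Y' ⟶ Y' ⊗ B') :
    Y ⊗ Y' ⟶ (Y ⊗ Y') ⊗ (B ⊗ B') :=
  (β ⊗ₘ β') ≫ tensorμ Y B Y' B'

/-- The tensor product of trivial left actions is trivial. -/
theorem tensorLeftAct_triv (A A' X X' : C) [BimonObj A] [BimonObj A'] :
    tensorLeftAct (trivLeftAct A X) (trivLeftAct A' X') = trivLeftAct (A ⊗ A') (X ⊗ X') := by
  simp only [tensorLeftAct, trivLeftAct, Comon.tensorObj_counit, comp_whiskerRight,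
    ← tensorHom_comp_tensorHom, Category.assoc, ← tensorμ_natural_left_assoc,
    tensor_left_unitality, hom_inv_whiskerRight_assoc]

/-- The tensor product of trivial right actions is trivial. -/
theorem tensorRightAct_triv (A A' X X' : C) [BimonObj A] [BimonObj A'] :
    tensorRightAct (trivRightAct A X) (trivRightAct A' X') =
      trivRightAct (A ⊗ A') (X ⊗ X') := by
  simp only [tensorRightAct, trivRightAct, Comon.tensorObj_counit,
    MonoidalCategory.whiskerLeft_comp, ← tensorHom_comp_tensorHom, Category.assoc,
    ← tensorμ_natural_right_assoc, tensor_right_unitality, whiskerLeft_hom_inv_assoc]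

/-- The tensor product of trivial left coactions is trivial. -/
theorem tensorLeftCoact_triv (B B' Y Y' : C) [BimonObj B] [BimonObj B'] :
    tensorLeftCoact (trivLeftCoact B Y) (trivLeftCoact B' Y') =
      trivLeftCoact (B ⊗ B') (Y ⊗ Y') := by
  have h1 := tensorμ_natural η[B] (𝟙 Y) η[B'] (𝟙 Y')
  have h2 : ((λ_ Y).inv ⊗ₘ (λ_ Y').inv) ≫ tensorμ (𝟙_ C) Y (𝟙_ C) Y' =
      (λ_ (Y ⊗ Y')).inv ≫ (λ_ (𝟙_ C)).inv ▷ (Y ⊗ Y') := by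
    rw [← cancel_mono ((λ_ (𝟙_ C)).hom ▷ (Y ⊗ Y')), ← cancel_mono (λ_ (Y ⊗ Y')).hom]
    simp only [Category.assoc]
    rw [← leftUnitor_monoidal]
    simp
  rw [id_tensorHom_id, tensorHom_id, tensorHom_id, tensorHom_id] at h1
  simp only [tensorLeftCoact, trivLeftCoact, ← tensorHom_comp_tensorHom, Category.assoc, h1,
    reassoc_of% h2, MonObj.tensorObj.one_def, comp_whiskerRight]

/-- The tensor product of trivial right coactions is trivial. -/
theorem tensorRightCoact_triv (B B' Y Y' : C) [BimonObj B] [BimonObj B'] :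
    tensorRightCoact (trivRightCoact B Y) (trivRightCoact B' Y') =
      trivRightCoact (B ⊗ B') (Y ⊗ Y') := by
  have h1 := tensorμ_natural (𝟙 Y) η[B] (𝟙 Y') η[B']
  have h2 : ((ρ_ Y).inv ⊗ₘ (ρ_ Y').inv) ≫ tensorμ Y (𝟙_ C) Y' (𝟙_ C) =
      (ρ_ (Y ⊗ Y')).inv ≫ (Y ⊗ Y') ◁ (λ_ (𝟙_ C)).inv := by
    rw [← cancel_mono ((Y ⊗ Y') ◁ (λ_ (𝟙_ C)).hom), ← cancel_mono (ρ_ (Y ⊗ Y')).hom]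
    simp only [Category.assoc]
    rw [← rightUnitor_monoidal]
    simp
  rw [id_tensorHom_id, id_tensorHom, id_tensorHom, id_tensorHom] at h1
  simp only [tensorRightCoact, trivRightCoact, ← tensorHom_comp_tensorHom, Category.assoc, h1,
    reassoc_of% h2, MonObj.tensorObj.one_def, MonoidalCategory.whiskerLeft_comp]

variable [HasCoequalizers C] [HasEqualizers C]

/-- The stabilized object `α \ X` of a left action. -/
noncomputable abbrev leftActStab {A X : C} [BimonObj A] (α : A ⊗ X ⟶ X) : C :=
  coequalizer α (trivLeftAct A X)

/-- The stabilized object `X / α` of a right action. -/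
noncomputable abbrev rightActStab {A X : C} [BimonObj A] (α : X ⊗ A ⟶ X) : C :=
  coequalizer α (trivRightAct A X)

/-- The stabilized object `β / Y` of a left coaction. -/
noncomputable abbrev leftCoactStab {B Y : C} [BimonObj B] (β : Y ⟶ B ⊗ Y) : C :=
  equalizer β (trivLeftCoact B Y)

/-- The stabilized object `Y \ β` of a right coaction. -/
noncomputable abbrev rightCoactStab {B Y : C} [BimonObj B] (β : Y ⟶ Y ⊗ B) : C :=
  equalizer β (trivRightCoact B Y)

/-- The comonoidal structure morphism of the functor sending a left action to its stabilized
object. Here the coequalizer is the stabilized object of the tensor product of the two actions. -/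
noncomputable def leftActComparison {A A' X X' : C} [BimonObj A] [BimonObj A']
    (α : A ⊗ X ⟶ X) (α' : A' ⊗ X' ⟶ X') :
    coequalizer (tensorLeftAct α α') (trivLeftAct (A ⊗ A') (X ⊗ X')) ⟶
      leftActStab α ⊗ leftActStab α' :=
  coequalizer.desc (coequalizer.π α (trivLeftAct A X) ⊗ₘ coequalizer.π α' (trivLeftAct A' X'))
    (by rw [← tensorLeftAct_triv]
        simp only [tensorLeftAct, Category.assoc, tensorHom_comp_tensorHom]
        rw [coequalizer.condition α, coequalizer.condition α'])

/-- The comonoidal structure morphism of the functor sending a right action to its stabilized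
object. -/
noncomputable def rightActComparison {A A' X X' : C} [BimonObj A] [BimonObj A']
    (α : X ⊗ A ⟶ X) (α' : X' ⊗ A' ⟶ X') :
    coequalizer (tensorRightAct α α') (trivRightAct (A ⊗ A') (X ⊗ X')) ⟶
      rightActStab α ⊗ rightActStab α' :=
  coequalizer.desc (coequalizer.π α (trivRightAct A X) ⊗ₘ coequalizer.π α' (trivRightAct A' X'))
    (by rw [← tensorRightAct_triv]
        simp only [tensorRightAct, Category.assoc, tensorHom_comp_tensorHom]
        rw [coequalizer.condition α, coequalizer.condition α'])

/-- The monoidal structure morphism of the functor sending a left coaction to its stabilized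
object. -/
noncomputable def leftCoactComparison {B B' Y Y' : C} [BimonObj B] [BimonObj B']
    (β : Y ⟶ B ⊗ Y) (β' : Y' ⟶ B' ⊗ Y') :
    leftCoactStab β ⊗ leftCoactStab β' ⟶
      equalizer (tensorLeftCoact β β') (trivLeftCoact (B ⊗ B') (Y ⊗ Y')) :=
  equalizer.lift (equalizer.ι β (trivLeftCoact B Y) ⊗ₘ equalizer.ι β' (trivLeftCoact B' Y'))
    (by rw [← tensorLeftCoact_triv]
        simp only [tensorLeftCoact, tensorHom_comp_tensorHom_assoc]
        rw [equalizer.condition β, equalizer.condition β'])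

/-- The monoidal structure morphism of the functor sending a right coaction to its stabilized
object. -/
noncomputable def rightCoactComparison {B B' Y Y' : C} [BimonObj B] [BimonObj B']
    (β : Y ⟶ Y ⊗ B) (β' : Y' ⟶ Y' ⊗ B') :
    rightCoactStab β ⊗ rightCoactStab β' ⟶
      equalizer (tensorRightCoact β β') (trivRightCoact (B ⊗ B') (Y ⊗ Y')) :=
  equalizer.lift (equalizer.ι β (trivRightCoact B Y) ⊗ₘ equalizer.ι β' (trivRightCoact B' Y'))
    (by rw [← tensorRightCoact_triv]
        simp only [tensorRightCoact, tensorHom_comp_tensorHom_assoc]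
        rw [equalizer.condition β, equalizer.condition β'])

variable (C) in
/-- The monoidal structure of `C` is bistable: the functors sending a left (right) action to its
stabilized object and a left (right) coaction to its stabilized object are strongly monoidal.
(The structure morphisms at the unit compare `𝟙` with the (co)equalizer of two equal morphisms, so
they are always isomorphisms.) -/
structure IsBistable : Prop where
  leftAct : ∀ {A A' X X' : C} [BimonObj A] [BimonObj A'] (α : A ⊗ X ⟶ X) (α' : A' ⊗ X' ⟶ X'),
    IsLeftAction α → IsLeftAction α' → IsIso (leftActComparison α α')
  rightAct : ∀ {A A' X X' : C} [BimonObj A] [BimonObj A'] (α : X ⊗ A ⟶ X) (α' : X' ⊗ A' ⟶ X'),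
    IsRightAction α → IsRightAction α' → IsIso (rightActComparison α α')
  leftCoact : ∀ {B B' Y Y' : C} [BimonObj B] [BimonObj B'] (β : Y ⟶ B ⊗ Y) (β' : Y' ⟶ B' ⊗ Y'),
    IsLeftCoaction β → IsLeftCoaction β' → IsIso (leftCoactComparison β β')
  rightCoact : ∀ {B B' Y Y' : C} [BimonObj B] [BimonObj B'] (β : Y ⟶ Y ⊗ B) (β' : Y' ⟶ Y' ⊗ B'),
    IsRightCoaction β → IsRightCoaction β' → IsIso (rightCoactComparison β β')

end Stability

section Category

/-! ### The category of bicommutative Hopf monoids -/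

variable (C) in
/-- A bicommutative Hopf monoid in `C`. -/
structure BicommHopf where
  /-- The underlying object. -/
  X : C
  [hopf : HopfObj X]
  [comm : IsCommMonObj X]
  [cocomm : IsCommComonObj X]

attribute [instance] BicommHopf.hopf BicommHopf.comm BicommHopf.cocomm

/-- A homomorphism of bicommutative Hopf monoids: a bimonoid homomorphism. -/
@[ext]
structure BicommHopf.Hom (A B : BicommHopf C) where
  /-- The underlying morphism. -/
  hom : A.X ⟶ B.X
  [isBimonHom : IsBimonHom hom]

attribute [instance] BicommHopf.Hom.isBimonHom

/-- The category of bicommutative Hopf monoids in `C` and bimonoid homomorphisms. -/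
instance : Category (BicommHopf C) where
  Hom A B := BicommHopf.Hom A B
  id A := { hom := 𝟙 A.X, isBimonHom := {} }
  comp f g := { hom := f.hom ≫ g.hom, isBimonHom := {} }

/-- In a cocommutative comonoid, the two middle factors of the fourfold comultiplication may be
interchanged. -/
theorem comul_comul_tensorμ (A : C) [ComonObj A] [IsCommComonObj A] :
    Δ[A] ≫ (Δ[A] ⊗ₘ Δ[A]) ≫ tensorμ A A A A = Δ[A] ≫ (Δ[A] ⊗ₘ Δ[A]) := by
  have h : Δ[A] ≫ (Δ[A] ⊗ₘ Δ[A]) =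
      Δ[A] ≫ A ◁ Δ[A] ≫ A ◁ Δ[A] ▷ A ≫ A ◁ (α_ A A A).hom ≫ (α_ A A (A ⊗ A)).inv := by
    rw [← MonoidalCategory.whiskerLeft_comp_assoc, ← MonoidalCategory.whiskerLeft_comp_assoc,
      Category.assoc,
      ← ComonObj.comul_assoc, MonoidalCategory.whiskerLeft_comp_assoc, ComonObj.comul_assoc_assoc,
      MonoidalCategory.tensorHom_def]
    simp
  rw [reassoc_of% h, h]
  simp only [tensorμ, Iso.inv_hom_id_assoc, whiskerLeft_hom_inv_assoc]
  rw [← MonoidalCategory.whiskerLeft_comp_assoc A (Δ[A] ▷ A), ← comp_whiskerRight,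
    IsCommComonObj.comul_comm]

/-- The convolution `∇ ∘ (ξ ⊗ ζ) ∘ Δ` of two homomorphisms of bicommutative Hopf monoids. -/
def BicommHopf.conv {A B : BicommHopf C} (ξ ζ : A ⟶ B) : A ⟶ B where
  hom := Δ[A.X] ≫ (ξ.hom ⊗ₘ ζ.hom) ≫ μ[B.X]
  isBimonHom :=
    { one_hom := by
        have h1 : η[A.X ⊗ A.X] ≫ (ξ.hom ⊗ₘ ζ.hom) = η[B.X ⊗ B.X] := IsMonHom.one_hom _
        rw [BimonObj.one_comul_assoc, reassoc_of% h1, MonObj.tensorObj.one_def]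
        simp [← unitors_equal]
      mul_hom := by
        have h1 := IsMonHom.mul_hom (ξ.hom ⊗ₘ ζ.hom)
        simp only [MonObj.tensorObj.mul_def, Category.assoc] at h1
        rw [BimonObj.mul_comul_assoc, reassoc_of% h1, MonObj.mul_mul_mul_comm]
        simp only [← tensorHom_comp_tensorHom, Category.assoc]
      hom_counit := by
        simp [tensorHom_comp_tensorHom_assoc, unitors_equal]
      hom_comul := by
        have h1 : (ξ.hom ⊗ₘ ζ.hom) ≫ (Δ[B.X] ⊗ₘ Δ[B.X]) ≫ tensorμ B.X B.X B.X B.X =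
            (Δ[A.X] ⊗ₘ Δ[A.X]) ≫ tensorμ A.X A.X A.X A.X ≫
              ((ξ.hom ⊗ₘ ζ.hom) ⊗ₘ (ξ.hom ⊗ₘ ζ.hom)) := by
          rw [← tensorμ_natural, tensorHom_comp_tensorHom_assoc, tensorHom_comp_tensorHom_assoc,
            IsComonHom.hom_comul, IsComonHom.hom_comul]
        simp only [Category.assoc, BimonObj.mul_comul]
        rw [reassoc_of% h1, reassoc_of% (comul_comul_tensorμ A.X)]
        simp only [← tensorHom_comp_tensorHom] }

end Category

section Index

/-! ### Fredholm morphisms and their index -/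

section General

variable {B : Type*} [Category B] [Abelian B] {M : Type*} [Monoid M]

/-- Let `P` be the class of objects of a full subcategory, closed under isomorphisms, of the
abelian category `B`, and let `v` assign to each object of the subcategory an element of `M`.
A morphism of `B` is Fredholm with respect to `v` if its kernel and its cokernel
belong to the subcategory and `v` is invertible on them. -/
structure IsFredholm (P : ObjectProperty B) (v : ∀ X, P X → M) {X Y : B} (f : X ⟶ Y) : Prop where
  ker_mem : P (kernel f)
  cok_mem : P (cokernel f)
  isUnit_ker : IsUnit (v _ ker_mem)
  isUnit_cok : IsUnit (v _ cok_mem)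

/-- The Fredholm index `v (Cok f) * v (Ker f)⁻¹`. -/
noncomputable def IsFredholm.index {P : ObjectProperty B} {v : ∀ X, P X → M} {X Y : B} {f : X ⟶ Y}
    (h : IsFredholm P v f) : M :=
  v _ h.cok_mem * ((h.isUnit_ker.unit⁻¹ : Mˣ) : M)

/-- A morphism is finite with respect to `v` if its image belongs to the subcategory and `v` is
invertible on it. -/
structure IsFinite (P : ObjectProperty B) (v : ∀ X, P X → M) {X Y : B} (f : X ⟶ Y) : Prop where
  im_mem : P (Abelian.image f)
  isUnit_im : IsUnit (v _ im_mem)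

end General

variable (C) in
/-- The bismall bicommutative Hopf monoids. -/
def bismall : ObjectProperty (BicommHopf C) := fun A => IsBismall A.X

variable (C) in
/-- The smallest submonoid of `End 𝟙` containing the inverse volumes of all bismall bicommutative
Hopf monoids and the inverses of those of them that are invertible. -/
def volMonoid : Submonoid (End (𝟙_ C)) :=
  Submonoid.closure {f | ∃ (A : BicommHopf C) (h : bismall C A),
    f = IsBismall.invVol h ∨ (f * IsBismall.invVol h = 1 ∧ IsBismall.invVol h * f = 1)}

variable (C) in
/-- The submonoid of the elements of `volMonoid C` that are automorphisms of `𝟙`. -/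
def volUnits : Submonoid (End (𝟙_ C)) :=
  volMonoid C ⊓ IsUnit.submonoid (End (𝟙_ C))

/-- The inverse volume, as a function on the bismall bicommutative Hopf monoids. -/
noncomputable def vol (A : BicommHopf C) (h : bismall C A) : volMonoid C :=
  ⟨IsBismall.invVol h, Submonoid.subset_closure ⟨A, h, Or.inl rfl⟩⟩

/-- A homomorphism of bicommutative Hopf monoids is Fredholm if it is so with respect to the
inverse volume on bismall bicommutative Hopf monoids. -/
abbrev IsFredholmHom [Abelian (BicommHopf C)] {A B : BicommHopf C} (ξ : A ⟶ B) : Prop :=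
  IsFredholm (bismall C) vol ξ

/-- A homomorphism of bicommutative Hopf monoids is finite if it is so with respect to the inverse
volume on bismall bicommutative Hopf monoids. -/
abbrev IsFiniteHom [Abelian (BicommHopf C)] {A B : BicommHopf C} (ξ : A ⟶ B) : Prop :=
  IsFinite (bismall C) vol ξ

/-- The index of a Fredholm homomorphism of bicommutative Hopf monoids, as an endomorphism
of `𝟙`. -/
noncomputable def Ind [Abelian (BicommHopf C)] {A B : BicommHopf C} {ξ : A ⟶ B}
    (h : IsFredholmHom ξ) : End (𝟙_ C) :=
  (h.index : volMonoid C)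

end Index

end HopfFredholm

/-! The index is a multiplicative Euler characteristic. Suppose that the inverse volume is
multiplicative on short exact sequences and that kernels and cokernels of homomorphisms between
objects of invertible volume again have invertible volume (`IsVolume`). Then everything is formal in
the abelian category. For a composite, the exact sequence 0 → Ker f → Ker(f ≫ g) → Ker g → Cok f →
Cok(f ≫ g) → Cok g → 0 is cut at the connecting map δ : Ker g → Cok f, whose kernel and cokernel
have invertible volume. For a finite perturbation, ξ and ξ * ε agree on the inclusion k of Ker ε,
and k is Fredholm because its cokernel is the image of ε; so both indices agree after multiplication
by the unit Ind k (`isFredholm_of_finite_perturbation`).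

It remains to prove `BicommHopf.isVolume`. Bistability makes stabilized objects stable under tensor
products, so that a cokernel of Hopf monoids is, in `C`, the coequalizer of an action, and a kernel
the equalizer of a coaction (`isStableCoequalizer_of_isColimit`, `isStableEqualizer_of_isLimit`).
For a short exact sequence A → B → D, averaging with an integral σ of A gives n : D ⟶ B, and
contracting with a cointegral τ of D gives m : B ⟶ A. An integral of D followed by n, and m followed
by a cointegral of A, are an integral and a cointegral of B; the identity n ≫ m = τ ≫ σ
(`norm_comp_restrict`) then gives multiplicativity. Bismallness of B is automatic, since normalized
integrals and cointegrals yield averaging idempotents, which split.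

Closure under kernels and cokernels is the deeper point. The image of f : X ⟶ Y receives an integral
from X and a cointegral from Y, but their pairing must be shown to be invertible. In Sweedler
notation, an integral s and a cointegral t satisfy t(a s₁) S(s₂) = t(s) a (`average_integral`). If
t(s) is invertible, the Hopf monoid is therefore self-dual. This applies to X and to Ker f, and the
image, being the coinvariants of Ker f acting on X, is then dualizable as well
(`exists_dual_of_isStableCoequalizer`). Taking the trace of the same identity on the image shows
that its dimension is inverse to t(s) (`exists_inv_of_dual`). -/

namespace HopfFredholm

/-! ### Volumes and the index in an abelian category -/

section Volume

open ZeroObject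

variable {B : Type*} [Category B] {M : Type*} [CommMonoid M]

/-- The objects on which `v` is defined and invertible. -/
def HasUnitVolume (P : ObjectProperty B) (v : ∀ X, P X → M) : ObjectProperty B :=
  fun X => ∃ h : P X, IsUnit (v X h)

/-- The invertible value of `v` (and `1` where there is none). -/
noncomputable def unitVolume (P : ObjectProperty B) (v : ∀ X, P X → M) (X : B) : Mˣ := by
  classical exact if h : HasUnitVolume P v X then h.choose_spec.unit else 1

variable {P : ObjectProperty B} {v : ∀ X, P X → M}

theorem coe_unitVolume {X : B} (h : P X) (hu : IsUnit (v X h)) :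
    (unitVolume P v X : M) = v X h := by
  have h' : HasUnitVolume P v X := ⟨h, hu⟩
  simp [unitVolume, h']

variable [Abelian B]

/-- `v` is multiplicative on short exact sequences, and the objects on which it is invertible are
closed under kernels and cokernels. -/
structure IsVolume (P : ObjectProperty B) (v : ∀ X, P X → M) : Prop where
  of_isZero : ∀ X, IsZero X → ∃ h : P X, v X h = 1
  of_shortExact : ∀ S : ShortComplex B, S.ShortExact → ∀ (h₁ : P S.X₁) (h₃ : P S.X₃),
    ∃ h₂ : P S.X₂, v _ h₂ = v _ h₁ * v _ h₃
  kernel_mem : ∀ {X Y : B} (f : X ⟶ Y), HasUnitVolume P v X → HasUnitVolume P v Y →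
    HasUnitVolume P v (kernel f)
  cokernel_mem : ∀ {X Y : B} (f : X ⟶ Y), HasUnitVolume P v X → HasUnitVolume P v Y →
    HasUnitVolume P v (cokernel f)

/-- Exactness at X₃ makes b surjective onto Ker d. This and its dual cut long exact sequences into
short ones. -/
theorem shortExact_kernel_of_exact {X₁ X₂ X₃ X₄ : B} {a : X₁ ⟶ X₂} {b : X₂ ⟶ X₃} {d : X₃ ⟶ X₄}
    (hab : a ≫ b = 0) (hbd : b ≫ d = 0) (h₁ : (ShortComplex.mk a b hab).Exact)
    (h₂ : (ShortComplex.mk b d hbd).Exact) [Mono a] :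
    ∃ w, (ShortComplex.mk a (kernel.lift d b hbd) w).ShortExact := by
  have w : a ≫ kernel.lift d b hbd = 0 := by
    rw [← cancel_mono (kernel.ι d)]; simp [hab]
  refine ⟨w, ShortComplex.ShortExact.mk' ?_ ‹_› h₂.epi_kernelLift⟩
  let φ : ShortComplex.mk a (kernel.lift d b hbd) w ⟶ ShortComplex.mk a b hab :=
    { τ₁ := 𝟙 _, τ₂ := 𝟙 _, τ₃ := kernel.ι d }
  have : Epi φ.τ₁ := by dsimp [φ]; infer_instance
  have : IsIso φ.τ₂ := by dsimp [φ]; infer_instance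
  have : Mono φ.τ₃ := by dsimp [φ]; infer_instance
  exact (ShortComplex.exact_iff_of_epi_of_isIso_of_mono φ).2 h₁

theorem shortExact_cokernel_of_exact {X₁ X₂ X₃ X₄ : B} {a : X₁ ⟶ X₂} {b : X₂ ⟶ X₃} {d : X₃ ⟶ X₄}
    (hab : a ≫ b = 0) (hbd : b ≫ d = 0) (h₁ : (ShortComplex.mk a b hab).Exact)
    (h₂ : (ShortComplex.mk b d hbd).Exact) [Epi d] :
    ∃ w, (ShortComplex.mk (cokernel.desc a b hab) d w).ShortExact := by
  have w : cokernel.desc a b hab ≫ d = 0 := by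
    rw [← cancel_epi (cokernel.π a)]; simp [hbd]
  refine ⟨w, ShortComplex.ShortExact.mk' ?_ h₁.mono_cokernelDesc ‹_›⟩
  let φ : ShortComplex.mk b d hbd ⟶ ShortComplex.mk (cokernel.desc a b hab) d w :=
    { τ₁ := cokernel.π a, τ₂ := 𝟙 _, τ₃ := 𝟙 _ }
  have : Epi φ.τ₁ := by dsimp [φ]; infer_instance
  have : IsIso φ.τ₂ := by dsimp [φ]; infer_instance
  have : Mono φ.τ₃ := by dsimp [φ]; infer_instance
  exact (ShortComplex.exact_iff_of_epi_of_isIso_of_mono φ).1 h₂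

theorem shortExact_kernel_factorThruImage {X Y : B} (f : X ⟶ Y) :
    (ShortComplex.mk (kernel.ι f) (Abelian.factorThruImage f)
      (by rw [← cancel_mono (Abelian.image.ι f)]; simp)).ShortExact := by
  obtain ⟨_, h⟩ := shortExact_kernel_of_exact (a := kernel.ι f) (b := f) (d := cokernel.π f)
    (kernel.condition f) (cokernel.condition f)
    (ShortComplex.exact_of_f_is_kernel _ (kernelIsKernel f))
    (ShortComplex.exact_of_g_is_cokernel _ (cokernelIsCokernel f))
  exact h

theorem shortExact_image_cokernel {X Y : B} (f : X ⟶ Y) :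
    (ShortComplex.mk (Abelian.image.ι f) (cokernel.π f) (kernel.condition _)).ShortExact :=
  ShortComplex.ShortExact.mk' (ShortComplex.exact_of_f_is_kernel _ (kernelIsKernel _))
    (by dsimp; infer_instance) (by dsimp; infer_instance)

namespace IsVolume

variable (hv : IsVolume P v)
include hv

theorem unitVolume_shortExact {S : ShortComplex B} (hS : S.ShortExact)
    (h₁ : HasUnitVolume P v S.X₁) (h₃ : HasUnitVolume P v S.X₃) :
    HasUnitVolume P v S.X₂ ∧ unitVolume P v S.X₂ = unitVolume P v S.X₁ * unitVolume P v S.X₃ := by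
  obtain ⟨p₁, u₁⟩ := h₁
  obtain ⟨p₃, u₃⟩ := h₃
  obtain ⟨p₂, e⟩ := hv.of_shortExact S hS p₁ p₃
  have u₂ : IsUnit (v _ p₂) := e ▸ u₁.mul u₃
  refine ⟨⟨p₂, u₂⟩, Units.ext ?_⟩
  rw [Units.val_mul, coe_unitVolume p₁ u₁, coe_unitVolume p₂ u₂, coe_unitVolume p₃ u₃, e]

theorem unitVolume_isZero {X : B} (hX : IsZero X) :
    HasUnitVolume P v X ∧ unitVolume P v X = 1 := by
  obtain ⟨p, e⟩ := hv.of_isZero X hX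
  have u : IsUnit (v X p) := e ▸ isUnit_one
  exact ⟨⟨p, u⟩, Units.ext (by rw [coe_unitVolume p u, e, Units.val_one])⟩

theorem unitVolume_iso {X Y : B} (e : X ≅ Y) (h : HasUnitVolume P v X) :
    HasUnitVolume P v Y ∧ unitVolume P v Y = unitVolume P v X := by
  -- An isomorphism is a short exact sequence with third term zero.
  have hS : (ShortComplex.mk e.hom (0 : Y ⟶ 0) (by simp)).ShortExact :=
    ShortComplex.ShortExact.mk'
      ((ShortComplex.exact_iff_epi _ (by simp)).2 (by dsimp; infer_instance))
      (by dsimp; infer_instance) ⟨fun _ _ _ => (isZero_zero B).eq_of_src _ _⟩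
  obtain ⟨h0, e0⟩ := hv.unitVolume_isZero (isZero_zero B)
  obtain ⟨h1, e1⟩ := hv.unitVolume_shortExact hS h h0
  exact ⟨h1, by simpa [e0] using e1⟩

/-- Both sides equal the product of the volumes of kernel, image and cokernel. The image has a
volume because it is the kernel of Y ⟶ Cok f. -/
theorem unitVolume_ker_mul {X Y : B} (f : X ⟶ Y) (hX : HasUnitVolume P v X)
    (hY : HasUnitVolume P v Y) :
    unitVolume P v (kernel f) * unitVolume P v Y =
      unitVolume P v X * unitVolume P v (cokernel f) := by
  have hk := hv.kernel_mem f hX hY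
  have hc := hv.cokernel_mem f hX hY
  have hi : HasUnitVolume P v (Abelian.image f) := hv.kernel_mem _ hY hc
  have s₁ := shortExact_kernel_factorThruImage f
  have s₂ := shortExact_image_cokernel f
  have e₁ := (hv.unitVolume_shortExact s₁ hk hi).2
  have e₂ := (hv.unitVolume_shortExact s₂ hi hc).2
  dsimp at e₁ e₂
  rw [e₁, e₂, mul_assoc]

end IsVolume

theorem isFredholm_iff {X Y : B} {f : X ⟶ Y} :
    IsFredholm P v f ↔ HasUnitVolume P v (kernel f) ∧ HasUnitVolume P v (cokernel f) :=
  ⟨fun h => ⟨⟨h.ker_mem, h.isUnit_ker⟩, ⟨h.cok_mem, h.isUnit_cok⟩⟩,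
    fun ⟨⟨h₁, h₂⟩, ⟨h₃, h₄⟩⟩ => ⟨h₁, h₃, h₂, h₄⟩⟩

theorem IsFredholm.index_eq {X Y : B} {f : X ⟶ Y} (h : IsFredholm P v f) :
    h.index = ((unitVolume P v (cokernel f) * (unitVolume P v (kernel f))⁻¹ : Mˣ) : M) := by
  have h₁ : h.isUnit_ker.unit = unitVolume P v (kernel f) :=
    Units.ext (by rw [coe_unitVolume _ h.isUnit_ker, IsUnit.unit_spec])
  rw [IsFredholm.index, Units.val_mul, coe_unitVolume _ h.isUnit_cok, h₁]

namespace IsVolume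

variable (hv : IsVolume P v) {X Y Z : B} (f : X ⟶ Y) (g : Y ⟶ Z)

open kernelCokernelCompSequence

/-- The part of the kernel-cokernel sequence of a composite to the left of δ; the next lemma is the
part to the right. -/
theorem shortExact_kernel_comp :
    ∃ w, (ShortComplex.mk (kernel.map f (f ≫ g) (𝟙 _) g (by simp) : kernel f ⟶ kernel (f ≫ g))
      (kernel.lift (δ f g) (kernel.map (f ≫ g) g f (𝟙 _) (by simp))
        (snakeInput f g).L₀_g_δ) w).ShortExact :=
  shortExact_kernel_of_exact _ _ (snakeInput f g).L₀_exact (snakeInput f g).L₁'_exact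

theorem shortExact_cokernel_comp :
    ∃ w, (ShortComplex.mk (cokernel.desc (δ f g) (cokernel.map f (f ≫ g) (𝟙 _) g (by simp))
        (snakeInput f g).δ_L₃_f)
      (cokernel.map (f ≫ g) g f (𝟙 _) (by simp) : cokernel (f ≫ g) ⟶ cokernel g) w).ShortExact :=
  shortExact_cokernel_of_exact _ _ (snakeInput f g).L₂'_exact (snakeInput f g).L₃_exact

include hv

theorem isFredholm_id : ∃ h : IsFredholm P v (𝟙 X), h.index = 1 := by
  obtain ⟨h₁, e₁⟩ := hv.unitVolume_isZero (isZero_kernel_of_mono (𝟙 X))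
  obtain ⟨h₂, e₂⟩ := hv.unitVolume_isZero (isZero_cokernel_of_epi (𝟙 X))
  refine ⟨isFredholm_iff.2 ⟨h₁, h₂⟩, ?_⟩
  rw [IsFredholm.index_eq, e₁, e₂]
  simp

variable {f g}

/-- Ker(f ≫ g) is an extension of Ker δ by Ker f, and Cok(f ≫ g) one of Cok g by Cok δ. The volumes
of Ker δ and Cok δ enter the index only through their ratio, which `unitVolume_ker_mul` expresses by
Ker g and Cok f. -/
theorem isFredholm_comp (hf : IsFredholm P v f) (hg : IsFredholm P v g) :
    ∃ h : IsFredholm P v (f ≫ g), h.index = hg.index * hf.index := by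
  obtain ⟨f₁, f₂⟩ := isFredholm_iff.1 hf
  obtain ⟨g₁, g₂⟩ := isFredholm_iff.1 hg
  obtain ⟨_, s₁⟩ := shortExact_kernel_comp f g
  obtain ⟨_, s₂⟩ := shortExact_cokernel_comp f g
  obtain ⟨h₁, e₁⟩ := hv.unitVolume_shortExact s₁ f₁ (hv.kernel_mem _ g₁ f₂)
  obtain ⟨h₂, e₂⟩ := hv.unitVolume_shortExact s₂ (hv.cokernel_mem _ g₁ f₂) g₂
  have e₃ := hv.unitVolume_ker_mul (δ f g) g₁ f₂
  refine ⟨isFredholm_iff.2 ⟨h₁, h₂⟩, ?_⟩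
  dsimp at e₁ e₂
  rw [IsFredholm.index_eq, IsFredholm.index_eq, IsFredholm.index_eq, ← Units.val_mul, e₁, e₂]
  congr 1
  rw [← mul_inv_eq_iff_eq_mul] at e₃
  -- Multiplication by the volumes of the three kernels clears all inverses.
  rw [← mul_right_inj (unitVolume P v (kernel f)), ← mul_right_inj (unitVolume P v (kernel g)),
    ← mul_right_inj (unitVolume P v (kernel (δ f g)))]
  rw [mul_inv_eq_iff_eq_mul] at e₃
  calc _ = (unitVolume P v (kernel g) * unitVolume P v (cokernel (δ f g))) *
        unitVolume P v (cokernel g) := by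
        rw [mul_inv]
        simp only [mul_comm, mul_left_comm, mul_assoc, mul_inv_cancel_left, mul_inv_cancel, one_mul]
    _ = _ := by
        rw [← e₃]
        simp only [mul_comm, mul_left_comm, mul_assoc, mul_inv_cancel_left, mul_inv_cancel, one_mul]

/-- With Ker f = 0 the sequence starts at Ker(f ≫ g). So Ker g is an extension of Ker a by Ker(f ≫
g) and Cok g is Cok a, where a : Cok f ⟶ Cok(f ≫ g) is a map between objects of invertible volume.
-/
theorem isFredholm_of_comp (hf : IsFredholm P v f) [Mono f] (hfg : IsFredholm P v (f ≫ g)) :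
    IsFredholm P v g := by
  obtain ⟨f₁, f₂⟩ := isFredholm_iff.1 hf
  obtain ⟨g₁, g₂⟩ := isFredholm_iff.1 hfg
  have m : Mono (snakeInput f g).L₀.g := by
    refine (snakeInput f g).L₀_exact.mono_g ?_
    exact (isZero_kernel_of_mono f).eq_of_src _ _
  let a : cokernel f ⟶ cokernel (f ≫ g) := cokernel.map f (f ≫ g) (𝟙 _) g (by simp)
  obtain ⟨_, s₁⟩ := shortExact_kernel_of_exact _ _ (snakeInput f g).L₁'_exact
    (snakeInput f g).L₂'_exact
  have h₁ := (hv.unitVolume_shortExact s₁ g₁ (hv.kernel_mem a f₂ g₂)).1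
  have s₂ := (snakeInput f g).L₃_exact
  have ep : Epi (snakeInput f g).L₃.g :=
    inferInstanceAs (Epi (cokernel.map (f ≫ g) g f (𝟙 _) (by simp)))
  have e : cokernel a ≅ cokernel g := s₂.gIsCokernel.coconePointUniqueUpToIso
    (cokernelIsCokernel a) |>.symm
  exact isFredholm_iff.2 ⟨h₁, (hv.unitVolume_iso e (hv.cokernel_mem a f₂ g₂)).1⟩

/-- The inclusion of Ker e has zero kernel and cokernel isomorphic to the image of e, hence is
Fredholm. Composed with it, f and g become equal, and its index can be cancelled. -/
theorem isFredholm_of_finite_perturbation {f g e : X ⟶ Y} (hf : IsFredholm P v f)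
    (he : IsFinite P v e) (hfg : kernel.ι e ≫ f = kernel.ι e ≫ g) :
    ∃ h : IsFredholm P v g, h.index = hf.index := by
  have hi : HasUnitVolume P v (Abelian.image e) := ⟨he.im_mem, he.isUnit_im⟩
  have hk : IsFredholm P v (kernel.ι e) := isFredholm_iff.2
    ⟨(hv.unitVolume_isZero (isZero_kernel_of_mono _)).1,
      (hv.unitVolume_iso (Abelian.coimageIsoImage e).symm hi).1⟩
  obtain ⟨h₁, e₁⟩ := hv.isFredholm_comp hk hf
  have h₂ : IsFredholm P v (kernel.ι e ≫ g) := hfg ▸ h₁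
  have h₃ := hv.isFredholm_of_comp hk h₂
  obtain ⟨h₄, e₄⟩ := hv.isFredholm_comp hk h₃
  refine ⟨h₃, ?_⟩
  have e₅ : h₄.index = h₁.index := by
    simp only [IsFredholm.index_eq, hfg]
  rw [e₁, e₄] at e₅
  have hu : IsUnit hk.index := by rw [IsFredholm.index_eq]; exact Units.isUnit _
  exact hu.mul_left_injective e₅

end IsVolume

end Volume

end HopfFredholm

/-! ### Normalized integrals imply smallness -/

namespace HopfFredholm

theorem exists_splitting {C : Type u} [Category.{v} C] [HasEqualizers C] {X : C} (e : X ⟶ X) (he : e ≫ e = e) :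
    ∃ (I : C) (i : I ⟶ X) (p : X ⟶ I), i ≫ p = 𝟙 I ∧ p ≫ i = e := by
  have : IsIdempotentComplete C := by
    rw [Idempotents.isIdempotentComplete_iff_hasEqualizer_of_id_and_idempotent]
    intros; infer_instance
  obtain ⟨I, i, p, h₁, h₂⟩ := IsIdempotentComplete.idempotents_split X e he
  exact ⟨I, i, p, h₁, h₂⟩

variable {C : Type u} [Category.{v} C] [MonoidalCategory C]

theorem trivLeftAct_natural (A : C) [ComonObj A] {X Z : C} (f : X ⟶ Z) :
    A ◁ f ≫ trivLeftAct A Z = trivLeftAct A X ≫ f := by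
  simp [trivLeftAct, whisker_exchange_assoc]

theorem trivRightAct_natural (A : C) [ComonObj A] {X Z : C} (f : X ⟶ Z) :
    f ▷ A ≫ trivRightAct A Z = trivRightAct A X ≫ f := by
  simp [trivRightAct, ← whisker_exchange_assoc]

theorem trivLeftCoact_natural (B : C) [MonObj B] {X Z : C} (f : X ⟶ Z) :
    trivLeftCoact B X ≫ B ◁ f = f ≫ trivLeftCoact B Z := by
  simp [trivLeftCoact, ← whisker_exchange]

theorem trivRightCoact_natural (B : C) [MonObj B] {X Z : C} (f : X ⟶ Z) :
    trivRightCoact B X ≫ f ▷ B = f ≫ trivRightCoact B Z := by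
  simp [trivRightCoact, whisker_exchange]

theorem tensorHom_trivLeftAct {A A' X X' : C} [ComonObj A] [ComonObj A'] {f : A ⟶ A'}
    (hf : f ≫ ε[A'] = ε[A]) (g : X ⟶ X') :
    (f ⊗ₘ g) ≫ trivLeftAct A' X' = trivLeftAct A X ≫ g := by
  rw [trivLeftAct, MonoidalCategory.tensorHom_def', Category.assoc, ← comp_whiskerRight_assoc, hf,
    ← trivLeftAct_natural, trivLeftAct]

theorem trivLeftCoact_tensorHom {B B' Y Y' : C} [MonObj B] [MonObj B'] {f : B ⟶ B'}
    (hf : η[B] ≫ f = η[B']) (g : Y ⟶ Y') :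
    trivLeftCoact B Y ≫ (f ⊗ₘ g) = g ≫ trivLeftCoact B' Y' := by
  rw [trivLeftCoact, MonoidalCategory.tensorHom_def, Category.assoc, ← comp_whiskerRight_assoc, hf,
    ← trivLeftCoact_natural, trivLeftCoact, Category.assoc]

variable [SymmetricCategory C]

section Small

theorem IsNormalizedIntegral.whiskerLeft_mul {A : C} [BimonObj A] {σ : 𝟙_ C ⟶ A}
    (hσ : IsNormalizedIntegral σ) : A ◁ σ ≫ μ[A] = (ρ_ A).hom ≫ ε[A] ≫ σ := by
  rw [← id_tensorHom, hσ.right, MonoidalCategory.tensorHom_def, Category.assoc,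
    leftUnitor_naturality]
  simp [unitors_equal]

theorem IsNormalizedIntegral.whiskerRight_mul {A : C} [BimonObj A] {σ : 𝟙_ C ⟶ A}
    (hσ : IsNormalizedIntegral σ) : σ ▷ A ≫ μ[A] = (λ_ A).hom ≫ ε[A] ≫ σ := by
  rw [← tensorHom_id, hσ.left, MonoidalCategory.tensorHom_def', Category.assoc,
    rightUnitor_naturality]
  simp [unitors_inv_equal]

theorem IsNormalizedCointegral.comul_whiskerLeft {A : C} [BimonObj A] {τ : A ⟶ 𝟙_ C}
    (hτ : IsNormalizedCointegral τ) : Δ[A] ≫ A ◁ τ = τ ≫ η[A] ≫ (ρ_ A).inv := by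
  rw [← id_tensorHom, hτ.right, MonoidalCategory.tensorHom_def',
    ← leftUnitor_inv_naturality_assoc]
  simp [unitors_inv_equal]

theorem IsNormalizedCointegral.comul_whiskerRight {A : C} [BimonObj A] {τ : A ⟶ 𝟙_ C}
    (hτ : IsNormalizedCointegral τ) : Δ[A] ≫ τ ▷ A = τ ≫ η[A] ≫ (λ_ A).inv := by
  rw [← tensorHom_id, hτ.left, MonoidalCategory.tensorHom_def,
    ← rightUnitor_inv_naturality_assoc]
  simp [← unitors_inv_equal]

/-- Acting by an integral is invariant. -/
theorem IsNormalizedIntegral.act_average {A X : C} [BimonObj A] {σ : 𝟙_ C ⟶ A}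
    (hσ : IsNormalizedIntegral σ) {α : A ⊗ X ⟶ X} (hα : IsLeftAction α) :
    α ≫ (λ_ X).inv ≫ σ ▷ X ≫ α = trivLeftAct A X ≫ (λ_ X).inv ≫ σ ▷ X ≫ α := by
  have := congr((λ_ (A ⊗ X)).inv ≫ (α_ (𝟙_ C) A X).inv ≫ $(hσ.whiskerRight_mul) ▷ X ≫ α)
  simp only [comp_whiskerRight, Category.assoc, hα.assoc] at this
  rw [leftUnitor_inv_naturality_assoc, whisker_exchange_assoc]
  simpa [trivLeftAct] using this

/-- Coacting by a cointegral is invariant. -/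
theorem IsNormalizedCointegral.average_coact {A X : C} [BimonObj A] {τ : A ⟶ 𝟙_ C}
    (hτ : IsNormalizedCointegral τ) {β : X ⟶ A ⊗ X} (hβ : IsLeftCoaction β) :
    (β ≫ τ ▷ X ≫ (λ_ X).hom) ≫ β = (β ≫ τ ▷ X ≫ (λ_ X).hom) ≫ trivLeftCoact A X := by
  have := congr(β ≫ $(hτ.comul_whiskerRight) ▷ X ≫ (α_ (𝟙_ C) A X).hom ≫ (λ_ (A ⊗ X)).hom)
  simp only [comp_whiskerRight, Category.assoc, reassoc_of% hβ.coassoc] at this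
  simp only [Category.assoc]
  rw [← leftUnitor_naturality, ← whisker_exchange_assoc]
  simpa [trivLeftCoact] using this

variable [HasEqualizers C]

/-- Acting by σ is an idempotent e of X. It takes values in the invariants (`e₁`), factors through
the coinvariants (`e₂`), fixes invariant maps (`e₃`) and is absorbed by coinvariant ones (`e₄`).
Idempotents split since equalizers exist, and the splitting is at once the invariant and the
stabilized object. -/
theorem isSmall_of_integral {A : C} [BimonObj A] {σ : 𝟙_ C ⟶ A} (hσ : IsNormalizedIntegral σ) :
    IsSmall A where
  left {X} α hα := by
    have h₃ := hσ.normalized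
    let e : X ⟶ X := (λ_ X).inv ≫ σ ▷ X ≫ α
    have e₁ : A ◁ e ≫ α = trivLeftAct A X ≫ e := by
      have := congr((A ◁ (λ_ X).inv) ≫ (α_ A (𝟙_ C) X).inv ≫ $(hσ.whiskerLeft_mul) ▷ X ≫ α)
      simp only [comp_whiskerRight, Category.assoc, hα.assoc] at this
      simpa [e, trivLeftAct] using this
    have e₂ : α ≫ e = trivLeftAct A X ≫ e := hσ.act_average hα
    have e₃ : ∀ {Z : C} (f : Z ⟶ X), A ◁ f ≫ α = trivLeftAct A Z ≫ f → f ≫ e = f := by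
      intro Z f hf
      simp only [e]
      rw [leftUnitor_inv_naturality_assoc, whisker_exchange_assoc, hf]
      simp [trivLeftAct, ← comp_whiskerRight_assoc, h₃]
    have e₄ : ∀ {Z : C} (f : X ⟶ Z), α ≫ f = trivLeftAct A X ≫ f → e ≫ f = f := by
      intro Z f hf
      simp only [e, Category.assoc, hf]
      simp [trivLeftAct, ← comp_whiskerRight_assoc, h₃]
    clear_value e
    obtain ⟨I, i, p, hip, hpi⟩ := exists_splitting e (e₃ e e₁)
    have hi : i ≫ e = i := by rw [← hpi, reassoc_of% hip]
    have hp : e ≫ p = p := by rw [← hpi, Category.assoc, hip, Category.comp_id]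
    have hm : Mono i := mono_of_mono_fac hip
    have hep : Epi p := epi_of_epi_fac hip
    have w : α ≫ p = trivLeftAct A X ≫ p := by rw [← hp, reassoc_of% e₂]
    refine ⟨I, I, i, p, ⟨?_, fun f hf => ⟨f ≫ p, ?_, ?_⟩⟩, ⟨w, ⟨?_⟩⟩, ?_⟩
    · rw [← hi, MonoidalCategory.whiskerLeft_comp, Category.assoc, e₁, hi,
        ← trivLeftAct_natural, ← trivLeftAct_natural, ← MonoidalCategory.whiskerLeft_comp_assoc, hi]
    · dsimp; rw [Category.assoc, hpi, e₃ f hf]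
    · intro g hg; rw [← hg, Category.assoc, hip, Category.comp_id]
    · exact Cofork.IsColimit.mk' _ fun s => ⟨i ≫ s.π, by
        dsimp; rw [reassoc_of% hpi]; exact e₄ _ s.condition, fun {m} hm => by
          rw [← cancel_epi p]; erw [hm]; rw [reassoc_of% hpi]; exact (e₄ _ s.condition).symm⟩
    · rw [hip]; infer_instance
  right {X} α hα := by
    have h₃ := hσ.normalized
    let e : X ⟶ X := (ρ_ X).inv ≫ X ◁ σ ≫ α
    have e₁ : e ▷ A ≫ α = trivRightAct A X ≫ e := by
      have := congr(((ρ_ X).inv ▷ A) ≫ (α_ X (𝟙_ C) A).hom ≫ X ◁ $(hσ.whiskerRight_mul) ≫ α)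
      simp only [MonoidalCategory.whiskerLeft_comp, Category.assoc, hα.assoc] at this
      simpa [e, trivRightAct] using this
    have e₂ : α ≫ e = trivRightAct A X ≫ e := by
      have := congr((ρ_ (X ⊗ A)).inv ≫ (α_ X A (𝟙_ C)).hom ≫ X ◁ $(hσ.whiskerLeft_mul) ≫ α)
      simp only [MonoidalCategory.whiskerLeft_comp, Category.assoc, hα.assoc] at this
      simp only [e]
      rw [rightUnitor_inv_naturality_assoc, ← whisker_exchange_assoc]
      simpa [trivRightAct] using this
    have e₃ : ∀ {Z : C} (f : Z ⟶ X), f ▷ A ≫ α = trivRightAct A Z ≫ f → f ≫ e = f := by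
      intro Z f hf
      simp only [e]
      rw [rightUnitor_inv_naturality_assoc, ← whisker_exchange_assoc, hf]
      simp [trivRightAct, ← MonoidalCategory.whiskerLeft_comp_assoc, h₃]
    have e₄ : ∀ {Z : C} (f : X ⟶ Z), α ≫ f = trivRightAct A X ≫ f → e ≫ f = f := by
      intro Z f hf
      simp only [e, Category.assoc, hf]
      simp [trivRightAct, ← MonoidalCategory.whiskerLeft_comp_assoc, h₃]
    clear_value e
    obtain ⟨I, i, p, hip, hpi⟩ := exists_splitting e (e₃ e e₁)
    have hi : i ≫ e = i := by rw [← hpi, reassoc_of% hip]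
    have hp : e ≫ p = p := by rw [← hpi, Category.assoc, hip, Category.comp_id]
    have hep : Epi p := epi_of_epi_fac hip
    have w : α ≫ p = trivRightAct A X ≫ p := by rw [← hp, reassoc_of% e₂]
    refine ⟨I, I, i, p, ⟨?_, fun f hf => ⟨f ≫ p, ?_, ?_⟩⟩, ⟨w, ⟨?_⟩⟩, ?_⟩
    · rw [← hi, comp_whiskerRight, Category.assoc, e₁, hi,
        ← trivRightAct_natural, ← trivRightAct_natural, ← comp_whiskerRight_assoc, hi]
    · dsimp; rw [Category.assoc, hpi, e₃ f hf]
    · intro g hg; rw [← hg, Category.assoc, hip, Category.comp_id]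
    · exact Cofork.IsColimit.mk' _ fun s => ⟨i ≫ s.π, by
        dsimp; rw [reassoc_of% hpi]; exact e₄ _ s.condition, fun {m} hm => by
          rw [← cancel_epi p]; erw [hm]; rw [reassoc_of% hpi]; exact (e₄ _ s.condition).symm⟩
    · rw [hip]; infer_instance

/-- Dually, contracting a coaction with τ is an idempotent whose splitting serves as both objects.
-/
theorem isCosmall_of_cointegral {A : C} [BimonObj A] {τ : A ⟶ 𝟙_ C}
    (hτ : IsNormalizedCointegral τ) : IsCosmall A where
  left {X} β hβ := by
    have h₃ := hτ.normalized
    let e : X ⟶ X := β ≫ τ ▷ X ≫ (λ_ X).hom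
    have e₁ : β ≫ A ◁ e = e ≫ trivLeftCoact A X := by
      have := congr(β ≫ $(hτ.comul_whiskerLeft) ▷ X ≫ (α_ A (𝟙_ C) X).hom ≫ A ◁ (λ_ X).hom)
      simp only [comp_whiskerRight, Category.assoc, reassoc_of% hβ.coassoc] at this
      simpa [e, trivLeftCoact] using this
    have e₂ : e ≫ β = e ≫ trivLeftCoact A X := hτ.average_coact hβ
    have e₃ : ∀ {Z : C} (f : X ⟶ Z), β ≫ A ◁ f = f ≫ trivLeftCoact A Z → e ≫ f = f := by
      intro Z f hf
      simp only [e, Category.assoc]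
      rw [← leftUnitor_naturality, ← whisker_exchange_assoc, reassoc_of% hf]
      simp [trivLeftCoact, ← comp_whiskerRight_assoc, h₃]
    have e₄ : ∀ {Z : C} (f : Z ⟶ X), f ≫ β = f ≫ trivLeftCoact A X → f ≫ e = f := by
      intro Z f hf
      simp only [e, reassoc_of% hf]
      simp [trivLeftCoact, ← comp_whiskerRight_assoc, h₃]
    clear_value e
    obtain ⟨I, i, p, hip, hpi⟩ := exists_splitting e (e₃ e e₁)
    have hi : i ≫ e = i := by rw [← hpi, reassoc_of% hip]
    have hp : e ≫ p = p := by rw [← hpi, Category.assoc, hip, Category.comp_id]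
    have hm : Mono i := mono_of_mono_fac hip
    have w : i ≫ β = i ≫ trivLeftCoact A X := by
      rw [← hi, Category.assoc, Category.assoc, e₂]
    refine ⟨I, I, i, p, ⟨w, ⟨?_⟩⟩, ⟨?_, fun f hf => ⟨i ≫ f, ?_, ?_⟩⟩, ?_⟩
    · exact Fork.IsLimit.mk' _ fun s => ⟨s.ι ≫ p, by
        dsimp; rw [Category.assoc, hpi]; exact e₄ _ s.condition, fun {m} hm => by
          rw [← cancel_mono i]; erw [hm]; rw [Category.assoc, hpi]
          exact (e₄ _ s.condition).symm⟩
    · have := congr($e₁ ≫ A ◁ p)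
      rwa [Category.assoc, Category.assoc, ← MonoidalCategory.whiskerLeft_comp, hp,
        trivLeftCoact_natural, reassoc_of% hp] at this
    · dsimp; rw [reassoc_of% hpi, e₃ f hf]
    · intro g hg; rw [← hg, reassoc_of% hip]
    · rw [hip]; infer_instance
  right {X} β hβ := by
    have h₃ := hτ.normalized
    let e : X ⟶ X := β ≫ X ◁ τ ≫ (ρ_ X).hom
    have e₁ : β ≫ e ▷ A = e ≫ trivRightCoact A X := by
      have := congr(β ≫ X ◁ $(hτ.comul_whiskerRight) ≫ (α_ X (𝟙_ C) A).inv ≫ (ρ_ X).hom ▷ A)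
      simp only [MonoidalCategory.whiskerLeft_comp, Category.assoc, reassoc_of% hβ.coassoc] at this
      simpa [e, trivRightCoact] using this
    have e₂ : e ≫ β = e ≫ trivRightCoact A X := by
      have := congr(β ≫ X ◁ $(hτ.comul_whiskerLeft) ≫ (α_ X A (𝟙_ C)).inv ≫ (ρ_ (X ⊗ A)).hom)
      simp only [MonoidalCategory.whiskerLeft_comp, Category.assoc, reassoc_of% hβ.coassoc] at this
      simp only [e, Category.assoc]
      rw [← rightUnitor_naturality, whisker_exchange_assoc]
      simpa [trivRightCoact] using this
    have e₃ : ∀ {Z : C} (f : X ⟶ Z), β ≫ f ▷ A = f ≫ trivRightCoact A Z → e ≫ f = f := by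
      intro Z f hf
      simp only [e, Category.assoc]
      rw [← rightUnitor_naturality, whisker_exchange_assoc, reassoc_of% hf]
      simp [trivRightCoact, ← MonoidalCategory.whiskerLeft_comp_assoc, h₃]
    have e₄ : ∀ {Z : C} (f : Z ⟶ X), f ≫ β = f ≫ trivRightCoact A X → f ≫ e = f := by
      intro Z f hf
      simp only [e, reassoc_of% hf]
      simp [trivRightCoact, ← MonoidalCategory.whiskerLeft_comp_assoc, h₃]
    clear_value e
    obtain ⟨I, i, p, hip, hpi⟩ := exists_splitting e (e₃ e e₁)
    have hi : i ≫ e = i := by rw [← hpi, reassoc_of% hip]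
    have hp : e ≫ p = p := by rw [← hpi, Category.assoc, hip, Category.comp_id]
    have hm : Mono i := mono_of_mono_fac hip
    have w : i ≫ β = i ≫ trivRightCoact A X := by
      rw [← hi, Category.assoc, Category.assoc, e₂]
    refine ⟨I, I, i, p, ⟨w, ⟨?_⟩⟩, ⟨?_, fun f hf => ⟨i ≫ f, ?_, ?_⟩⟩, ?_⟩
    · exact Fork.IsLimit.mk' _ fun s => ⟨s.ι ≫ p, by
        dsimp; rw [Category.assoc, hpi]; exact e₄ _ s.condition, fun {m} hm => by
          rw [← cancel_mono i]; erw [hm]; rw [Category.assoc, hpi]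
          exact (e₄ _ s.condition).symm⟩
    · have := congr($e₁ ≫ p ▷ A)
      rwa [Category.assoc, Category.assoc, ← comp_whiskerRight, hp,
        trivRightCoact_natural, reassoc_of% hp] at this
    · dsimp; rw [reassoc_of% hpi, e₃ f hf]
    · intro g hg; rw [← hg, reassoc_of% hip]
    · rw [hip]; infer_instance

theorem isBismall_of_integrals {A : C} [BimonObj A] {σ : 𝟙_ C ⟶ A} {τ : A ⟶ 𝟙_ C}
    (hσ : IsNormalizedIntegral σ) (hτ : IsNormalizedCointegral τ) : IsBismall A :=
  ⟨isSmall_of_integral hσ, isCosmall_of_cointegral hτ⟩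

end Small

/-- The definition uses chosen integrals; by uniqueness any normalized pair computes the same value.
-/
theorem IsBismall.invVol_eq {A : C} [BimonObj A] (h : IsBismall A) {σ : 𝟙_ C ⟶ A} {τ : A ⟶ 𝟙_ C}
    (hσ : IsNormalizedIntegral σ) (hτ : IsNormalizedCointegral τ) : h.invVol = σ ≫ τ := by
  have h₁ := h.small.exists_normalizedIntegral.choose_spec
  have h₂ := h.cosmall.exists_normalizedCointegral.choose_spec
  rw [← eq_of_left_right_integral h₁.left h₁.normalized hσ.right hσ.normalized,
    ← eq_of_left_right_cointegral h₂.left h₂.normalized hτ.right hτ.normalized]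
  rfl

end HopfFredholm

/-! ### Equalizers and coequalizers stable under the tensor product -/

namespace HopfFredholm

variable {C : Type u} [Category.{v} C] [MonoidalCategory C]

section Stable

/-- `q` is a coequalizer of `a` and `b`, and it remains so after tensoring with any object. -/
structure IsStableCoequalizer {X Y Q : C} (a b : X ⟶ Y) (q : Y ⟶ Q) : Prop where
  w : a ≫ q = b ≫ q
  epi : ∀ Z : C, Epi (Z ◁ q)
  desc : ∀ {Z W : C} (g : Z ⊗ Y ⟶ W), Z ◁ a ≫ g = Z ◁ b ≫ g → ∃ g' : Z ⊗ Q ⟶ W, Z ◁ q ≫ g' = g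

/-- `i` is an equalizer of `a` and `b`, and it remains so after tensoring with any object. -/
structure IsStableEqualizer {X Y E : C} (a b : X ⟶ Y) (i : E ⟶ X) : Prop where
  w : i ≫ a = i ≫ b
  mono : ∀ Z : C, Mono (Z ◁ i)
  lift : ∀ {Z W : C} (g : W ⟶ Z ⊗ X), g ≫ Z ◁ a = g ≫ Z ◁ b → ∃ g' : W ⟶ Z ⊗ E, g' ≫ Z ◁ i = g

/-- A morphism all of whose tensor products with objects are epimorphisms. -/
def StableEpi {Y Q : C} (q : Y ⟶ Q) : Prop := ∀ Z : C, Epi (Z ◁ q)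

/-- A morphism all of whose tensor products with objects are monomorphisms. -/
def StableMono {E X : C} (i : E ⟶ X) : Prop := ∀ Z : C, Mono (Z ◁ i)

namespace StableEpi

theorem epi {Y Q : C} {q : Y ⟶ Q} (h : StableEpi q) : Epi q := by
  have := h (𝟙_ C)
  have e : q = (λ_ Y).inv ≫ 𝟙_ C ◁ q ≫ (λ_ Q).hom := by simp
  rw [e]; infer_instance

theorem whiskerRight [BraidedCategory C] {Y Q : C} {q : Y ⟶ Q} (h : StableEpi q) (Z : C) :
    Epi (q ▷ Z) := by
  have := h Z
  have e : q ▷ Z = (β_ Y Z).hom ≫ Z ◁ q ≫ (β_ Q Z).inv := by simp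
  rw [e]; infer_instance

theorem tensor [BraidedCategory C] {Y Q : C} {q : Y ⟶ Q} (h : StableEpi q) {Y' Q' : C}
    {q' : Y' ⟶ Q'} (h' : StableEpi q') : StableEpi (q ⊗ₘ q') := by
  intro Z
  have := h Z
  have := h' (Z ⊗ Q)
  have e : Z ◁ (q ⊗ₘ q') = (α_ Z Y Y').inv ≫ (Z ◁ q) ▷ Y' ≫ (Z ⊗ Q) ◁ q' ≫ (α_ Z Q Q').hom := by
    simp [MonoidalCategory.tensorHom_def]
  have e' : Epi ((Z ◁ q) ▷ Y') := by
    have := h (Y' ⊗ Z)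
    have e₁ : Y' ◁ Z ◁ q = (α_ _ _ _).inv ≫ (Y' ⊗ Z) ◁ q ≫ (α_ _ _ _).hom := by simp
    have : Epi (Y' ◁ Z ◁ q) := by rw [e₁]; infer_instance
    have e₂ : (Z ◁ q) ▷ Y' = (β_ (Z ⊗ Y) Y').hom ≫ Y' ◁ Z ◁ q ≫ (β_ (Z ⊗ Q) Y').inv := by
      rw [← BraidedCategory.braiding_naturality_left_assoc, Iso.hom_inv_id, Category.comp_id]
    rw [e₂]; infer_instance
  rw [e]; infer_instance

end StableEpi

namespace StableMono

theorem mono {Y Q : C} {q : Y ⟶ Q} (h : StableMono q) : Mono q := by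
  have := h (𝟙_ C)
  have e : q = (λ_ Y).inv ≫ 𝟙_ C ◁ q ≫ (λ_ Q).hom := by simp
  rw [e]; infer_instance

theorem whiskerRight [BraidedCategory C] {Y Q : C} {q : Y ⟶ Q} (h : StableMono q) (Z : C) :
    Mono (q ▷ Z) := by
  have := h Z
  have e : q ▷ Z = (β_ Y Z).hom ≫ Z ◁ q ≫ (β_ Q Z).inv := by simp
  rw [e]; infer_instance

theorem tensor [BraidedCategory C] {Y Q : C} {q : Y ⟶ Q} (h : StableMono q) {Y' Q' : C}
    {q' : Y' ⟶ Q'} (h' : StableMono q') : StableMono (q ⊗ₘ q') := by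
  intro Z
  have := h Z
  have := h' (Z ⊗ Q)
  have e : Z ◁ (q ⊗ₘ q') = (α_ Z Y Y').inv ≫ (Z ◁ q) ▷ Y' ≫ (Z ⊗ Q) ◁ q' ≫ (α_ Z Q Q').hom := by
    simp [MonoidalCategory.tensorHom_def]
  have e' : Mono ((Z ◁ q) ▷ Y') := by
    have := h (Y' ⊗ Z)
    have e₁ : Y' ◁ Z ◁ q = (α_ _ _ _).inv ≫ (Y' ⊗ Z) ◁ q ≫ (α_ _ _ _).hom := by simp
    have : Mono (Y' ◁ Z ◁ q) := by rw [e₁]; infer_instance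
    have e₂ : (Z ◁ q) ▷ Y' = (β_ (Z ⊗ Y) Y').hom ≫ Y' ◁ Z ◁ q ≫ (β_ (Z ⊗ Q) Y').inv := by
      rw [← BraidedCategory.braiding_naturality_left_assoc, Iso.hom_inv_id, Category.comp_id]
    rw [e₂]; infer_instance
  rw [e]; infer_instance

end StableMono

namespace IsStableCoequalizer

variable {X Y Q : C} {a b : X ⟶ Y} {q : Y ⟶ Q} (h : IsStableCoequalizer a b q)
include h

theorem stableEpi : StableEpi q := h.epi

theorem desc_right [SymmetricCategory C] {Z W : C} (g : Y ⊗ Z ⟶ W) (hg : a ▷ Z ≫ g = b ▷ Z ≫ g) :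
    ∃ g' : Q ⊗ Z ⟶ W, q ▷ Z ≫ g' = g := by
  obtain ⟨g', hg'⟩ := h.desc ((β_ Z Y).hom ≫ g) (by simp [hg])
  exact ⟨(β_ Q Z).hom ≫ g', by simp [hg']⟩

theorem desc_self {W : C} (g : Y ⟶ W) (hg : a ≫ g = b ≫ g) : ∃ g' : Q ⟶ W, q ≫ g' = g := by
  obtain ⟨g', hg'⟩ := h.desc ((λ_ Y).hom ≫ g) (by simp [hg])
  exact ⟨(λ_ Q).inv ≫ g', by rw [leftUnitor_inv_naturality_assoc, hg']; simp⟩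

theorem of_iso {D : C} (d : Q ⟶ D) [IsIso d] : IsStableCoequalizer a b (q ≫ d) where
  w := by rw [reassoc_of% h.w]
  epi Z := by
    have := h.epi Z
    rw [MonoidalCategory.whiskerLeft_comp]; infer_instance
  desc {Z W} g hg := by
    obtain ⟨g', hg'⟩ := h.desc g hg
    exact ⟨Z ◁ inv d ≫ g', by rw [← MonoidalCategory.whiskerLeft_comp_assoc]; simpa⟩

end IsStableCoequalizer

namespace IsStableEqualizer

variable {X Y E : C} {a b : X ⟶ Y} {i : E ⟶ X} (h : IsStableEqualizer a b i)
include h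

theorem stableMono : StableMono i := h.mono

theorem lift_right [SymmetricCategory C] {Z W : C} (g : W ⟶ X ⊗ Z) (hg : g ≫ a ▷ Z = g ≫ b ▷ Z) :
    ∃ g' : W ⟶ E ⊗ Z, g' ≫ i ▷ Z = g := by
  obtain ⟨g', hg'⟩ := h.lift (g ≫ (β_ X Z).hom) (by
    simp only [Category.assoc, ← BraidedCategory.braiding_naturality_left, reassoc_of% hg])
  exact ⟨g' ≫ (β_ Z E).hom, by
    rw [Category.assoc, ← BraidedCategory.braiding_naturality_right, reassoc_of% hg']
    simp⟩

theorem lift_self {W : C} (g : W ⟶ X) (hg : g ≫ a = g ≫ b) : ∃ g' : W ⟶ E, g' ≫ i = g := by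
  obtain ⟨g', hg'⟩ := h.lift (g ≫ (λ_ X).inv) (by simp [reassoc_of% hg])
  exact ⟨g' ≫ (λ_ E).hom, by
    rw [Category.assoc, ← leftUnitor_naturality, reassoc_of% hg']; simp⟩

theorem of_iso {D : C} (d : D ⟶ E) [IsIso d] : IsStableEqualizer a b (d ≫ i) where
  w := by rw [Category.assoc, h.w, Category.assoc]
  mono Z := by
    have := h.mono Z
    rw [MonoidalCategory.whiskerLeft_comp]; infer_instance
  lift {Z W} g hg := by
    obtain ⟨g', hg'⟩ := h.lift g hg
    exact ⟨g' ≫ Z ◁ inv d, by rw [Category.assoc, ← MonoidalCategory.whiskerLeft_comp]; simpa⟩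

end IsStableEqualizer

variable [SymmetricCategory C]

theorem isLeftAction_triv (A X : C) [BimonObj A] : IsLeftAction (trivLeftAct A X) where
  assoc := by
    rw [trivLeftAct_natural, trivLeftAct, trivLeftAct, ← comp_whiskerRight_assoc,
      Bimon.mul_counit, MonoidalCategory.tensorHom_def]
    simp
  unit := by simp [trivLeftAct, ← comp_whiskerRight_assoc]

theorem isLeftCoaction_triv (B Y : C) [BimonObj B] : IsLeftCoaction (trivLeftCoact B Y) where
  coassoc := by
    rw [reassoc_of% (trivLeftCoact_natural B (trivLeftCoact B Y)), trivLeftCoact, trivLeftCoact, Category.assoc,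
      ← comp_whiskerRight, Bimon.one_comul, MonoidalCategory.tensorHom_def']
    monoidal
  counit := by simp [trivLeftCoact, ← comp_whiskerRight]

variable [HasEqualizers C] [HasCoequalizers C]

/-- Bistability is applied to α tensored with the trivial action of A on Z. The stabilized object of
the trivial action is Z itself, so the comparison isomorphism says that tensoring with Z preserves
the coequalizer of α. -/
theorem IsBistable.isStableCoequalizer (hC : IsBistable C) {A X : C} [BimonObj A] {α : A ⊗ X ⟶ X}
    (hα : IsLeftAction α) :
    IsStableCoequalizer α (trivLeftAct A X) (coequalizer.π α (trivLeftAct A X)) := by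
  have key (Z : C) : coequalizer.π (tensorLeftAct (trivLeftAct A Z) α) _ ≫
      leftActComparison (trivLeftAct A Z) α =
        coequalizer.π (trivLeftAct A Z) (trivLeftAct A Z) ⊗ₘ coequalizer.π α (trivLeftAct A X) :=
    coequalizer.π_desc _ _
  have hiso (Z : C) := hC.leftAct _ _ (isLeftAction_triv A Z) hα
  have hπ (Z : C) : IsIso (coequalizer.π (trivLeftAct A Z) (trivLeftAct A Z)) := inferInstance
  refine ⟨coequalizer.condition _ _, fun Z => ?_, fun {Z W} g hg => ?_⟩
  · have := hiso Z
    have e : Z ◁ coequalizer.π α (trivLeftAct A X) =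
        (coequalizer.π (tensorLeftAct (trivLeftAct A Z) α) _ ≫
          leftActComparison (trivLeftAct A Z) α) ≫
        inv (coequalizer.π (trivLeftAct A Z) (trivLeftAct A Z)) ▷ _ := by
      rw [key, ← tensorHom_id, tensorHom_comp_tensorHom]; simp
    rw [e]
    infer_instance
  · have := hiso Z
    -- Trivializing the α factor alone is enough, since the action on Z is already trivial.
    have w : tensorLeftAct (trivLeftAct A Z) α ≫ g = trivLeftAct (A ⊗ A) (Z ⊗ X) ≫ g := by
      rw [← tensorLeftAct_triv]
      simp only [tensorLeftAct, MonoidalCategory.tensorHom_def, Category.assoc, hg]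
    refine ⟨coequalizer.π (trivLeftAct A Z) (trivLeftAct A Z) ▷ _ ≫
      inv (leftActComparison (trivLeftAct A Z) α) ≫ coequalizer.desc g w, ?_⟩
    rw [← MonoidalCategory.tensorHom_def'_assoc, ← key]
    simp

theorem IsBistable.isStableEqualizer (hC : IsBistable C) {A X : C} [BimonObj A] {α : X ⟶ A ⊗ X}
    (hα : IsLeftCoaction α) :
    IsStableEqualizer α (trivLeftCoact A X) (equalizer.ι α (trivLeftCoact A X)) := by
  have key (Z : C) : leftCoactComparison (trivLeftCoact A Z) α ≫
      equalizer.ι (tensorLeftCoact (trivLeftCoact A Z) α) _ =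
        equalizer.ι (trivLeftCoact A Z) (trivLeftCoact A Z) ⊗ₘ
          equalizer.ι α (trivLeftCoact A X) :=
    equalizer.lift_ι _ _
  have hiso (Z : C) := hC.leftCoact _ _ (isLeftCoaction_triv A Z) hα
  have hπ (Z : C) : IsIso (equalizer.ι (trivLeftCoact A Z) (trivLeftCoact A Z)) := inferInstance
  refine ⟨equalizer.condition _ _, fun Z => ?_, fun {Z W} g hg => ?_⟩
  · have := hiso Z
    have e : Z ◁ equalizer.ι α (trivLeftCoact A X) =
        inv (equalizer.ι (trivLeftCoact A Z) (trivLeftCoact A Z)) ▷ _ ≫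
        (leftCoactComparison (trivLeftCoact A Z) α ≫
          equalizer.ι (tensorLeftCoact (trivLeftCoact A Z) α) _) := by
      rw [key, ← tensorHom_id, tensorHom_comp_tensorHom]; simp
    rw [e]
    infer_instance
  · have := hiso Z
    have w : g ≫ tensorLeftCoact (trivLeftCoact A Z) α = g ≫ trivLeftCoact (A ⊗ A) (Z ⊗ X) := by
      rw [← tensorLeftCoact_triv]
      simp only [tensorLeftCoact, MonoidalCategory.tensorHom_def', Category.assoc, reassoc_of% hg]
    refine ⟨equalizer.lift g w ≫ inv (leftCoactComparison (trivLeftCoact A Z) α) ≫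
      equalizer.ι (trivLeftCoact A Z) (trivLeftCoact A Z) ▷ _, ?_⟩
    rw [Category.assoc, Category.assoc, ← MonoidalCategory.tensorHom_def, ← key]
    simp

end Stable

end HopfFredholm

/-! ### Transfer of Hopf structures -/

namespace HopfFredholm

variable {C : Type u} [Category.{v} C] [MonoidalCategory C] [SymmetricCategory C]

section Transfer

open HopfObj

/-- A bicommutative Hopf structure descends along a stable epimorphism. -/
theorem exists_bicommHopf_of_stableEpi (B : BicommHopf C) {Q : C} (q : B.X ⟶ Q) (hq : StableEpi q)
    (m : Q ⊗ Q ⟶ Q) (d : Q ⟶ Q ⊗ Q) (e : Q ⟶ 𝟙_ C) (s : Q ⟶ Q)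
    (hm : (q ⊗ₘ q) ≫ m = μ[B.X] ≫ q) (hd : q ≫ d = Δ[B.X] ≫ (q ⊗ₘ q)) (he : q ≫ e = ε[B.X])
    (hs : q ≫ s = 𝒮[B.X] ≫ q) :
    ∃ (Q' : BicommHopf C) (i : Q ≅ Q'.X) (π : B ⟶ Q'), π.hom = q ≫ i.hom := by
  -- Stability of q makes its tensor powers epimorphisms, so each axiom for Q may be checked after
  -- precomposition with them, where it is an axiom for B.
  have := hq.epi
  have := (hq.tensor hq).epi
  have := ((hq.tensor hq).tensor hq).epi
  have := hq (𝟙_ C)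
  have := hq.whiskerRight (𝟙_ C)
  let mon : MonObj Q :=
    { one := η[B.X] ≫ q
      mul := m
      one_mul := by
        rw [← cancel_epi (𝟙_ C ◁ q)]
        have h : 𝟙_ C ◁ q ≫ (η[B.X] ≫ q) ▷ Q = η[B.X] ▷ B.X ≫ (q ⊗ₘ q) := by
          rw [comp_whiskerRight, whisker_exchange_assoc, whisker_exchange,
            MonoidalCategory.tensorHom_def]
        rw [reassoc_of% h, hm]
        simp
      mul_one := by
        rw [← cancel_epi (q ▷ 𝟙_ C)]
        have h : q ▷ 𝟙_ C ≫ Q ◁ (η[B.X] ≫ q) = B.X ◁ η[B.X] ≫ (q ⊗ₘ q) := by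
          simp [MonoidalCategory.tensorHom_def, whisker_exchange_assoc]
        rw [reassoc_of% h, hm]
        simp
      mul_assoc := by
        rw [← cancel_epi ((q ⊗ₘ q) ⊗ₘ q), ← tensorHom_id, ← id_tensorHom,
          tensorHom_comp_tensorHom_assoc, associator_naturality_assoc,
          tensorHom_comp_tensorHom_assoc, hm, Category.comp_id]
        have h₁ : (μ[B.X] ≫ q) ⊗ₘ q = (μ[B.X] ▷ B.X) ≫ (q ⊗ₘ q) := by
          rw [← tensorHom_id, tensorHom_comp_tensorHom, Category.id_comp]
        have h₂ : q ⊗ₘ (μ[B.X] ≫ q) = (B.X ◁ μ[B.X]) ≫ (q ⊗ₘ q) := by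
          rw [← id_tensorHom, tensorHom_comp_tensorHom, Category.id_comp]
        rw [h₁, h₂, Category.assoc, Category.assoc, hm, MonObj.mul_assoc_assoc] }
  let comon : ComonObj Q :=
    { counit := e
      comul := d
      counit_comul := by
        rw [← cancel_epi q, reassoc_of% hd, MonoidalCategory.tensorHom_def', Category.assoc,
          ← comp_whiskerRight, he, whisker_exchange, ComonObj.counit_comul_assoc,
          leftUnitor_inv_naturality]
      comul_counit := by
        rw [← cancel_epi q, reassoc_of% hd, MonoidalCategory.tensorHom_def, Category.assoc,
          ← MonoidalCategory.whiskerLeft_comp, he, ← whisker_exchange,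
          ComonObj.comul_counit_assoc, rightUnitor_inv_naturality]
      comul_assoc := by
        rw [← cancel_epi q, reassoc_of% hd, reassoc_of% hd, ← tensorHom_id, ← id_tensorHom,
          tensorHom_comp_tensorHom, tensorHom_comp_tensorHom_assoc, hd, Category.comp_id]
        have h₁ : (Δ[B.X] ≫ (q ⊗ₘ q)) ⊗ₘ q = (Δ[B.X] ▷ B.X) ≫ ((q ⊗ₘ q) ⊗ₘ q) := by
          rw [← tensorHom_id, tensorHom_comp_tensorHom, Category.id_comp]
        have h₂ : q ⊗ₘ (Δ[B.X] ≫ (q ⊗ₘ q)) = (B.X ◁ Δ[B.X]) ≫ (q ⊗ₘ (q ⊗ₘ q)) := by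
          rw [← id_tensorHom, tensorHom_comp_tensorHom, Category.id_comp]
        rw [h₁, h₂, Category.assoc, associator_naturality, ComonObj.comul_assoc_assoc] }
  have hη : η[Q] = η[B.X] ≫ q := rfl
  have hμ : (q ⊗ₘ q) ≫ μ[Q] = μ[B.X] ≫ q := hm
  have hΔ : q ≫ Δ[Q] = Δ[B.X] ≫ (q ⊗ₘ q) := hd
  have hε : q ≫ ε[Q] = ε[B.X] := he
  let bim : BimonObj Q :=
    { mul_comul := by
        rw [← cancel_epi (q ⊗ₘ q), reassoc_of% hμ, hΔ, BimonObj.mul_comul_assoc,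
          tensorHom_comp_tensorHom_assoc, hΔ, ← tensorHom_comp_tensorHom_assoc,
          tensorμ_natural_assoc, tensorHom_comp_tensorHom, tensorHom_comp_tensorHom, hμ]
      one_comul := by
        rw [hη, Category.assoc, hΔ, BimonObj.one_comul_assoc, MonObj.tensorObj.one_def,
          MonObj.tensorObj.one_def, hη, Category.assoc, tensorHom_comp_tensorHom]
      mul_counit := by
        rw [← cancel_epi (q ⊗ₘ q), reassoc_of% hμ, hε, BimonObj.mul_counit,
          Comon.tensorObj_counit, Comon.tensorObj_counit, tensorHom_comp_tensorHom_assoc, hε]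
      one_counit := by rw [hη, Category.assoc, hε, BimonObj.one_counit] }
  let hopf : HopfObj Q :=
    { antipode := s
      antipode_left := by
        rw [← cancel_epi q, reassoc_of% hΔ, ← tensorHom_id, tensorHom_comp_tensorHom_assoc, hs,
          Category.comp_id, reassoc_of% hε, hη, ← antipode_left_assoc, ← hμ, ← tensorHom_id,
          tensorHom_comp_tensorHom_assoc, Category.id_comp]
      antipode_right := by
        rw [← cancel_epi q, reassoc_of% hΔ, ← id_tensorHom, tensorHom_comp_tensorHom_assoc, hs,
          Category.comp_id, reassoc_of% hε, hη, ← antipode_right_assoc, ← hμ, ← id_tensorHom,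
          tensorHom_comp_tensorHom_assoc, Category.id_comp] }
  have hcomm : IsCommMonObj Q := ⟨by
    rw [← cancel_epi (q ⊗ₘ q), BraidedCategory.braiding_naturality_assoc, hμ,
      IsCommMonObj.mul_comm_assoc]⟩
  have hcocomm : IsCommComonObj Q := ⟨by
    rw [← cancel_epi q, reassoc_of% hΔ, hΔ, BraidedCategory.braiding_naturality,
      IsCommComonObj.comul_comm_assoc]⟩
  have hom : IsBimonHom q :=
    { one_hom := rfl, mul_hom := hm.symm, hom_counit := he, hom_comul := hd }
  exact ⟨{ X := Q }, Iso.refl _, { hom := q }, (Category.comp_id q).symm⟩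

/-- A bicommutative Hopf structure restricts along a stable monomorphism. -/
theorem exists_bicommHopf_of_stableMono (B : BicommHopf C) {E : C} (j : E ⟶ B.X)
    (hj : StableMono j) (m : E ⊗ E ⟶ E) (d : E ⟶ E ⊗ E) (u : 𝟙_ C ⟶ E) (s : E ⟶ E)
    (hm : m ≫ j = (j ⊗ₘ j) ≫ μ[B.X]) (hd : d ≫ (j ⊗ₘ j) = j ≫ Δ[B.X]) (hu : u ≫ j = η[B.X])
    (hs : s ≫ j = j ≫ 𝒮[B.X]) :
    ∃ (E' : BicommHopf C) (i : E'.X ≅ E) (k : E' ⟶ B), k.hom = i.hom ≫ j := by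
  -- Tensor powers of j are monomorphisms, so each axiom for E may be checked inside B.
  have := hj.mono
  have := (hj.tensor hj).mono
  have := (hj.tensor (hj.tensor hj)).mono
  have := hj (𝟙_ C)
  have := hj.whiskerRight (𝟙_ C)
  let mon : MonObj E :=
    { one := u
      mul := m
      one_mul := by
        rw [← cancel_mono j, Category.assoc, hm, ← leftUnitor_naturality, ← MonObj.one_mul, ← hu,
          MonoidalCategory.tensorHom_def, comp_whiskerRight, Category.assoc, Category.assoc,
          whisker_exchange_assoc, whisker_exchange_assoc]
      mul_one := by
        rw [← cancel_mono j, Category.assoc, hm, ← rightUnitor_naturality, ← MonObj.mul_one, ← hu,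
          MonoidalCategory.tensorHom_def', MonoidalCategory.whiskerLeft_comp, Category.assoc,
          Category.assoc, ← whisker_exchange_assoc, ← whisker_exchange_assoc]
      mul_assoc := by
        rw [← cancel_mono j, Category.assoc, Category.assoc, Category.assoc, hm, ← tensorHom_id,
          ← id_tensorHom, tensorHom_comp_tensorHom_assoc, tensorHom_comp_tensorHom_assoc, hm,
          Category.id_comp]
        have h₁ : ((j ⊗ₘ j) ≫ μ[B.X]) ⊗ₘ j = ((j ⊗ₘ j) ⊗ₘ j) ≫ (μ[B.X] ▷ B.X) := by
          rw [← tensorHom_id, tensorHom_comp_tensorHom, Category.comp_id]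
        have h₂ : j ⊗ₘ ((j ⊗ₘ j) ≫ μ[B.X]) = (j ⊗ₘ (j ⊗ₘ j)) ≫ (B.X ◁ μ[B.X]) := by
          rw [← id_tensorHom, tensorHom_comp_tensorHom, Category.comp_id]
        rw [h₁, h₂, Category.assoc, Category.assoc, ← associator_naturality_assoc,
          MonObj.mul_assoc] }
  let comon : ComonObj E :=
    { counit := j ≫ ε[B.X]
      comul := d
      counit_comul := by
        rw [← cancel_mono (𝟙_ C ◁ j), Category.assoc]
        have h : (j ≫ ε[B.X]) ▷ E ≫ 𝟙_ C ◁ j = (j ⊗ₘ j) ≫ ε[B.X] ▷ B.X := by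
          rw [comp_whiskerRight, Category.assoc, ← whisker_exchange, ← whisker_exchange_assoc,
            MonoidalCategory.tensorHom_def', Category.assoc]
        rw [h, reassoc_of% hd]
        simp
      comul_counit := by
        rw [← cancel_mono (j ▷ 𝟙_ C), Category.assoc]
        have h : E ◁ (j ≫ ε[B.X]) ≫ j ▷ 𝟙_ C = (j ⊗ₘ j) ≫ B.X ◁ ε[B.X] := by
          rw [MonoidalCategory.whiskerLeft_comp, Category.assoc, whisker_exchange,
            whisker_exchange_assoc, MonoidalCategory.tensorHom_def, Category.assoc]
        rw [h, reassoc_of% hd]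
        simp
      comul_assoc := by
        rw [← cancel_mono (j ⊗ₘ (j ⊗ₘ j))]
        simp only [Category.assoc]
        rw [← associator_naturality, ← tensorHom_id, ← id_tensorHom,
          tensorHom_comp_tensorHom, tensorHom_comp_tensorHom_assoc, hd, Category.id_comp]
        have h₁ : (j ≫ Δ[B.X]) ⊗ₘ j = (j ⊗ₘ j) ≫ (Δ[B.X] ▷ B.X) := by
          rw [← tensorHom_id, tensorHom_comp_tensorHom, Category.comp_id]
        have h₂ : j ⊗ₘ (j ≫ Δ[B.X]) = (j ⊗ₘ j) ≫ (B.X ◁ Δ[B.X]) := by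
          rw [← id_tensorHom, tensorHom_comp_tensorHom, Category.comp_id]
        rw [h₁, h₂, Category.assoc, reassoc_of% hd, reassoc_of% hd, ComonObj.comul_assoc] }
  have hη : η[E] ≫ j = η[B.X] := hu
  have hμ : μ[E] ≫ j = (j ⊗ₘ j) ≫ μ[B.X] := hm
  have hΔ : Δ[E] ≫ (j ⊗ₘ j) = j ≫ Δ[B.X] := hd
  have hε : ε[E] = j ≫ ε[B.X] := rfl
  let bim : BimonObj E :=
    { mul_comul := by
        rw [← cancel_mono (j ⊗ₘ j)]
        simp only [Category.assoc]
        rw [hΔ, reassoc_of% hμ, BimonObj.mul_comul,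
          tensorHom_comp_tensorHom, hμ, ← tensorHom_comp_tensorHom,
          ← tensorμ_natural_assoc, tensorHom_comp_tensorHom_assoc, tensorHom_comp_tensorHom_assoc,
          hΔ]
      one_comul := by
        rw [← cancel_mono (j ⊗ₘ j), Category.assoc, hΔ, reassoc_of% hη, BimonObj.one_comul,
          MonObj.tensorObj.one_def, MonObj.tensorObj.one_def, Category.assoc,
          tensorHom_comp_tensorHom, hη]
      mul_counit := by
        rw [hε, reassoc_of% hμ, BimonObj.mul_counit,
          Comon.tensorObj_counit, Comon.tensorObj_counit, hε, tensorHom_comp_tensorHom_assoc]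
      one_counit := by rw [hε, reassoc_of% hη, BimonObj.one_counit] }
  let hopf : HopfObj E :=
    { antipode := s
      antipode_left := by
        rw [← cancel_mono j]
        simp only [Category.assoc]
        rw [hμ, ← tensorHom_id, tensorHom_comp_tensorHom_assoc, hs, hη, hε, Category.assoc,
          ← antipode_left, ← reassoc_of% hΔ, ← tensorHom_id, tensorHom_comp_tensorHom_assoc,
          Category.id_comp, Category.comp_id]
      antipode_right := by
        rw [← cancel_mono j]
        simp only [Category.assoc]
        rw [hμ, ← id_tensorHom, tensorHom_comp_tensorHom_assoc, hs, hη, hε, Category.assoc,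
          ← antipode_right, ← reassoc_of% hΔ, ← id_tensorHom, tensorHom_comp_tensorHom_assoc,
          Category.id_comp, Category.comp_id] }
  have hcomm : IsCommMonObj E := ⟨by
    rw [← cancel_mono j, Category.assoc, hμ, ← BraidedCategory.braiding_naturality_assoc,
      IsCommMonObj.mul_comm]⟩
  have hcocomm : IsCommComonObj E := ⟨by
    rw [← cancel_mono (j ⊗ₘ j), Category.assoc, ← BraidedCategory.braiding_naturality,
      reassoc_of% hΔ, hΔ, IsCommComonObj.comul_comm]⟩
  have hom : IsBimonHom j :=
    { one_hom := hu, mul_hom := hm, hom_counit := rfl, hom_comul := hd.symm }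
  exact ⟨{ X := E }, Iso.refl _, { hom := j }, (Category.id_comp j).symm⟩

end Transfer
end HopfFredholm

/-! ### Quotient and sub Hopf monoids defined by a homomorphism -/

namespace HopfFredholm

variable {C : Type u} [Category.{v} C] [MonoidalCategory C] [SymmetricCategory C]

section Cokernel

open HopfObj

namespace BicommHopf

@[simp] theorem id_hom (A : BicommHopf C) : Hom.hom (𝟙 A) = 𝟙 A.X := rfl

@[simp] theorem comp_hom {A B D : BicommHopf C} (f : A ⟶ B) (g : B ⟶ D) :
    (f ≫ g).hom = f.hom ≫ g.hom := rfl

@[ext] theorem hom_ext {A B : BicommHopf C} {f g : A ⟶ B} (h : f.hom = g.hom) : f = g :=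
  Hom.ext h

instance {A B : BicommHopf C} (f : A ⟶ B) : IsBimonHom f.hom := f.isBimonHom

/-- The trivial homomorphism. -/
def triv (A B : BicommHopf C) : A ⟶ B where
  hom := ε[A.X] ≫ η[B.X]
  isBimonHom :=
    { one_hom := by simp
      mul_hom := by
        have h : (η[B.X] ⊗ₘ η[B.X]) ≫ μ[B.X] = (λ_ (𝟙_ C)).hom ≫ η[B.X] := by
          rw [MonoidalCategory.tensorHom_def', Category.assoc, MonObj.one_mul,
            leftUnitor_naturality]
        rw [BimonObj.mul_counit_assoc, Comon.tensorObj_counit, ← tensorHom_comp_tensorHom,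
          Category.assoc, Category.assoc, h]
      hom_counit := by simp
      hom_comul := by
        have h : Δ[A.X] ≫ (ε[A.X] ⊗ₘ ε[A.X]) = ε[A.X] ≫ (λ_ (𝟙_ C)).inv := by
          rw [MonoidalCategory.tensorHom_def, ComonObj.counit_comul_assoc,
            leftUnitor_inv_naturality]
        rw [Category.assoc, BimonObj.one_comul, MonObj.tensorObj.one_def,
          ← tensorHom_comp_tensorHom, reassoc_of% h] }

/-- The zero morphisms are those of an abstract structure. A homomorphism preserves units, so the
trivial endomorphism followed by 0 is trivial; it is also 0. -/
theorem zero_hom [HasZeroMorphisms (BicommHopf C)] (A B : BicommHopf C) :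
    (0 : A ⟶ B).hom = ε[A.X] ≫ η[B.X] := by
  have h : triv A A ≫ (0 : A ⟶ B) = triv A B := by
    refine hom_ext ?_
    rw [comp_hom]
    dsimp only [triv]
    rw [Category.assoc, IsMonHom.one_hom]
  rw [comp_zero] at h
  rw [h, triv]

/-- The action of `A` on `B` by multiplication along `f : A ⟶ B`. -/
def act {A B : BicommHopf C} (f : A ⟶ B) : A.X ⊗ B.X ⟶ B.X := f.hom ▷ B.X ≫ μ[B.X]

/-- The coaction of `B` on `A` by comultiplication along `f : A ⟶ B`. -/
def coact {A B : BicommHopf C} (f : A ⟶ B) : A.X ⟶ B.X ⊗ A.X := Δ[A.X] ≫ f.hom ▷ A.X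

theorem isLeftAction_act {A B : BicommHopf C} (f : A ⟶ B) : IsLeftAction (act f) where
  assoc := by
    simp only [act]
    rw [← comp_whiskerRight_assoc, IsMonHom.mul_hom, comp_whiskerRight_assoc, MonObj.mul_assoc,
      whisker_exchange_assoc]
    simp [MonoidalCategory.tensorHom_def]
  unit := by simp [act, ← comp_whiskerRight_assoc]

theorem isLeftCoaction_coact {A B : BicommHopf C} (f : A ⟶ B) : IsLeftCoaction (coact f) where
  coassoc := by
    simp only [coact, Category.assoc]
    rw [← comp_whiskerRight, IsComonHom.hom_comul, ← whisker_exchange_assoc]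
    simp [MonoidalCategory.tensorHom_def']
  counit := by simp [coact, ← comp_whiskerRight]

theorem antipode_mul (A : BicommHopf C) : μ[A.X] ≫ 𝒮 = (𝒮 ⊗ₘ 𝒮) ≫ μ[A.X] := by
  rw [HopfObj.mul_antipode, IsCommMonObj.mul_comm]

theorem antipode_comul (A : BicommHopf C) : 𝒮 ≫ Δ[A.X] = Δ[A.X] ≫ (𝒮 ⊗ₘ 𝒮) := by
  rw [HopfObj.antipode_comul, IsCommComonObj.comul_comm_assoc]

theorem act_natural {A B D : BicommHopf C} (f : A ⟶ B) (g : B ⟶ D) :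
    act f ≫ g.hom = A.X ◁ g.hom ≫ act (f ≫ g) := by
  simp only [act, Category.assoc, IsMonHom.mul_hom, comp_hom, MonoidalCategory.tensorHom_def,
    comp_whiskerRight, whisker_exchange_assoc]

theorem coact_natural {A B D : BicommHopf C} (f : A ⟶ B) (g : B ⟶ D) :
    f.hom ≫ coact g = coact (f ≫ g) ≫ D.X ◁ f.hom := by
  simp only [coact, Category.assoc, IsComonHom.hom_comul_assoc, comp_hom,
    MonoidalCategory.tensorHom_def', comp_whiskerRight, whisker_exchange]

theorem act_zero [HasZeroMorphisms (BicommHopf C)] (A B : BicommHopf C) :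
    act (0 : A ⟶ B) = trivLeftAct A.X B.X := by
  simp [act, zero_hom, trivLeftAct]

theorem coact_zero [HasZeroMorphisms (BicommHopf C)] (A B : BicommHopf C) :
    coact (0 : A ⟶ B) = trivLeftCoact B.X A.X := by
  simp [coact, zero_hom, trivLeftCoact]

theorem act_whiskerRight_mul {A B : BicommHopf C} (f : A ⟶ B) :
    act f ▷ B.X ≫ μ[B.X] = (α_ _ _ _).hom ≫ A.X ◁ μ[B.X] ≫ act f := by
  simp [act, whisker_exchange_assoc]

theorem comul_whiskerRight_coact {A B : BicommHopf C} (f : A ⟶ B) :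
    Δ[A.X] ≫ coact f ▷ A.X = coact f ≫ B.X ◁ Δ[A.X] ≫ (α_ _ _ _).inv := by
  simp [coact, ← whisker_exchange_assoc]

/-- The comultiplication of B is equivariant along that of A, with the tensor product action on B ⊗
B. This is why it descends to the quotient. -/
theorem act_comul {A B : BicommHopf C} (f : A ⟶ B) :
    act f ≫ Δ[B.X] = (Δ[A.X] ⊗ₘ Δ[B.X]) ≫ tensorLeftAct (act f) (act f) := by
  have h := tensorμ_natural_left f.hom f.hom B.X B.X
  simp only [act, tensorLeftAct, ← tensorHom_comp_tensorHom, Category.assoc]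
  rw [← reassoc_of% h, BimonObj.mul_comul, ← tensorHom_id, ← tensorHom_id,
    tensorHom_comp_tensorHom_assoc, tensorHom_comp_tensorHom_assoc, IsComonHom.hom_comul,
    Category.id_comp, Category.comp_id]

theorem mul_coact {A B : BicommHopf C} (f : A ⟶ B) :
    μ[A.X] ≫ coact f = tensorLeftCoact (coact f) (coact f) ≫ (μ[B.X] ⊗ₘ μ[A.X]) := by
  have h := tensorμ_natural_left f.hom f.hom A.X A.X
  have h' := tensorμ_natural f.hom (𝟙 A.X) f.hom (𝟙 A.X)
  simp only [tensorHom_id] at h'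
  simp only [coact, tensorLeftCoact, ← tensorHom_comp_tensorHom, Category.assoc]
  rw [reassoc_of% h', BimonObj.mul_comul_assoc, ← tensorHom_id, ← tensorHom_id,
    tensorHom_comp_tensorHom, tensorHom_comp_tensorHom, IsMonHom.mul_hom]
  simp

theorem trivLeftAct_comul (A B : BicommHopf C) :
    trivLeftAct A.X B.X ≫ Δ[B.X] =
      (Δ[A.X] ⊗ₘ Δ[B.X]) ≫ tensorLeftAct (trivLeftAct A.X B.X) (trivLeftAct A.X B.X) := by
  rw [tensorLeftAct_triv, tensorHom_trivLeftAct]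
  rw [Comon.tensorObj_counit, MonoidalCategory.tensorHom_def, Category.assoc,
    ComonObj.counit_comul_assoc, leftUnitor_naturality, Iso.inv_hom_id_assoc]

theorem mul_trivLeftCoact (A B : BicommHopf C) :
    μ[A.X] ≫ trivLeftCoact B.X A.X =
      tensorLeftCoact (trivLeftCoact B.X A.X) (trivLeftCoact B.X A.X) ≫ (μ[B.X] ⊗ₘ μ[A.X]) := by
  rw [tensorLeftCoact_triv, trivLeftCoact_tensorHom]
  rw [MonObj.tensorObj.one_def, MonoidalCategory.tensorHom_def', Category.assoc, Category.assoc,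
    MonObj.one_mul, leftUnitor_naturality, Iso.inv_hom_id_assoc]

theorem act_antipode {A B : BicommHopf C} (f : A ⟶ B) :
    act f ≫ 𝒮[B.X] = (𝒮[A.X] ⊗ₘ 𝒮[B.X]) ≫ act f := by
  rw [act, Category.assoc, antipode_mul, ← tensorHom_id, tensorHom_comp_tensorHom_assoc,
    tensorHom_comp_tensorHom_assoc, hom_antipode, Category.id_comp, Category.comp_id]

theorem antipode_coact {A B : BicommHopf C} (f : A ⟶ B) :
    𝒮[A.X] ≫ coact f = coact f ≫ (𝒮[B.X] ⊗ₘ 𝒮[A.X]) := by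
  rw [coact, ← Category.assoc, antipode_comul, ← tensorHom_id, Category.assoc, Category.assoc,
    tensorHom_comp_tensorHom, tensorHom_comp_tensorHom, hom_antipode, Category.id_comp,
    Category.comp_id]

/-- The coequalizer of the action of `A` on `B` along `f : A ⟶ B` is a Hopf monoid. -/
theorem exists_quotient {A B : BicommHopf C} (f : A ⟶ B) {Q : C} {q : B.X ⟶ Q}
    (hq : IsStableCoequalizer (act f) (trivLeftAct A.X B.X) q) :
    ∃ (Q' : BicommHopf C) (i : Q ≅ Q'.X) (π : B ⟶ Q'), π.hom = q ≫ i.hom := by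
  have w := hq.w
  obtain ⟨e, he⟩ := hq.desc_self ε[B.X] (by
    rw [act, Category.assoc, BimonObj.mul_counit, ← tensorHom_id, Comon.tensorObj_counit,
      tensorHom_comp_tensorHom_assoc, IsComonHom.hom_counit, Category.id_comp, trivLeftAct,
      MonoidalCategory.tensorHom_def, Category.assoc, Category.assoc, leftUnitor_naturality])
  obtain ⟨d, hd⟩ := hq.desc_self (Δ[B.X] ≫ (q ⊗ₘ q)) (by
    rw [reassoc_of% act_comul, reassoc_of% trivLeftAct_comul, tensorLeftAct, tensorLeftAct]
    simp only [Category.assoc, tensorHom_comp_tensorHom, w])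
  obtain ⟨s, hs⟩ := hq.desc_self (𝒮[B.X] ≫ q) (by
    rw [reassoc_of% act_antipode, w, reassoc_of% (tensorHom_trivLeftAct (antipode_counit A.X))])
  -- The multiplication is descended one variable at a time. Stability is needed because the other
  -- tensor factor is still present, and commutativity reduces the second variable to the first.
  have hm₀ : act f ▷ B.X ≫ μ[B.X] ≫ q = trivLeftAct A.X B.X ▷ B.X ≫ μ[B.X] ≫ q := by
    rw [reassoc_of% act_whiskerRight_mul, w, reassoc_of% trivLeftAct_natural]
    simp [trivLeftAct]
  obtain ⟨m₁, hm₁⟩ := hq.desc_right (μ[B.X] ≫ q) hm₀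
  obtain ⟨m, hm⟩ := hq.desc m₁ (by
    have := hq.stableEpi.whiskerRight (A.X ⊗ B.X)
    rw [← cancel_epi (q ▷ (A.X ⊗ B.X)), ← whisker_exchange_assoc, ← whisker_exchange_assoc, hm₁,
      ← IsCommMonObj.mul_comm B.X, Category.assoc, BraidedCategory.braiding_naturality_right_assoc,
      BraidedCategory.braiding_naturality_right_assoc, hm₀])
  exact exists_bicommHopf_of_stableEpi B q hq.stableEpi m d e s
    (by rw [MonoidalCategory.tensorHom_def, Category.assoc, hm, hm₁]) hd he hs

/-- The equalizer of the coaction of `B` on `A` along `f : A ⟶ B` is a Hopf monoid. -/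
theorem exists_sub {A B : BicommHopf C} (f : A ⟶ B) {E : C} {j : E ⟶ A.X}
    (hj : IsStableEqualizer (coact f) (trivLeftCoact B.X A.X) j) :
    ∃ (E' : BicommHopf C) (i : E'.X ≅ E) (k : E' ⟶ A), k.hom = i.hom ≫ j := by
  have w := hj.w
  obtain ⟨u, hu⟩ := hj.lift_self η[A.X] (by
    rw [coact, BimonObj.one_comul_assoc, MonObj.tensorObj.one_def, Category.assoc, ← tensorHom_id,
      tensorHom_comp_tensorHom, IsMonHom.one_hom, Category.comp_id, trivLeftCoact,
      MonoidalCategory.tensorHom_def', leftUnitor_inv_naturality_assoc])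
  obtain ⟨m, hm⟩ := hj.lift_self ((j ⊗ₘ j) ≫ μ[A.X]) (by
    rw [Category.assoc, Category.assoc, mul_coact, mul_trivLeftCoact, tensorLeftCoact,
      tensorLeftCoact]
    simp only [Category.assoc, tensorHom_comp_tensorHom_assoc, w])
  obtain ⟨s, hs⟩ := hj.lift_self (j ≫ 𝒮[A.X]) (by
    rw [Category.assoc, antipode_coact, reassoc_of% w,
      trivLeftCoact_tensorHom (one_antipode B.X), Category.assoc])
  -- Likewise the comultiplication is lifted one tensor factor at a time; cocommutativity handles
  -- the second.
  have hd₀ : j ≫ Δ[A.X] ≫ coact f ▷ A.X = j ≫ Δ[A.X] ≫ trivLeftCoact B.X A.X ▷ A.X := by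
    rw [comul_whiskerRight_coact, reassoc_of% w, reassoc_of% trivLeftCoact_natural]
    simp [trivLeftCoact]
  obtain ⟨d₁, hd₁⟩ := hj.lift_right (j ≫ Δ[A.X]) (by simpa using hd₀)
  obtain ⟨d, hd⟩ := hj.lift d₁ (by
    have := hj.stableMono.whiskerRight (B.X ⊗ A.X)
    rw [← cancel_mono (j ▷ (B.X ⊗ A.X)), Category.assoc, Category.assoc, whisker_exchange,
      whisker_exchange, reassoc_of% hd₁, reassoc_of% hd₁,
      ← IsCommComonObj.comul_comm A.X, Category.assoc, Category.assoc,
      ← BraidedCategory.braiding_naturality_left,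
      ← BraidedCategory.braiding_naturality_left, reassoc_of% hd₀])
  exact exists_bicommHopf_of_stableMono A j hj.stableMono m d u s hm
    (by rw [MonoidalCategory.tensorHom_def', reassoc_of% hd, hd₁]) hu hs

end BicommHopf
end Cokernel
end HopfFredholm

/-! ### Kernels and cokernels of bicommutative Hopf monoids -/

namespace HopfFredholm

variable {C : Type u} [Category.{v} C] [MonoidalCategory C] [SymmetricCategory C]

section Exact

namespace BicommHopf

/-- A morphism of the underlying objects that becomes a homomorphism after composition with a
homomorphism that is a stable epimorphism is a homomorphism. -/
theorem isBimonHom_of_comp {A B D : BicommHopf C} (p : A ⟶ B) (hp : StableEpi p.hom)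
    (g : B.X ⟶ D.X) (f : A ⟶ D) (h : p.hom ≫ g = f.hom) : IsBimonHom g := by
  have := hp.epi
  have := (hp.tensor hp).epi
  refine { one_hom := ?_, mul_hom := ?_, hom_counit := ?_, hom_comul := ?_ }
  · rw [← IsMonHom.one_hom p.hom, Category.assoc, h, IsMonHom.one_hom]
  · rw [← cancel_epi (p.hom ⊗ₘ p.hom), ← IsMonHom.mul_hom_assoc, h, IsMonHom.mul_hom,
      tensorHom_comp_tensorHom_assoc, h]
  · rw [← cancel_epi p.hom, reassoc_of% h, IsComonHom.hom_counit, IsComonHom.hom_counit]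
  · rw [← cancel_epi p.hom, reassoc_of% h, IsComonHom.hom_comul, IsComonHom.hom_comul_assoc,
      tensorHom_comp_tensorHom, h]

/-- A morphism of the underlying objects that becomes a homomorphism after composition with a
homomorphism that is a stable monomorphism is a homomorphism. -/
theorem isBimonHom_of_comp_mono {A B D : BicommHopf C} (i : B ⟶ D) (hi : StableMono i.hom)
    (g : A.X ⟶ B.X) (f : A ⟶ D) (h : g ≫ i.hom = f.hom) : IsBimonHom g := by
  have := hi.mono
  have := (hi.tensor hi).mono
  refine { one_hom := ?_, mul_hom := ?_, hom_counit := ?_, hom_comul := ?_ }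
  · rw [← cancel_mono i.hom, Category.assoc, h, IsMonHom.one_hom, IsMonHom.one_hom]
  · rw [← cancel_mono i.hom, Category.assoc, h, IsMonHom.mul_hom, Category.assoc, IsMonHom.mul_hom,
      tensorHom_comp_tensorHom_assoc, h]
  · rw [← IsComonHom.hom_counit i.hom, reassoc_of% h, IsComonHom.hom_counit]
  · rw [← cancel_mono (i.hom ⊗ₘ i.hom), Category.assoc, ← IsComonHom.hom_comul, reassoc_of% h,
      IsComonHom.hom_comul, Category.assoc, tensorHom_comp_tensorHom, h]

variable [HasEqualizers C] [HasCoequalizers C] [HasZeroMorphisms (BicommHopf C)]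

/-- The underlying morphism of a cokernel is the coequalizer of the action. -/
theorem isStableCoequalizer_of_isColimit (hC : IsBistable C) {A B D : BicommHopf C} {f : A ⟶ B}
    {p : B ⟶ D} (w : f ≫ p = 0) (hp : IsColimit (CokernelCofork.ofπ p w)) :
    IsStableCoequalizer (act f) (trivLeftAct A.X B.X) p.hom := by
  have hq := hC.isStableCoequalizer (isLeftAction_act f)
  obtain ⟨Q, i, π, hπ⟩ := exists_quotient f hq
  have hq' := hq.of_iso i.hom
  rw [← hπ] at hq'
  -- f is recovered by acting on the unit of B, and π makes this action trivial.
  have hfπ : f ≫ π = 0 := by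
    refine hom_ext ?_
    rw [comp_hom, zero_hom, ← IsMonHom.one_hom π.hom]
    have h : (ρ_ A.X).inv ≫ A.X ◁ η[B.X] ≫ act f = f.hom := by
      rw [act, whisker_exchange_assoc, MonObj.mul_one]
      simp
    rw [← h, Category.assoc, Category.assoc, hq'.w, reassoc_of% trivLeftAct_natural]
    simp [trivLeftAct, unitors_equal]
  -- The cokernel property yields d : D ⟶ Q and the coequalizer property e : Q ⟶ D. They are
  -- mutually inverse, so D inherits the stable coequalizer property from Q.
  obtain ⟨d, hd⟩ := CokernelCofork.IsColimit.desc' hp π hfπ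
  obtain ⟨e₀, he₀⟩ := hq'.desc_self p.hom (by
    rw [act_natural, w, act_zero, trivLeftAct_natural])
  let e : Q ⟶ D := { hom := e₀, isBimonHom := isBimonHom_of_comp π hq'.stableEpi e₀ p he₀ }
  have he : π ≫ e = p := hom_ext he₀
  dsimp at hd
  have hde : d ≫ e = 𝟙 D := by
    refine Cofork.IsColimit.hom_ext hp ?_
    dsimp
    rw [reassoc_of% hd, he, Category.comp_id]
  have hed : e₀ ≫ d.hom = 𝟙 Q.X := by
    have := hq'.stableEpi.epi
    rw [← cancel_epi π.hom, reassoc_of% he₀, ← comp_hom, hd, Category.comp_id]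
  have : IsIso e₀ := ⟨d.hom, hed, congrArg Hom.hom hde⟩
  have := hq'.of_iso e₀
  rwa [he₀] at this

/-- The underlying morphism of a kernel is the equalizer of the coaction. -/
theorem isStableEqualizer_of_isLimit (hC : IsBistable C) {A B D : BicommHopf C} {f : A ⟶ B}
    {p : D ⟶ A} (w : p ≫ f = 0) (hp : IsLimit (KernelFork.ofι p w)) :
    IsStableEqualizer (coact f) (trivLeftCoact B.X A.X) p.hom := by
  have hq := hC.isStableEqualizer (isLeftCoaction_coact f)
  obtain ⟨Q, i, k, hk⟩ := exists_sub f hq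
  have hq' := hq.of_iso i.hom
  rw [← hk] at hq'
  have hfk : k ≫ f = 0 := by
    refine hom_ext ?_
    rw [comp_hom, zero_hom, ← IsComonHom.hom_counit k.hom]
    have h : coact f ≫ B.X ◁ ε[A.X] ≫ (ρ_ B.X).hom = f.hom := by
      rw [coact, Category.assoc, ← whisker_exchange_assoc, ComonObj.comul_counit_assoc]
      simp
    rw [← h, ← Category.assoc, hq'.w, Category.assoc, reassoc_of% trivLeftCoact_natural]
    simp [trivLeftCoact, unitors_inv_equal]
  obtain ⟨d, hd⟩ := KernelFork.IsLimit.lift' hp k hfk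
  obtain ⟨e₀, he₀⟩ := hq'.lift_self p.hom (by
    rw [coact_natural, w, coact_zero, trivLeftCoact_natural])
  let e : D ⟶ Q := { hom := e₀, isBimonHom := isBimonHom_of_comp_mono k hq'.stableMono e₀ p he₀ }
  have he : e ≫ k = p := hom_ext he₀
  dsimp at hd
  have hed : e ≫ d = 𝟙 D := by
    refine Fork.IsLimit.hom_ext hp ?_
    dsimp
    rw [Category.assoc, hd, he, Category.id_comp]
  have hde : d.hom ≫ e₀ = 𝟙 Q.X := by
    have := hq'.stableMono.mono
    rw [← cancel_mono k.hom, Category.assoc, he₀, ← comp_hom, hd, Category.id_comp]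
  have : IsIso e₀ := ⟨d.hom, congrArg Hom.hom hed, hde⟩
  have := hq'.of_iso e₀
  rwa [he₀] at this

end BicommHopf

end Exact

end HopfFredholm

/-! ### Integrals in extensions -/

namespace HopfFredholm

variable {C : Type u} [Category.{v} C] [MonoidalCategory C] [SymmetricCategory C]

section Extension

theorem isNormalizedIntegral_of_comm {A : C} [BimonObj A] [IsCommMonObj A] {σ : 𝟙_ C ⟶ A}
    (h : A ◁ σ ≫ μ[A] = (ρ_ A).hom ≫ ε[A] ≫ σ) (hn : σ ≫ ε[A] = 𝟙 _) :
    IsNormalizedIntegral σ := by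
  have h' : σ ▷ A ≫ μ[A] = (λ_ A).hom ≫ ε[A] ≫ σ := by
    rw [← IsCommMonObj.mul_comm A, BraidedCategory.braiding_naturality_left_assoc, h]
    simp
  refine ⟨?_, ?_, hn⟩
  · rw [tensorHom_id, h', MonoidalCategory.tensorHom_def', Category.assoc, rightUnitor_naturality]
    simp [unitors_inv_equal]
  · rw [id_tensorHom, h, MonoidalCategory.tensorHom_def, Category.assoc, leftUnitor_naturality]
    simp [unitors_equal]

theorem isNormalizedCointegral_of_comm {A : C} [BimonObj A] [IsCommComonObj A] {τ : A ⟶ 𝟙_ C}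
    (h : Δ[A] ≫ A ◁ τ = τ ≫ η[A] ≫ (ρ_ A).inv) (hn : η[A] ≫ τ = 𝟙 _) :
    IsNormalizedCointegral τ := by
  have h' : Δ[A] ≫ τ ▷ A = τ ≫ η[A] ≫ (λ_ A).inv := by
    rw [← IsCommComonObj.comul_comm A, Category.assoc,
      ← BraidedCategory.braiding_naturality_right, reassoc_of% h]
    simp
  refine ⟨?_, ?_, hn⟩
  · rw [tensorHom_id, h', MonoidalCategory.tensorHom_def, ← rightUnitor_inv_naturality_assoc]
    simp [unitors_equal]
  · rw [id_tensorHom, h, MonoidalCategory.tensorHom_def', ← leftUnitor_inv_naturality_assoc]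
    simp [unitors_inv_equal]

namespace BicommHopf

variable {A B D : BicommHopf C} {i : A ⟶ B} {p : B ⟶ D}

/-- The image of an integral under an epimorphism is an integral. -/
theorem integral_comp (hp : StableEpi p.hom) {σ : 𝟙_ C ⟶ B.X} (hσ : IsNormalizedIntegral σ) :
    IsNormalizedIntegral (σ ≫ p.hom) := by
  refine isNormalizedIntegral_of_comm ?_ ?_
  · have := hp.whiskerRight (𝟙_ C)
    rw [← cancel_epi (p.hom ▷ 𝟙_ C), MonoidalCategory.whiskerLeft_comp, Category.assoc,
      ← whisker_exchange_assoc, ← whisker_exchange_assoc, rightUnitor_naturality_assoc,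
      IsComonHom.hom_counit_assoc, whisker_exchange_assoc, ← MonoidalCategory.tensorHom_def_assoc,
      ← IsMonHom.mul_hom, reassoc_of% hσ.whiskerLeft_mul]
  · rw [Category.assoc, IsComonHom.hom_counit, hσ.normalized]

/-- The restriction of a cointegral along a monomorphism is a cointegral. -/
theorem comp_cointegral (hi : StableMono i.hom) {τ : B.X ⟶ 𝟙_ C} (hτ : IsNormalizedCointegral τ) :
    IsNormalizedCointegral (i.hom ≫ τ) := by
  refine isNormalizedCointegral_of_comm ?_ ?_
  · have := hi.whiskerRight (𝟙_ C)
    rw [← cancel_mono (i.hom ▷ 𝟙_ C)]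
    simp only [Category.assoc]
    rw [← rightUnitor_inv_naturality, IsMonHom.one_hom_assoc, ← hτ.comul_whiskerLeft,
      IsComonHom.hom_comul_assoc, MonoidalCategory.whiskerLeft_comp, Category.assoc,
      whisker_exchange, MonoidalCategory.tensorHom_def', Category.assoc]
  · rw [IsMonHom.one_hom_assoc, hτ.normalized]

/-- Average over the cosets of `A`, as an endomorphism of `B`. -/
def normEnd (i : A ⟶ B) (σ : 𝟙_ C ⟶ A.X) : B.X ⟶ B.X := (λ_ B.X).inv ≫ σ ▷ B.X ≫ act i

/-- The projection of `B` to the kernel of `p : B ⟶ D` given by a cointegral of `D`. -/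
def restrictEnd (p : B ⟶ D) (τ : D.X ⟶ 𝟙_ C) : B.X ⟶ B.X := coact p ≫ τ ▷ B.X ≫ (λ_ B.X).hom

/-- The average does not distinguish α from the trivial action, so it descends to a map n : D ⟶ B,
summation over fibres. -/
theorem exists_norm (hp : IsStableCoequalizer (act i) (trivLeftAct A.X B.X) p.hom)
    {σ : 𝟙_ C ⟶ A.X} (hσ : IsNormalizedIntegral σ) :
    ∃ n : D.X ⟶ B.X, p.hom ≫ n = normEnd i σ :=
  hp.desc_self _ (hσ.act_average (isLeftAction_act i))

/-- Contracting with τ takes values in the coinvariants of p, so it lifts to a map m : B ⟶ A. -/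
theorem exists_restrict (hi : IsStableEqualizer (coact p) (trivLeftCoact D.X B.X) i.hom)
    {τ : D.X ⟶ 𝟙_ C} (hτ : IsNormalizedCointegral τ) :
    ∃ m : B.X ⟶ A.X, m ≫ i.hom = restrictEnd p τ :=
  hi.lift_self _ (hτ.average_coact (isLeftCoaction_coact p))

theorem normEnd_counit {σ : 𝟙_ C ⟶ A.X} (hσ : σ ≫ ε[A.X] = 𝟙 _) :
    normEnd i σ ≫ ε[B.X] = ε[B.X] := by
  rw [normEnd, act]
  simp only [Category.assoc, BimonObj.mul_counit, Comon.tensorObj_counit,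
    MonoidalCategory.tensorHom_def, ← comp_whiskerRight_assoc, IsComonHom.hom_counit, hσ]
  simp

theorem one_restrictEnd {τ : D.X ⟶ 𝟙_ C} (hτ : η[D.X] ≫ τ = 𝟙 _) :
    η[B.X] ≫ restrictEnd p τ = η[B.X] := by
  rw [restrictEnd, coact]
  have h : η[B.X] ▷ B.X ≫ p.hom ▷ B.X ≫ τ ▷ B.X = 𝟙 _ := by
    rw [← comp_whiskerRight, ← comp_whiskerRight, IsMonHom.one_hom_assoc, hτ, id_whiskerRight]
  simp only [Category.assoc, BimonObj.one_comul_assoc, MonObj.tensorObj.one_def,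
    MonoidalCategory.tensorHom_def', reassoc_of% h]
  simp

theorem restrictEnd_counit {τ : D.X ⟶ 𝟙_ C} : restrictEnd p τ ≫ ε[B.X] = p.hom ≫ τ := by
  rw [restrictEnd, coact]
  simp only [Category.assoc]
  rw [← leftUnitor_naturality, ← whisker_exchange_assoc, ← whisker_exchange_assoc,
    ComonObj.comul_counit_assoc]
  simp [unitors_equal]

theorem one_normEnd {σ : 𝟙_ C ⟶ A.X} : η[B.X] ≫ normEnd i σ = σ ≫ i.hom := by
  rw [normEnd, act, leftUnitor_inv_naturality_assoc, whisker_exchange_assoc,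
    whisker_exchange_assoc, MonObj.mul_one]
  simp [unitors_inv_equal]

theorem normEnd_whiskerRight_mul {σ : 𝟙_ C ⟶ A.X} :
    normEnd i σ ▷ B.X ≫ μ[B.X] = μ[B.X] ≫ normEnd i σ := by
  rw [normEnd, leftUnitor_inv_naturality_assoc, whisker_exchange_assoc]
  simp [act_whiskerRight_mul]

theorem comul_restrictEnd_whiskerRight {τ : D.X ⟶ 𝟙_ C} :
    Δ[B.X] ≫ restrictEnd p τ ▷ B.X = restrictEnd p τ ≫ Δ[B.X] := by
  simp only [restrictEnd, Category.assoc]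
  rw [← leftUnitor_naturality, ← whisker_exchange_assoc]
  simp [reassoc_of% comul_whiskerRight_coact]

theorem restrictEnd_eq {τ : D.X ⟶ 𝟙_ C} :
    restrictEnd p τ = Δ[B.X] ≫ B.X ◁ (p.hom ≫ τ) ≫ (ρ_ B.X).hom := by
  rw [restrictEnd, coact, ← IsCommComonObj.comul_comm B.X, Category.assoc, Category.assoc,
    ← comp_whiskerRight_assoc, ← BraidedCategory.braiding_naturality_right_assoc]
  simp

theorem normEnd_eq {σ : 𝟙_ C ⟶ A.X} :
    normEnd i σ = (ρ_ B.X).inv ≫ B.X ◁ (σ ≫ i.hom) ≫ μ[B.X] := by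
  rw [normEnd, act, ← IsCommMonObj.mul_comm B.X, ← comp_whiskerRight_assoc,
    BraidedCategory.braiding_naturality_left_assoc]
  simp

/-- In Sweedler notation (a·b)₁ ⊗ p((a·b)₂) = a·b₁ ⊗ p(b₂): the second leg does not see A because p
trivializes the action. -/
theorem act_comul_whiskerLeft (hw : act i ≫ p.hom = trivLeftAct A.X B.X ≫ p.hom) :
    act i ≫ Δ[B.X] ≫ B.X ◁ p.hom =
      A.X ◁ Δ[B.X] ≫ (α_ A.X B.X B.X).inv ≫ act i ▷ B.X ≫ B.X ◁ p.hom := by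
  have h := tensorμ_natural_left (𝟙 A.X) ε[A.X] B.X B.X
  have h' : (act i ⊗ₘ act i) ≫ B.X ◁ p.hom =
      (𝟙 A.X ▷ B.X ⊗ₘ ε[A.X] ▷ B.X) ≫ (act i ⊗ₘ (λ_ B.X).hom ≫ p.hom) := by
    rw [← id_tensorHom, tensorHom_comp_tensorHom, tensorHom_comp_tensorHom, hw, trivLeftAct]
    simp
  have h'' : (ρ_ A.X).inv ▷ (B.X ⊗ B.X) ≫ tensorμ A.X (𝟙_ C) B.X B.X ≫
      (act i ⊗ₘ (λ_ B.X).hom ≫ p.hom) = (α_ A.X B.X B.X).inv ≫ act i ▷ B.X ≫ B.X ◁ p.hom := by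
    rw [tensorμ, braiding_tensorUnit_left, MonoidalCategory.tensorHom_def]
    monoidal
  rw [reassoc_of% act_comul, tensorLeftAct, Category.assoc, h', ← reassoc_of% h, id_tensorHom,
    MonoidalCategory.tensorHom_def', Category.assoc, ← comp_whiskerRight_assoc,
    ComonObj.comul_counit, h'']

theorem whiskerLeft_mul_coact (hw : i.hom ≫ coact p = i.hom ≫ trivLeftCoact D.X B.X) :
    B.X ◁ i.hom ≫ μ[B.X] ≫ coact p =
      B.X ◁ i.hom ≫ coact p ▷ B.X ≫ (α_ D.X B.X B.X).hom ≫ D.X ◁ μ[B.X] := by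
  have h := tensorμ_natural_right D.X B.X η[D.X] (𝟙 B.X)
  have h' : B.X ◁ i.hom ≫ (coact p ⊗ₘ coact p) =
      (coact p ⊗ₘ i.hom ≫ (λ_ B.X).inv) ≫ (D.X ⊗ B.X) ◁ (η[D.X] ⊗ₘ 𝟙 B.X) := by
    rw [← id_tensorHom, ← id_tensorHom, tensorHom_comp_tensorHom, tensorHom_comp_tensorHom, hw,
      trivLeftCoact]
    simp
  have h'' : (coact p ⊗ₘ i.hom ≫ (λ_ B.X).inv) ≫ tensorμ D.X B.X (𝟙_ C) B.X ≫
      (ρ_ D.X).hom ▷ (B.X ⊗ B.X) =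
        B.X ◁ i.hom ≫ coact p ▷ B.X ≫ (α_ D.X B.X B.X).hom := by
    rw [tensorμ, braiding_tensorUnit_right, MonoidalCategory.tensorHom_def']
    monoidal
  rw [mul_coact, tensorLeftCoact, Category.assoc, reassoc_of% h', reassoc_of% h,
    tensorHom_comp_tensorHom, MonObj.mul_one, MonoidalCategory.whiskerLeft_id, Category.id_comp,
    MonoidalCategory.tensorHom_def (ρ_ D.X).hom, reassoc_of% h'']

/-- Contraction with τ involves only p of one leg of the comultiplication, which A does not move. -/
theorem act_restrictEnd (hw : act i ≫ p.hom = trivLeftAct A.X B.X ≫ p.hom) {τ : D.X ⟶ 𝟙_ C} :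
    act i ≫ restrictEnd p τ = A.X ◁ restrictEnd p τ ≫ act i := by
  simp only [restrictEnd_eq, MonoidalCategory.whiskerLeft_comp, Category.assoc]
  rw [reassoc_of% act_comul_whiskerLeft hw, ← whisker_exchange_assoc, ← whisker_exchange_assoc,
    rightUnitor_naturality]
  simp

theorem normEnd_coact (hw : i.hom ≫ coact p = i.hom ≫ trivLeftCoact D.X B.X) {σ : 𝟙_ C ⟶ A.X} :
    normEnd i σ ≫ coact p = coact p ≫ D.X ◁ normEnd i σ := by
  simp only [normEnd_eq, MonoidalCategory.whiskerLeft_comp, Category.assoc]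
  rw [whiskerLeft_mul_coact hw, whisker_exchange_assoc, whisker_exchange_assoc,
    ← rightUnitor_inv_naturality_assoc]
  simp

theorem comp_normEnd {σ : 𝟙_ C ⟶ A.X} (hσ : IsNormalizedIntegral σ) :
    i.hom ≫ normEnd i σ = ε[A.X] ≫ σ ≫ i.hom := by
  have h := hσ.whiskerRight_mul
  rw [normEnd, act, leftUnitor_inv_naturality_assoc, whisker_exchange_assoc,
    whisker_exchange_assoc, ← MonoidalCategory.tensorHom_def_assoc, ← IsMonHom.mul_hom,
    reassoc_of% h, Iso.inv_hom_id_assoc]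

/-- The composition of the average over `A` and the projection to `A`. -/
theorem norm_comp_restrict (hp : IsStableCoequalizer (act i) (trivLeftAct A.X B.X) p.hom)
    (hi : IsStableEqualizer (coact p) (trivLeftCoact D.X B.X) i.hom)
    {σ : 𝟙_ C ⟶ A.X} (hσ : IsNormalizedIntegral σ) {τ : D.X ⟶ 𝟙_ C}
    {n : D.X ⟶ B.X} (hn : p.hom ≫ n = normEnd i σ)
    {m : B.X ⟶ A.X} (hm : m ≫ i.hom = restrictEnd p τ) : n ≫ m = τ ≫ σ := by
  have := hp.stableEpi.epi
  have := hi.stableMono.mono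
  rw [← cancel_epi p.hom, ← cancel_mono i.hom, reassoc_of% hn, Category.assoc, Category.assoc, hm]
  -- Equivariance of the restriction lets the two endomorphisms be exchanged. After the restriction,
  -- averaging takes place inside A, where σ absorbs everything up to the counit.
  have h : normEnd i σ ≫ restrictEnd p τ = restrictEnd p τ ≫ normEnd i σ := by
    rw [normEnd, Category.assoc, Category.assoc, act_restrictEnd hp.w,
      leftUnitor_inv_naturality_assoc, whisker_exchange_assoc]
  rw [h, ← hm, Category.assoc, comp_normEnd hσ, ← IsComonHom.hom_counit i.hom, Category.assoc,
    reassoc_of% hm, reassoc_of% restrictEnd_counit]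
  simp only [Category.assoc]

/-- The map n is linear over p, that is n(d) b = n(d p(b)) (`h₁`), and preserves counits (`h₂`). So
invariance and normalization of σ' pass to σ' ≫ n. -/
theorem integral_extension (hp : IsStableCoequalizer (act i) (trivLeftAct A.X B.X) p.hom)
    {σ : 𝟙_ C ⟶ A.X} (hσ : IsNormalizedIntegral σ) {σ' : 𝟙_ C ⟶ D.X} (hσ' : IsNormalizedIntegral σ')
    {n : D.X ⟶ B.X} (hn : p.hom ≫ n = normEnd i σ) : IsNormalizedIntegral (σ' ≫ n) := by
  have h₁ : n ▷ B.X ≫ μ[B.X] = D.X ◁ p.hom ≫ μ[D.X] ≫ n := by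
    have := hp.stableEpi.whiskerRight B.X
    rw [← cancel_epi (p.hom ▷ B.X), ← comp_whiskerRight_assoc, hn, normEnd_whiskerRight_mul,
      ← hn, IsMonHom.mul_hom_assoc, MonoidalCategory.tensorHom_def, Category.assoc]
  have h₂ : n ≫ ε[B.X] = ε[D.X] := by
    have := hp.stableEpi.epi
    rw [← cancel_epi p.hom, reassoc_of% hn, normEnd_counit hσ.normalized, IsComonHom.hom_counit]
  have h₃ : (σ' ≫ n) ▷ B.X ≫ μ[B.X] = (λ_ B.X).hom ≫ ε[B.X] ≫ σ' ≫ n := by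
    rw [comp_whiskerRight, Category.assoc, h₁, ← whisker_exchange_assoc,
      reassoc_of% hσ'.whiskerRight_mul, leftUnitor_naturality_assoc, IsComonHom.hom_counit_assoc]
  refine isNormalizedIntegral_of_comm ?_ ?_
  · rw [← IsCommMonObj.mul_comm B.X, BraidedCategory.braiding_naturality_right_assoc, h₃]
    simp
  · rw [Category.assoc, h₂, hσ'.normalized]

/-- Dually, m is colinear over i (`h₁`) and preserves units (`h₂`). -/
theorem cointegral_extension (hi : IsStableEqualizer (coact p) (trivLeftCoact D.X B.X) i.hom)
    {τ : D.X ⟶ 𝟙_ C} (hτ : IsNormalizedCointegral τ) {τ' : A.X ⟶ 𝟙_ C}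
    (hτ' : IsNormalizedCointegral τ') {m : B.X ⟶ A.X} (hm : m ≫ i.hom = restrictEnd p τ) :
    IsNormalizedCointegral (m ≫ τ') := by
  have h₁ : Δ[B.X] ≫ m ▷ B.X = m ≫ Δ[A.X] ≫ A.X ◁ i.hom := by
    have := hi.stableMono.whiskerRight B.X
    rw [← cancel_mono (i.hom ▷ B.X)]
    simp only [Category.assoc]
    rw [← comp_whiskerRight, hm, comul_restrictEnd_whiskerRight,
      ← hm, Category.assoc, IsComonHom.hom_comul, MonoidalCategory.tensorHom_def']
  have h₂ : η[B.X] ≫ m = η[A.X] := by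
    have := hi.stableMono.mono
    rw [← cancel_mono i.hom, Category.assoc, hm, one_restrictEnd hτ.normalized, IsMonHom.one_hom]
  have h₃ : Δ[B.X] ≫ (m ≫ τ') ▷ B.X = (m ≫ τ') ≫ η[B.X] ≫ (λ_ B.X).inv := by
    rw [comp_whiskerRight, reassoc_of% h₁, whisker_exchange,
      reassoc_of% hτ'.comul_whiskerRight, ← leftUnitor_inv_naturality, IsMonHom.one_hom_assoc,
      Category.assoc]
  refine isNormalizedCointegral_of_comm ?_ ?_
  · rw [← IsCommComonObj.comul_comm B.X, Category.assoc,
      ← BraidedCategory.braiding_naturality_left, reassoc_of% h₃]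
    simp
  · rw [reassoc_of% h₂, hτ'.normalized]

/-- An integral of `B` restricts to an integral of the kernel of `p : B ⟶ D`. -/
theorem whiskerLeft_restrict_mul
    (hp : act i ≫ p.hom = trivLeftAct A.X B.X ≫ p.hom) (hi : StableMono i.hom)
    {σ : 𝟙_ C ⟶ B.X} (hσ : IsNormalizedIntegral σ) {τ : D.X ⟶ 𝟙_ C}
    {m : B.X ⟶ A.X} (hm : m ≫ i.hom = restrictEnd p τ) :
    A.X ◁ (σ ≫ m) ≫ μ[A.X] = (ρ_ A.X).hom ≫ ε[A.X] ≫ σ ≫ m := by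
  have := hi.mono
  -- After composition with i, m becomes the A-equivariant endomorphism `restrictEnd p τ`, so A can
  -- be moved onto σ, which absorbs it.
  rw [← cancel_mono i.hom]
  simp only [Category.assoc]
  rw [IsMonHom.mul_hom, MonoidalCategory.tensorHom_def', Category.assoc,
    ← MonoidalCategory.whiskerLeft_comp_assoc, Category.assoc, hm, MonoidalCategory.whiskerLeft_comp, Category.assoc,
    ← act, ← act_restrictEnd hp, act, Category.assoc, whisker_exchange_assoc,
    reassoc_of% hσ.whiskerLeft_mul, rightUnitor_naturality_assoc, IsComonHom.hom_counit_assoc]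

theorem restrict_counit {τ : D.X ⟶ 𝟙_ C} {m : B.X ⟶ A.X} (hm : m ≫ i.hom = restrictEnd p τ) :
    m ≫ ε[A.X] = p.hom ≫ τ := by
  rw [← IsComonHom.hom_counit i.hom, reassoc_of% hm, restrictEnd_counit]

/-- A cointegral of `B` induces a cointegral of the cokernel of `i : A ⟶ B`. -/
theorem comul_whiskerLeft_norm
    (hi : i.hom ≫ coact p = i.hom ≫ trivLeftCoact D.X B.X) (hp : StableEpi p.hom)
    {τ : B.X ⟶ 𝟙_ C} (hτ : IsNormalizedCointegral τ) {σ : 𝟙_ C ⟶ A.X}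
    {n : D.X ⟶ B.X} (hn : p.hom ≫ n = normEnd i σ) :
    Δ[D.X] ≫ D.X ◁ (n ≫ τ) = (n ≫ τ) ≫ η[D.X] ≫ (ρ_ D.X).inv := by
  have := hp.epi
  rw [← cancel_epi p.hom]
  simp only [Category.assoc]
  rw [IsComonHom.hom_comul_assoc, MonoidalCategory.tensorHom_def, Category.assoc,
    ← MonoidalCategory.whiskerLeft_comp, reassoc_of% hn, reassoc_of% hn, MonoidalCategory.whiskerLeft_comp,
    ← Category.assoc (Δ[B.X])]
  rw [← coact, ← reassoc_of% normEnd_coact hi, coact, Category.assoc, ← whisker_exchange,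
    reassoc_of% hτ.comul_whiskerLeft, ← rightUnitor_inv_naturality, IsMonHom.one_hom_assoc]

theorem one_norm {σ : 𝟙_ C ⟶ A.X} {n : D.X ⟶ B.X} (hn : p.hom ≫ n = normEnd i σ) :
    η[D.X] ≫ n = σ ≫ i.hom := by
  rw [← IsMonHom.one_hom p.hom, Category.assoc, hn, one_normEnd]

end BicommHopf
end Extension
end HopfFredholm

/-! ### Perfect pairings and adjoint morphisms -/

namespace HopfFredholm

variable {C : Type u} [Category.{v} C] [MonoidalCategory C] [SymmetricCategory C]

section Pairing

/-- Pairing with `e`, with values in `W`. -/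
def pairing {K L : C} (e : L ⊗ K ⟶ 𝟙_ C) {Z W : C} (f : Z ⟶ W ⊗ L) : Z ⊗ K ⟶ W :=
  f ▷ K ≫ (α_ W L K).hom ≫ W ◁ e ≫ (ρ_ W).hom

/-- The pairing `e` identifies `L` with the dual of `K`. -/
def IsPerfect {K L : C} (e : L ⊗ K ⟶ 𝟙_ C) : Prop :=
  ∀ Z W : C, Function.Bijective (pairing e : (Z ⟶ W ⊗ L) → (Z ⊗ K ⟶ W))

theorem isPerfect_evaluation (K L : C) [ExactPairing K L] : IsPerfect (ε_ K L) :=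
  fun Z W => (tensorRightHomEquiv Z K L W).symm.bijective

theorem isPerfect_unit : IsPerfect (λ_ (𝟙_ C)).hom := by
  intro Z W
  have h : ∀ f : Z ⟶ W ⊗ 𝟙_ C, pairing (λ_ (𝟙_ C)).hom f = (ρ_ Z).hom ≫ f ≫ (ρ_ W).hom := by
    intro f
    rw [pairing, ← rightUnitor_naturality_assoc]
    monoidal
  refine ⟨fun f g e => ?_, fun g => ⟨(ρ_ Z).inv ≫ g ≫ (ρ_ W).inv, ?_⟩⟩
  · rw [h, h] at e
    simpa using e
  · rw [h]
    simp

/-- The pairing of two tensor products. -/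
def tensorPairing {K K' L L' : C} (e : L ⊗ K ⟶ 𝟙_ C) (e' : L' ⊗ K' ⟶ 𝟙_ C) :
    (L ⊗ L') ⊗ (K ⊗ K') ⟶ 𝟙_ C :=
  tensorμ L L' K K' ≫ (e ⊗ₘ e') ≫ (λ_ (𝟙_ C)).hom

/-- Once K and K' are swapped, the two pairings are nested, e' inside e. Pairing with a tensor
product is thus an iterated pairing. -/
theorem whiskerLeft_braiding_tensorPairing {K K' L L' : C} (e : L ⊗ K ⟶ 𝟙_ C)
    (e' : L' ⊗ K' ⟶ 𝟙_ C) :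
    (L ⊗ L') ◁ (β_ K' K).hom ≫ tensorPairing e e' =
      (α_ L L' (K' ⊗ K)).hom ≫ L ◁ ((α_ L' K' K).inv ≫ e' ▷ K ≫ (λ_ K).hom) ≫ e := by
  have h := BraidedCategory.hexagon_reverse L' K' K
  have h1 : L' ◁ (β_ K' K).hom ≫ (α_ L' K K').inv ≫ (β_ L' K).hom ▷ K' ≫ (α_ K L' K').hom =
      (α_ L' K' K).inv ≫ (β_ (L' ⊗ K') K).hom := by
    simp
  have h2 : (β_ (L' ⊗ K') K).hom ≫ K ◁ e' = e' ▷ K ≫ (λ_ K).hom ≫ (ρ_ K).inv := by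
    rw [← BraidedCategory.braiding_naturality_left]; simp
  rw [tensorPairing, tensorμ, MonoidalCategory.tensorHom_def']
  simp only [MonoidalCategory.whiskerLeft_comp, Category.assoc]
  rw [tensor_whiskerLeft]
  simp only [Category.assoc, Iso.inv_hom_id_assoc]
  congr 1
  have h3 : L ◁ L' ◁ (β_ K' K).hom ≫ L ◁ (α_ L' K K').inv ≫ L ◁ (β_ L' K).hom ▷ K' ≫
      L ◁ (α_ K L' K').hom = L ◁ (α_ L' K' K).inv ≫ L ◁ (β_ (L' ⊗ K') K).hom := by
    simp only [← MonoidalCategory.whiskerLeft_comp, h1]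
  rw [reassoc_of% h3]
  congr 1
  rw [tensor_whiskerLeft]
  simp only [Category.assoc, Iso.inv_hom_id_assoc]
  rw [← MonoidalCategory.whiskerLeft_comp_assoc, h2]
  simp only [MonoidalCategory.whiskerLeft_comp, Category.assoc]
  congr 2
  rw [unitors_equal, ← cancel_epi (L ◁ (ρ_ K).hom)]
  simp

/-- Up to isomorphisms the pairing map is the composite of the bijections for e' and e. -/
theorem IsPerfect.tensor {K K' L L' : C} {e : L ⊗ K ⟶ 𝟙_ C} {e' : L' ⊗ K' ⟶ 𝟙_ C}
    (h : IsPerfect e) (h' : IsPerfect e') : IsPerfect (tensorPairing e e') := by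
  have key : ∀ (Z W : C) (f : Z ⟶ W ⊗ (L ⊗ L')),
      pairing e (pairing e' (f ≫ (α_ W L L').inv)) =
        ((α_ Z K' K).hom ≫ Z ◁ (β_ K' K).hom) ≫ pairing (tensorPairing e e') f := by
    intro Z W f
    have h1 := whiskerLeft_braiding_tensorPairing e e'
    have h2 : (W ⊗ L ⊗ L') ◁ (β_ K' K).hom ≫ (α_ W (L ⊗ L') (K ⊗ K')).hom ≫
        W ◁ tensorPairing e e' = (α_ W (L ⊗ L') (K' ⊗ K)).hom ≫
          W ◁ ((α_ L L' (K' ⊗ K)).hom ≫ L ◁ ((α_ L' K' K).inv ≫ e' ▷ K ≫ (λ_ K).hom) ≫ e) := by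
      rw [← h1]; simp
    rw [pairing, pairing, pairing, Category.assoc, whisker_exchange_assoc, reassoc_of% h2]
    monoidal
  intro Z W
  refine ⟨fun f g hfg => ?_, fun φ => ?_⟩
  · have h1 := key Z W f
    rw [hfg, ← key Z W g] at h1
    exact (cancel_mono _).1 ((h' _ _).1 ((h _ _).1 h1))
  · obtain ⟨u, hu⟩ := (h _ _).2 (((α_ Z K' K).hom ≫ Z ◁ (β_ K' K).hom) ≫ φ)
    obtain ⟨f, hf⟩ := (h' _ _).2 u
    refine ⟨f ≫ (α_ W L L').hom, ?_⟩
    have h1 := key Z W (f ≫ (α_ W L L').hom)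
    rw [Category.assoc, Iso.hom_inv_id, Category.comp_id, hf, hu] at h1
    exact ((cancel_epi _).1 h1).symm

/-- The morphisms `f` and `f'` are adjoint to each other with respect to `e` and `e'`. -/
def IsAdjoint {K K' L L' : C} (e : L ⊗ K ⟶ 𝟙_ C) (e' : L' ⊗ K' ⟶ 𝟙_ C) (f : K ⟶ K')
    (f' : L' ⟶ L) : Prop :=
  f' ▷ K ≫ e = L' ◁ f ≫ e'

theorem pairing_whiskerLeft {K K' L L' : C} {e : L ⊗ K ⟶ 𝟙_ C} {e' : L' ⊗ K' ⟶ 𝟙_ C}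
    {f : K ⟶ K'} {f' : L' ⟶ L} (h : IsAdjoint e e' f f') {Z W : C} (g : Z ⟶ W ⊗ L') :
    pairing e (g ≫ W ◁ f') = Z ◁ f ≫ pairing e' g := by
  have h' : (W ◁ f') ▷ K ≫ (α_ W L K).hom ≫ W ◁ e = (α_ W L' K).hom ≫ W ◁ (L' ◁ f ≫ e') := by
    rw [← h]; simp
  rw [pairing, comp_whiskerRight_assoc, reassoc_of% h', pairing, whisker_exchange_assoc]
  simp

theorem pairing_comp {K L : C} (e : L ⊗ K ⟶ 𝟙_ C) {Z W W' : C} (g : Z ⟶ W ⊗ L) (f : W ⟶ W') :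
    pairing e (g ≫ f ▷ L) = pairing e g ≫ f := by
  simp only [pairing, comp_whiskerRight, Category.assoc]
  rw [← rightUnitor_naturality, whisker_exchange_assoc]
  simp

theorem pairing_unit {K L : C} (e : L ⊗ K ⟶ 𝟙_ C) {Z : C} (f : Z ⟶ L) :
    pairing e (f ≫ (λ_ L).inv) = f ▷ K ≫ e := by
  simp only [pairing, comp_whiskerRight, Category.assoc]
  congr 1
  rw [← unitors_equal, leftUnitor_naturality]
  monoidal

theorem IsPerfect.eq_of_pairing {K L : C} {e : L ⊗ K ⟶ 𝟙_ C} (h : IsPerfect e) {Z W : C}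
    {f g : Z ⟶ W ⊗ L} (hfg : pairing e f = pairing e g) : f = g :=
  (h Z W).1 hfg

theorem IsPerfect.hom_ext {K L : C} {e : L ⊗ K ⟶ 𝟙_ C} (h : IsPerfect e) {Z : C} {f g : Z ⟶ L}
    (hfg : f ▷ K ≫ e = g ▷ K ≫ e) : f = g := by
  rw [← cancel_mono (λ_ L).inv]
  exact h.eq_of_pairing (by rw [pairing_unit, pairing_unit, hfg])

theorem IsPerfect.exists_isAdjoint {K K' L L' : C} {e : L ⊗ K ⟶ 𝟙_ C} (h : IsPerfect e)
    (e' : L' ⊗ K' ⟶ 𝟙_ C) (f : K ⟶ K') : ∃ f', IsAdjoint e e' f f' := by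
  obtain ⟨g, hg⟩ := (h L' (𝟙_ C)).2 (L' ◁ f ≫ e')
  refine ⟨g ≫ (λ_ L).hom, ?_⟩
  rw [IsAdjoint, ← hg, ← pairing_unit]
  simp

/-- Uniqueness of adjoints is the tool for dualizing diagrams: both sides of an identity between the
L are adjoint to the same morphism between the K. -/
theorem IsPerfect.eq_of_isAdjoint {K K' L L' : C} {e : L ⊗ K ⟶ 𝟙_ C} {e' : L' ⊗ K' ⟶ 𝟙_ C}
    (h : IsPerfect e) {f : K ⟶ K'} {f₁ f₂ : L' ⟶ L} (h₁ : IsAdjoint e e' f f₁)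
    (h₂ : IsAdjoint e e' f f₂) : f₁ = f₂ :=
  h.hom_ext (h₁.trans h₂.symm)

namespace IsAdjoint

theorem id {K L : C} (e : L ⊗ K ⟶ 𝟙_ C) : IsAdjoint e e (𝟙 K) (𝟙 L) := by
  simp [IsAdjoint]

theorem comp {K K' K'' L L' L'' : C} {e : L ⊗ K ⟶ 𝟙_ C} {e' : L' ⊗ K' ⟶ 𝟙_ C}
    {e'' : L'' ⊗ K'' ⟶ 𝟙_ C} {f : K ⟶ K'} {f' : L' ⟶ L} {g : K' ⟶ K''} {g' : L'' ⟶ L'}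
    (hf : IsAdjoint e e' f f') (hg : IsAdjoint e' e'' g g') :
    IsAdjoint e e'' (f ≫ g) (g' ≫ f') := by
  rw [IsAdjoint] at *
  rw [comp_whiskerRight_assoc, hf, ← whisker_exchange_assoc, hg,
    MonoidalCategory.whiskerLeft_comp_assoc]

theorem of_iso {K K' L L' : C} {e : L ⊗ K ⟶ 𝟙_ C} {e' : L' ⊗ K' ⟶ 𝟙_ C} {f : K ≅ K'} {f' : L' ≅ L}
    (h : IsAdjoint e e' f.hom f'.hom) : IsAdjoint e' e f.inv f'.inv := by
  rw [IsAdjoint] at *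
  rw [← cancel_epi (f'.hom ▷ K'), hom_inv_whiskerRight_assoc, ← whisker_exchange_assoc, h,
    whiskerLeft_inv_hom_assoc]

variable {K₁ K₂ K₃ L₁ L₂ L₃ : C} (e₁ : L₁ ⊗ K₁ ⟶ 𝟙_ C) (e₂ : L₂ ⊗ K₂ ⟶ 𝟙_ C)
  (e₃ : L₃ ⊗ K₃ ⟶ 𝟙_ C)

theorem tensor {K K' L L' M M' N N' : C} {e : L ⊗ K ⟶ 𝟙_ C} {e' : L' ⊗ K' ⟶ 𝟙_ C}
    {d : N ⊗ M ⟶ 𝟙_ C} {d' : N' ⊗ M' ⟶ 𝟙_ C}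
    {f : K ⟶ K'} {f' : L' ⟶ L} {g : M ⟶ M'} {g' : N' ⟶ N}
    (hf : IsAdjoint e e' f f') (hg : IsAdjoint d d' g g') :
    IsAdjoint (tensorPairing e d) (tensorPairing e' d') (f ⊗ₘ g) (f' ⊗ₘ g') := by
  rw [IsAdjoint] at *
  have h := tensorμ_natural_left f' g' K M
  have h' := tensorμ_natural_right L' N' f g
  rw [tensorPairing, tensorPairing, reassoc_of% h, reassoc_of% h', tensorHom_comp_tensorHom_assoc,
    tensorHom_comp_tensorHom_assoc, hf, hg]

theorem whiskerLeft {K K' L L' : C} {e : L ⊗ K ⟶ 𝟙_ C} {e' : L' ⊗ K' ⟶ 𝟙_ C}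
    {f : K ⟶ K'} {f' : L' ⟶ L} (hf : IsAdjoint e e' f f') :
    IsAdjoint (tensorPairing e₁ e) (tensorPairing e₁ e') (K₁ ◁ f) (L₁ ◁ f') := by
  simpa using (IsAdjoint.id e₁).tensor hf

theorem whiskerRight {K K' L L' : C} {e : L ⊗ K ⟶ 𝟙_ C} {e' : L' ⊗ K' ⟶ 𝟙_ C}
    {f : K ⟶ K'} {f' : L' ⟶ L} (hf : IsAdjoint e e' f f') :
    IsAdjoint (tensorPairing e e₁) (tensorPairing e' e₁) (f ▷ K₁) (f' ▷ L₁) := by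
  simpa using hf.tensor (IsAdjoint.id e₁)

theorem associator_inv : IsAdjoint (tensorPairing e₁ (tensorPairing e₂ e₃))
    (tensorPairing (tensorPairing e₁ e₂) e₃) (α_ K₁ K₂ K₃).inv (α_ L₁ L₂ L₃).hom := by
  have h := associator_monoidal L₁ L₂ L₃ K₁ K₂ K₃
  have h1 : tensorPairing (tensorPairing e₁ e₂) e₃ = tensorμ (L₁ ⊗ L₂) L₃ (K₁ ⊗ K₂) K₃ ≫
      tensorμ L₁ L₂ K₁ K₂ ▷ (L₃ ⊗ K₃) ≫ (α_ _ _ _).hom ≫ (e₁ ⊗ₘ (e₂ ⊗ₘ e₃)) ≫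
        𝟙_ C ◁ (λ_ (𝟙_ C)).hom ≫ (λ_ (𝟙_ C)).hom := by
    simp only [tensorPairing, MonoidalCategory.tensorHom_def]
    monoidal
  have h2 : tensorPairing e₁ (tensorPairing e₂ e₃) = tensorμ L₁ (L₂ ⊗ L₃) K₁ (K₂ ⊗ K₃) ≫
      (L₁ ⊗ K₁) ◁ tensorμ L₂ L₃ K₂ K₃ ≫ (e₁ ⊗ₘ (e₂ ⊗ₘ e₃)) ≫
        𝟙_ C ◁ (λ_ (𝟙_ C)).hom ≫ (λ_ (𝟙_ C)).hom := by
    simp only [tensorPairing, MonoidalCategory.tensorHom_def']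
    monoidal
  rw [IsAdjoint, h1, h2, reassoc_of% h, MonoidalCategory.tensorHom_def' (α_ L₁ L₂ L₃).hom,
    Category.assoc, whiskerLeft_inv_hom_assoc]

theorem associator_hom : IsAdjoint (tensorPairing (tensorPairing e₁ e₂) e₃)
    (tensorPairing e₁ (tensorPairing e₂ e₃)) (α_ K₁ K₂ K₃).hom (α_ L₁ L₂ L₃).inv :=
  of_iso (f := (α_ K₁ K₂ K₃).symm) (associator_inv e₁ e₂ e₃)

theorem leftUnitor_inv : IsAdjoint e₁ (tensorPairing (λ_ (𝟙_ C)).hom e₁) (λ_ K₁).inv (λ_ L₁).hom := by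
  have h := leftUnitor_monoidal L₁ K₁
  rw [IsAdjoint, tensorPairing]
  have h' : ((λ_ (𝟙_ C)).hom ⊗ₘ e₁) ≫ (λ_ (𝟙_ C)).hom =
      (λ_ (𝟙_ C)).hom ▷ (L₁ ⊗ K₁) ≫ (λ_ (L₁ ⊗ K₁)).hom ≫ e₁ := by
    rw [MonoidalCategory.tensorHom_def, Category.assoc, leftUnitor_naturality]
  rw [h', ← reassoc_of% h, MonoidalCategory.tensorHom_def', Category.assoc,
    whiskerLeft_inv_hom_assoc]

theorem leftUnitor_hom : IsAdjoint (tensorPairing (λ_ (𝟙_ C)).hom e₁) e₁ (λ_ K₁).hom (λ_ L₁).inv :=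
  of_iso (f := (λ_ K₁).symm) (leftUnitor_inv e₁)

theorem rightUnitor_inv :
    IsAdjoint e₁ (tensorPairing e₁ (λ_ (𝟙_ C)).hom) (ρ_ K₁).inv (ρ_ L₁).hom := by
  have h := rightUnitor_monoidal L₁ K₁
  rw [IsAdjoint, tensorPairing]
  have h' : (e₁ ⊗ₘ (λ_ (𝟙_ C)).hom) ≫ (λ_ (𝟙_ C)).hom =
      (L₁ ⊗ K₁) ◁ (λ_ (𝟙_ C)).hom ≫ (ρ_ (L₁ ⊗ K₁)).hom ≫ e₁ := by
    rw [MonoidalCategory.tensorHom_def', Category.assoc, unitors_equal, rightUnitor_naturality]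
  rw [h', ← reassoc_of% h, MonoidalCategory.tensorHom_def', Category.assoc,
    whiskerLeft_inv_hom_assoc]

theorem rightUnitor_hom :
    IsAdjoint (tensorPairing e₁ (λ_ (𝟙_ C)).hom) e₁ (ρ_ K₁).hom (ρ_ L₁).inv :=
  of_iso (f := (ρ_ K₁).symm) (rightUnitor_inv e₁)

theorem braiding : IsAdjoint (tensorPairing e₁ e₂) (tensorPairing e₂ e₁) (β_ K₁ K₂).hom
    (β_ L₂ L₁).hom := by
  have h : tensorμ L₂ L₁ K₂ K₁ ≫ (β_ (L₂ ⊗ K₂) (L₁ ⊗ K₁)).hom =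
      ((β_ L₂ L₁).hom ⊗ₘ (β_ K₂ K₁).hom) ≫ tensorμ L₁ L₂ K₁ K₂ := by
    simp [tensorμ, SymmetricCategory.braiding_swap_eq_inv_braiding K₂ L₁,
      MonoidalCategory.tensorHom_def]
  have h' : (e₂ ⊗ₘ e₁) ≫ (λ_ (𝟙_ C)).hom =
      (β_ (L₂ ⊗ K₂) (L₁ ⊗ K₁)).hom ≫ (e₁ ⊗ₘ e₂) ≫ (λ_ (𝟙_ C)).hom := by
    rw [← BraidedCategory.braiding_naturality_assoc, braiding_tensorUnit_left]
    simp [unitors_equal]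
  rw [IsAdjoint, tensorPairing, tensorPairing, h', reassoc_of% h,
    MonoidalCategory.tensorHom_def' (β_ L₂ L₁).hom, Category.assoc, ← MonoidalCategory.whiskerLeft_comp_assoc, SymmetricCategory.symmetry,
    MonoidalCategory.whiskerLeft_id, Category.id_comp]

theorem tensorμ {K₁ K₂ K₃ K₄ L₁ L₂ L₃ L₄ : C} (e₁ : L₁ ⊗ K₁ ⟶ 𝟙_ C) (e₂ : L₂ ⊗ K₂ ⟶ 𝟙_ C)
    (e₃ : L₃ ⊗ K₃ ⟶ 𝟙_ C) (e₄ : L₄ ⊗ K₄ ⟶ 𝟙_ C) :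
    IsAdjoint (tensorPairing (tensorPairing e₁ e₂) (tensorPairing e₃ e₄))
      (tensorPairing (tensorPairing e₁ e₃) (tensorPairing e₂ e₄))
      (MonoidalCategory.tensorμ K₁ K₂ K₃ K₄) (MonoidalCategory.tensorμ L₁ L₃ L₂ L₄) := by
  have h := (associator_hom e₁ e₂ (tensorPairing e₃ e₄)).comp
    ((whiskerLeft e₁ ((associator_inv e₂ e₃ e₄).comp
      ((whiskerRight e₄ (braiding e₂ e₃)).comp (associator_hom e₃ e₂ e₄)))).comp
      (associator_inv e₁ e₃ (tensorPairing e₂ e₄)))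
  simpa [MonoidalCategory.tensorμ] using h

end IsAdjoint

end Pairing
end HopfFredholm

/-! ### Dual bimonoids and duals of coinvariants -/

namespace HopfFredholm

variable {C : Type u} [Category.{v} C] [MonoidalCategory C] [SymmetricCategory C]

section Dual

/-- A bimonoid structure on the dual object of a bimonoid. -/
theorem exists_dual_bimonObj {K L : C} [BimonObj K] {e : L ⊗ K ⟶ 𝟙_ C} (he : IsPerfect e) :
    ∃ _ : BimonObj L, IsAdjoint e (tensorPairing e e) Δ[K] μ[L] ∧
      IsAdjoint e (λ_ (𝟙_ C)).hom ε[K] η[L] ∧ IsAdjoint (tensorPairing e e) e μ[K] Δ[L] ∧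
      IsAdjoint (λ_ (𝟙_ C)).hom e η[K] ε[L] := by
  have he₀ := isPerfect_unit (C := C)
  have he₂ := he.tensor he
  -- The operations of L are the adjoints of those of K with the roles exchanged. Each axiom below
  -- follows from the dual axiom of K by uniqueness of adjoints.
  obtain ⟨m, hm⟩ := he.exists_isAdjoint (tensorPairing e e) Δ[K]
  obtain ⟨u, hu⟩ := he.exists_isAdjoint (λ_ (𝟙_ C)).hom ε[K]
  obtain ⟨d, hd⟩ := he₂.exists_isAdjoint e μ[K]
  obtain ⟨t, ht⟩ := he₀.exists_isAdjoint e η[K]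
  let M : MonObj L :=
    { one := u
      mul := m
      one_mul := by
        refine he.eq_of_isAdjoint (hm.comp (hu.whiskerRight e)) ?_
        rw [ComonObj.counit_comul]
        exact IsAdjoint.leftUnitor_inv e
      mul_one := by
        refine he.eq_of_isAdjoint (hm.comp (hu.whiskerLeft e)) ?_
        rw [ComonObj.comul_counit]
        exact IsAdjoint.rightUnitor_inv e
      mul_assoc := by
        refine he.eq_of_isAdjoint (hm.comp (hm.whiskerRight e)) ?_
        have h := (hm.comp (hm.whiskerLeft e)).comp (IsAdjoint.associator_inv e e e)
        rwa [ComonObj.comul_assoc, Category.assoc, Category.assoc, Iso.hom_inv_id,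
          Category.comp_id] at h }
  let N : ComonObj L :=
    { counit := t
      comul := d
      counit_comul := by
        refine (he₀.tensor he).eq_of_isAdjoint ((ht.whiskerRight e).comp hd) ?_
        rw [MonObj.one_mul]
        exact IsAdjoint.leftUnitor_hom e
      comul_counit := by
        refine (he.tensor he₀).eq_of_isAdjoint ((ht.whiskerLeft e).comp hd) ?_
        rw [MonObj.mul_one]
        exact IsAdjoint.rightUnitor_hom e
      comul_assoc := by
        refine (he.tensor he₂).eq_of_isAdjoint ((hd.whiskerLeft e).comp hd) ?_
        have h := (IsAdjoint.associator_inv e e e).comp ((hd.whiskerRight e).comp hd)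
        rwa [MonObj.mul_assoc, Iso.inv_hom_id_assoc, Category.assoc] at h }
  refine ⟨{ M, N with
    mul_comul := ?_
    one_comul := ?_
    mul_counit := ?_
    one_counit := ?_ }, hm, hu, hd, ht⟩
  · refine he₂.eq_of_isAdjoint (hd.comp hm) ?_
    rw [BimonObj.mul_comul]
    have h := (hm.tensor hm).comp ((IsAdjoint.tensorμ e e e e).comp (hd.tensor hd))
    rwa [Category.assoc] at h
  · refine he₂.eq_of_isAdjoint (hd.comp hu) ?_
    rw [BimonObj.mul_counit]
    exact (hu.tensor hu).comp (IsAdjoint.leftUnitor_hom _)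
  · refine he₀.eq_of_isAdjoint (ht.comp hm) ?_
    rw [BimonObj.one_comul]
    exact (IsAdjoint.leftUnitor_inv _).comp (ht.tensor ht)
  · refine he₀.eq_of_isAdjoint (ht.comp hu) ?_
    rw [BimonObj.one_counit]
    exact IsAdjoint.id _

/-- The coaction of the dual bimonoid that is adjoint to an action. -/
theorem exists_adjoint_coaction {K L X Y : C} [BimonObj K] [BimonObj L] {e : L ⊗ K ⟶ 𝟙_ C}
    {d : Y ⊗ X ⟶ 𝟙_ C} (he : IsPerfect e) (hd : IsPerfect d)
    (hΔ : IsAdjoint (tensorPairing e e) e μ[K] Δ[L])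
    (hε : IsAdjoint (λ_ (𝟙_ C)).hom e η[K] ε[L]) {a : K ⊗ X ⟶ X} (ha : IsLeftAction a) :
    ∃ b : Y ⟶ L ⊗ Y, IsAdjoint (tensorPairing e d) d a b ∧ IsLeftCoaction b := by
  obtain ⟨b, hb⟩ := (he.tensor hd).exists_isAdjoint d a
  refine ⟨b, hb, ?_, ?_⟩
  · refine ((he.tensor he).tensor hd).eq_of_isAdjoint ((hΔ.whiskerRight d).comp hb) ?_
    rw [ha.assoc]
    have h := (IsAdjoint.associator_hom e e d).comp ((hb.whiskerLeft e).comp hb)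
    rwa [Category.assoc] at h
  · refine (isPerfect_unit.tensor hd).eq_of_isAdjoint ((hε.whiskerRight d).comp hb) ?_
    rw [ha.unit]
    exact IsAdjoint.leftUnitor_hom d

theorem isAdjoint_trivLeftCoact {K L X Y : C} [BimonObj K] [BimonObj L] {e : L ⊗ K ⟶ 𝟙_ C}
    (d : Y ⊗ X ⟶ 𝟙_ C) (hη : IsAdjoint e (λ_ (𝟙_ C)).hom ε[K] η[L]) :
    IsAdjoint (tensorPairing e d) d (trivLeftAct K X) (trivLeftCoact L Y) :=
  (hη.whiskerRight d).comp (IsAdjoint.leftUnitor_hom d)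

/-- The coinvariants of an action of a dualizable bimonoid on a dualizable object are dualizable. -/
theorem exists_dual_of_isStableCoequalizer [HasEqualizers C] [HasCoequalizers C]
    (hC : IsBistable C) {K L X Y Q : C} [BimonObj K] {e : L ⊗ K ⟶ 𝟙_ C} {d : Y ⊗ X ⟶ 𝟙_ C}
    (he : IsPerfect e) (hd : IsPerfect d) {a : K ⊗ X ⟶ X} (ha : IsLeftAction a) {p : X ⟶ Q}
    (hp : IsStableCoequalizer a (trivLeftAct K X) p) :
    ∃ (E : C) (ev : E ⊗ Q ⟶ 𝟙_ C) (c : 𝟙_ C ⟶ Q ⊗ E),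
      c ▷ Q ≫ (α_ Q E Q).hom ≫ Q ◁ ev = (λ_ Q).hom ≫ (ρ_ Q).inv := by
  obtain ⟨_, -, hη, hΔ, hε⟩ := exists_dual_bimonObj he
  obtain ⟨b, hb, hb'⟩ := exists_adjoint_coaction he hd hΔ hε ha
  have hj := hC.isStableEqualizer hb'
  set j := equalizer.ι b (trivLeftCoact L Y)
  have ht := isAdjoint_trivLeftCoact d hη
  -- The dual of Q is the equalizer of the adjoint coaction on Y. Restricted to it, d no longer sees
  -- the action on X, so it descends to Q.
  obtain ⟨ev, hev⟩ := hp.desc (j ▷ X ≫ d) (by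
    rw [whisker_exchange_assoc, whisker_exchange_assoc, ← hb, ← ht, ← comp_whiskerRight_assoc,
      ← comp_whiskerRight_assoc, hj.w])
  -- c₀ is the coevaluation 𝟙 ⟶ X ⊗ Y. As p equalizes the action, the image of c₀ in Q ⊗ Y is
  -- equalized by the adjoint coaction, and so lifts to Q ⊗ E.
  obtain ⟨c₀, hc₀⟩ := (hd (𝟙_ C) X).2 (λ_ X).hom
  obtain ⟨c, hc⟩ := hj.lift (c₀ ≫ p ▷ Y) (by
    refine (he.tensor hd).eq_of_pairing ?_
    rw [pairing_whiskerLeft hb, pairing_whiskerLeft ht, pairing_comp, hc₀,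
      leftUnitor_naturality_assoc, leftUnitor_naturality_assoc, hp.w])
  refine ⟨_, ev, c, ?_⟩
  have := hp.epi (𝟙_ C)
  rw [← cancel_epi (𝟙_ C ◁ p), ← cancel_mono (ρ_ Q).hom]
  have h1 := congr(pairing d $hc)
  rw [pairing_comp, hc₀, pairing, comp_whiskerRight] at h1
  have h2 : (Q ◁ j) ▷ X ≫ (α_ Q Y X).hom ≫ Q ◁ d =
      (α_ Q _ X).hom ≫ Q ◁ (_ ◁ p ≫ ev) := by
    rw [hev]; simp
  rw [Category.assoc, reassoc_of% h2] at h1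
  simp only [Category.assoc, Iso.inv_hom_id, Category.comp_id]
  rw [whisker_exchange_assoc, leftUnitor_naturality, ← h1]
  simp

end Dual
end HopfFredholm

/-! ### Frobenius pairings and the dimension -/

namespace HopfFredholm

variable {C : Type u} [Category.{v} C] [MonoidalCategory C] [SymmetricCategory C]

section Frobenius

open HopfObj

/-- A symmetric pairing that satisfies one of the triangle identities is perfect. -/
theorem isPerfect_of_symm {A : C} {e : A ⊗ A ⟶ 𝟙_ C} (he : (β_ A A).hom ≫ e = e)
    {c : 𝟙_ C ⟶ A ⊗ A} (hc : A ◁ c ≫ (α_ A A A).inv ≫ e ▷ A = (ρ_ A).hom ≫ (λ_ A).inv) :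
    IsPerfect e := by
  -- The given triangle identity recovers f from its pairing, so e is nondegenerate.
  have hinj : ∀ {f : A ⟶ A}, f ▷ A ≫ e = e → f = 𝟙 A := by
    intro f hf
    have h1 : A ◁ c ≫ (α_ A A A).inv ≫ (f ▷ A ≫ e) ▷ A = (ρ_ A).hom ≫ f ≫ (λ_ A).inv := by
      rw [← rightUnitor_naturality_assoc, ← hc, ← whisker_exchange_assoc]
      simp
    rw [hf, hc] at h1
    exact (cancel_mono (λ_ A).inv).1 (by simpa using h1.symm)
  -- The second triangle is tested against e. Symmetry of e and the interchange of two copies of it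
  -- reduce this to the first triangle.
  have hsnake : (λ_ A).inv ≫ c ▷ A ≫ (α_ A A A).hom ≫ A ◁ e ≫ (ρ_ A).hom = 𝟙 A := by
    refine hinj ?_
    rw [← he, BraidedCategory.braiding_naturality_left_assoc, he]
    have h2 : A ◁ ((λ_ A).inv ≫ c ▷ A ≫ (α_ A A A).hom ≫ A ◁ e ≫ (ρ_ A).hom) ≫ e =
        ((ρ_ A).inv ≫ A ◁ c ≫ (α_ A A A).inv ≫ e ▷ A ≫ (λ_ A).hom) ▷ A ≫ e := by
      have h3 : e ▷ (A ⊗ A) ≫ 𝟙_ C ◁ e = (A ⊗ A) ◁ e ≫ e ▷ 𝟙_ C := (whisker_exchange _ _).symm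
      have h4 := congr((ρ_ A).inv ▷ A ≫ (A ◁ c) ▷ A ≫ (α_ A A A).inv ▷ A ≫ (α_ _ _ _).hom ≫ $h3 ≫
        (λ_ _).hom)
      have h5 : e ▷ 𝟙_ C ≫ (λ_ (𝟙_ C)).hom = (ρ_ _).hom ≫ e := by
        rw [unitors_equal, rightUnitor_naturality]
      simp only [Category.assoc] at h4
      rw [leftUnitor_naturality, h5] at h4
      refine Eq.trans ?_ (h4.symm.trans ?_) <;> monoidal
    rw [h2, reassoc_of% hc]
    simp [he]
  let _ : ExactPairing A A :=
    { coevaluation' := c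
      evaluation' := e
      coevaluation_evaluation' := hc
      evaluation_coevaluation' := by
        rw [← cancel_epi (λ_ A).inv, ← cancel_mono (ρ_ A).hom]
        simpa using hsnake }
  exact isPerfect_evaluation A A

section

variable {A : C} [HopfObj A] [IsCommMonObj A]

/-- In Sweedler notation t(a₁ b₁) b₂ a₂ = t((ab)₁) (ab)₂, by multiplicativity of Δ and
commutativity. -/
theorem mul_comul_average (t : A ⟶ 𝟙_ C) :
    Δ[A] ▷ A ≫ (α_ A A A).hom ≫ A ◁ (β_ A A).hom ≫ (α_ A A A).inv ≫
      (A ◁ Δ[A] ≫ (α_ A A A).inv ≫ (μ[A] ≫ t) ▷ A ≫ (λ_ A).hom) ▷ A ≫ μ[A] =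
        μ[A] ≫ Δ[A] ≫ t ▷ A ≫ (λ_ A).hom := by
  have h : (β_ A A).hom ≫ Δ[A] ▷ A = A ◁ Δ[A] ≫ (α_ A A A).inv ≫ (β_ A A).hom ▷ A ≫
      (α_ A A A).hom ≫ A ◁ (β_ A A).hom ≫ (α_ A A A).inv := by
    rw [← BraidedCategory.braiding_naturality_right, ← cancel_mono (α_ A A A).hom]
    simp
  have h2 : A ◁ (β_ A A).hom ≫ (α_ A A A).inv ≫ (A ◁ Δ[A]) ▷ A =
      A ◁ (A ◁ Δ[A] ≫ (α_ A A A).inv ≫ (β_ A A).hom ▷ A ≫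
      (α_ A A A).hom ≫ A ◁ (β_ A A).hom ≫ (α_ A A A).inv) ≫ (α_ _ _ _).inv := by
    rw [← h]; simp
  rw [comp_whiskerRight_assoc, reassoc_of% h2, BimonObj.mul_comul_assoc, tensorμ]
  have h3 : (A ⊗ A) ◁ (β_ A A).hom ≫ (μ[A] ≫ t) ▷ (A ⊗ A) ≫ 𝟙_ C ◁ μ[A] =
      (μ[A] ≫ t) ▷ (A ⊗ A) ≫ 𝟙_ C ◁ μ[A] := by
    rw [whisker_exchange_assoc, ← MonoidalCategory.whiskerLeft_comp, IsCommMonObj.mul_comm]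
  have h4 := congr(Δ[A] ▷ A ≫ (α_ A A A).hom ≫ A ◁ A ◁ Δ[A] ≫ A ◁ (α_ A A A).inv ≫
    A ◁ (β_ A A).hom ▷ A ≫ A ◁ (α_ A A A).hom ≫ (α_ _ _ _).inv ≫ $h3 ≫ (λ_ A).hom)
  refine Eq.trans ?_ (h4.trans ?_)
  · monoidal
  · rw [MonoidalCategory.tensorHom_def, MonoidalCategory.tensorHom_def]
    simp only [Category.assoc]
    rw [whisker_exchange_assoc t μ[A]]
    monoidal

theorem scalar_whiskerRight (X : C) (f : 𝟙_ C ⟶ 𝟙_ C) :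
    (λ_ X).inv ≫ f ▷ X ≫ (λ_ X).hom = (ρ_ X).inv ≫ X ◁ f ≫ (ρ_ X).hom := by
  have h := BraidedCategory.braiding_naturality_left f X
  rw [braiding_tensorUnit_left] at h
  rw [← cancel_mono (ρ_ X).inv, Category.assoc, Category.assoc, h]
  simp

/-- The Fourier transform of an integral. -/
theorem average_integral {s : 𝟙_ C ⟶ A} (hs : A ◁ s ≫ μ[A] = (ρ_ A).hom ≫ ε[A] ≫ s)
    {t : A ⟶ 𝟙_ C} (ht : Δ[A] ≫ t ▷ A = t ≫ η[A] ≫ (λ_ A).inv) :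
    A ◁ (s ≫ Δ[A] ≫ A ◁ 𝒮[A]) ≫ (α_ A A A).inv ≫ (μ[A] ≫ t) ▷ A =
      A ◁ (s ≫ t) ≫ (ρ_ A).hom ≫ (λ_ A).inv := by
  set g : A ⟶ A := (ρ_ A).inv ≫ A ◁ s ≫ A ◁ Δ[A] ≫ (α_ A A A).inv ≫ (μ[A] ≫ t) ▷ A ≫ (λ_ A).hom
    with hg
  -- Here g(a) = t(a s₁) s₂. By `mul_comul_average` and the invariance of s and t, g(a₁) a₂ = ε(a)
  -- t(s) 1.
  have h1 : Δ[A] ≫ g ▷ A ≫ μ[A] = ε[A] ≫ (s ≫ t) ≫ η[A] := by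
    have h := mul_comul_average (A := A) t
    have h' := congr((ρ_ A).inv ≫ A ◁ s ≫ $h)
    rw [reassoc_of% hs, Iso.inv_hom_id_assoc, reassoc_of% ht, Iso.inv_hom_id, Category.comp_id]
      at h'
    rw [Category.assoc, ← h', whisker_exchange_assoc, associator_naturality_right_assoc,
      ← MonoidalCategory.whiskerLeft_comp_assoc A (A ◁ s),
      BraidedCategory.braiding_naturality_right, ← rightUnitor_inv_naturality_assoc, hg]
    simp
  have h2 : g = (λ_ A).inv ≫ (s ≫ t) ▷ A ≫ (λ_ A).hom ≫ 𝒮[A] := by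
    -- By `h1`, g * id = t(s)·1 in the convolution monoid. The antipode is the convolution inverse
    -- of the identity, so g = t(s)·S; applying S once more and using S² = id gives the claim.
    let G : Conv A A := g
    let I : Conv A A := 𝟙 A
    let S : Conv A A := 𝒮[A]
    let Z : Conv A A := ε[A] ≫ (s ≫ t) ≫ η[A]
    have hGI : G * I = Z := by
      change Δ[A] ≫ g ▷ A ≫ A ◁ 𝟙 A ≫ μ[A] = ε[A] ≫ (s ≫ t) ≫ η[A]
      rw [MonoidalCategory.whiskerLeft_id, Category.id_comp, h1]
    have hIS : I * S = 1 := by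
      change Δ[A] ≫ 𝟙 A ▷ A ≫ A ◁ 𝒮[A] ≫ μ[A] = ε[A] ≫ η[A]
      rw [id_whiskerRight, Category.id_comp, HopfObj.antipode_right]
    have : G = Z * S := by rw [← hGI, mul_assoc, hIS, mul_one]
    change g = Δ[A] ≫ (ε[A] ≫ (s ≫ t) ≫ η[A]) ▷ A ≫ A ◁ 𝒮[A] ≫ μ[A] at this
    refine this.trans ?_
    rw [comp_whiskerRight, comp_whiskerRight, Category.assoc, Category.assoc,
      ComonObj.counit_comul_assoc, ← whisker_exchange_assoc, MonObj.one_mul, leftUnitor_naturality]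
  have h3 : 𝒮[A] ≫ 𝒮[A] = 𝟙 A := HopfObj.antipode_antipode A (IsCommMonObj.mul_comm A)
  have h4 : g ≫ 𝒮[A] = (ρ_ A).inv ≫ A ◁ (s ≫ t) ≫ (ρ_ A).hom := by
    rw [h2, ← scalar_whiskerRight]
    simp [h3]
  rw [← cancel_epi (ρ_ A).inv, ← cancel_mono (λ_ A).hom]
  simp only [Category.assoc, Iso.inv_hom_id, Category.comp_id]
  rw [← h4, hg]
  simp only [Category.assoc]
  rw [← leftUnitor_naturality, ← whisker_exchange_assoc]
  simp

/-- The pairing given by a cointegral is perfect if the cointegral is invertible on an integral. -/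
theorem isPerfect_of_integral {s : 𝟙_ C ⟶ A} (hs : A ◁ s ≫ μ[A] = (ρ_ A).hom ≫ ε[A] ≫ s)
    {t : A ⟶ 𝟙_ C} (ht : Δ[A] ≫ t ▷ A = t ≫ η[A] ≫ (λ_ A).inv) {w : 𝟙_ C ⟶ 𝟙_ C}
    (hw : w ≫ s ≫ t = 𝟙 _) : IsPerfect (μ[A] ≫ t) := by
  -- The copairing is s₁ ⊗ S(s₂), rescaled by the inverse w of t(s).
  refine isPerfect_of_symm (c := w ≫ s ≫ Δ[A] ≫ A ◁ 𝒮[A]) ?_ ?_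
  · rw [← Category.assoc, IsCommMonObj.mul_comm]
  · rw [MonoidalCategory.whiskerLeft_comp, Category.assoc, average_integral hs ht,
      ← MonoidalCategory.whiskerLeft_comp_assoc, hw]
    simp

end

/-- If `A` is dualizable, the pairing of a normalized integral and a normalized cointegral
is invertible: its inverse is the dimension of `A`. -/
theorem exists_inv_of_dual {A E : C} [HopfObj A] [IsCommMonObj A]
    {ev : E ⊗ A ⟶ 𝟙_ C} {c : 𝟙_ C ⟶ A ⊗ E}
    (h : c ▷ A ≫ (α_ A E A).hom ≫ A ◁ ev = (λ_ A).hom ≫ (ρ_ A).inv)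
    {s : 𝟙_ C ⟶ A} (hs : A ◁ s ≫ μ[A] = (ρ_ A).hom ≫ ε[A] ≫ s) (hsn : s ≫ ε[A] = 𝟙 _)
    {t : A ⟶ 𝟙_ C} (ht : Δ[A] ≫ t ▷ A = t ≫ η[A] ≫ (λ_ A).inv) (htn : η[A] ≫ t = 𝟙 _) :
    (c ≫ (β_ A E).hom ≫ ev) ≫ s ≫ t = 𝟙 _ := by
  set D := s ≫ Δ[A] ≫ A ◁ 𝒮[A] with hD
  set e := μ[A] ≫ t with he
  have h1 := whiskerLeft_braiding_tensorPairing ev e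
  have h2 := whiskerLeft_braiding_tensorPairing e ev
  have h3 : (β_ A E).hom ▷ (A ⊗ A) ≫ tensorPairing ev e =
    (A ⊗ E) ◁ (β_ A A).hom ≫ tensorPairing e ev := IsAdjoint.braiding ev e
  -- t(s) times the dimension is the trace of t(s)·id, and `average_integral` replaces t(s)·id by a
  -- ↦ t(a s₁) S(s₂).
  have h4 : (c ≫ (β_ A E).hom ≫ ev) ≫ s ≫ t =
      c ≫ (β_ A E).hom ≫ (ρ_ _).inv ≫ (E ⊗ A) ◁ D ≫ (α_ E A (A ⊗ A)).hom ≫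
        E ◁ ((α_ A A A).inv ≫ e ▷ A ≫ (λ_ A).hom) ≫ ev := by
    have h5 := average_integral hs ht
    have h6 : E ◁ ((ρ_ A).inv ≫ A ◁ (s ≫ t) ≫ (ρ_ A).hom) ≫ ev = ev ≫ s ≫ t := by
      have h8 : (E ⊗ A) ◁ (s ≫ t) ≫ ev ▷ 𝟙_ C ≫ (ρ_ _).hom = (ρ_ _).hom ≫ ev ≫ s ≫ t := by
        rw [whisker_exchange_assoc, ← unitors_equal, leftUnitor_naturality, unitors_equal,
          rightUnitor_naturality_assoc]
      rw [rightUnitor_naturality] at h8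
      rw [← cancel_epi (ρ_ _).hom, ← h8]
      monoidal
    have h9 : (ρ_ A).inv ≫ A ◁ D ≫ (α_ A A A).inv ≫ e ▷ A ≫ (λ_ A).hom =
        (ρ_ A).inv ≫ A ◁ (s ≫ t) ≫ (ρ_ A).hom := by
      rw [reassoc_of% h5]; simp
    rw [Category.assoc, Category.assoc, ← h6, ← h9]
    monoidal
  -- The trace evaluates to t(S(s₂) s₁) = ε(s) t(1) = 1 by the antipode axiom and commutativity.
  have h7 : D ≫ (β_ A A).hom ≫ e = 𝟙 _ := by
    rw [he, hD]
    simp only [Category.assoc]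
    rw [IsCommMonObj.mul_comm_assoc, HopfObj.antipode_right_assoc, htn, Category.comp_id, hsn]
  -- The triangle identity removes the evaluation and coevaluation of the dual pair.
  have h10 : c ≫ (ρ_ _).inv ≫ (A ⊗ E) ◁ (D ≫ (β_ A A).hom) ≫ (α_ A E (A ⊗ A)).hom ≫
      A ◁ ((α_ E A A).inv ≫ ev ▷ A ≫ (λ_ A).hom) ≫ e = D ≫ (β_ A A).hom ≫ e := by
    have h11 : c ≫ (ρ_ _).inv ≫ (A ⊗ E) ◁ (D ≫ (β_ A A).hom) =
        (D ≫ (β_ A A).hom) ≫ (λ_ _).inv ≫ c ▷ (A ⊗ A) := by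
      rw [leftUnitor_inv_naturality_assoc, whisker_exchange, rightUnitor_inv_naturality_assoc,
        unitors_inv_equal]
    have h12 : (λ_ (A ⊗ A)).inv ≫ c ▷ (A ⊗ A) ≫ (α_ A E (A ⊗ A)).hom ≫
        A ◁ ((α_ E A A).inv ≫ ev ▷ A ≫ (λ_ A).hom) = 𝟙 _ := by
      have h13 := congr((λ_ A).inv ▷ A ≫ $h ▷ A ≫ (ρ_ A).hom ▷ A)
      refine Eq.trans ?_ (h13.trans ?_)
      · monoidal
      · simp
    rw [reassoc_of% h11, reassoc_of% h12]
  rw [h4, ← h1, rightUnitor_inv_naturality_assoc, ← whisker_exchange_assoc,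
    ← whisker_exchange_assoc, h3, h2, ← MonoidalCategory.whiskerLeft_comp_assoc, h10, h7]

end Frobenius
end HopfFredholm

/-! ### The inverse volume of bicommutative Hopf monoids -/

namespace HopfFredholm

variable {C : Type u} [Category.{v} C] [MonoidalCategory C] [SymmetricCategory C]

section VolumeOfHopf

/-- The Eckmann–Hilton argument: tensoring and composing scalars coincide. -/
theorem end_unit_comm (f g : 𝟙_ C ⟶ 𝟙_ C) : f ≫ g = g ≫ f := by
  have h := whisker_exchange f g
  have hf : f ▷ 𝟙_ C = (ρ_ _).hom ≫ f ≫ (ρ_ _).inv := by simp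
  have hg : 𝟙_ C ◁ g = (ρ_ _).hom ≫ g ≫ (ρ_ _).inv := by
    rw [← unitors_equal, ← unitors_inv_equal]; simp
  rw [hf, hg] at h
  simpa using h.symm

theorem end_unit_mul_inv {a b x y : 𝟙_ C ⟶ 𝟙_ C} (hx : a ≫ x = 𝟙 _) (hy : b ≫ y = 𝟙 _) :
    (x ≫ b) ≫ a ≫ y = 𝟙 _ := by
  rw [Category.assoc, ← Category.assoc b, end_unit_comm b a, Category.assoc, hy, Category.comp_id,
    end_unit_comm, hx]

theorem whiskerLeft_scalar {X Y : C} (w : 𝟙_ C ⟶ 𝟙_ C) (f : X ⟶ 𝟙_ C) (g : 𝟙_ C ⟶ Y) :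
    X ◁ w ≫ (ρ_ X).hom ≫ f ≫ g = (ρ_ X).hom ≫ f ≫ w ≫ g := by
  have h : X ◁ w ≫ (ρ_ X).hom ≫ f = (ρ_ X).hom ≫ f ≫ w := by
    rw [← rightUnitor_naturality, whisker_exchange_assoc, ← unitors_equal, leftUnitor_naturality,
      unitors_equal, rightUnitor_naturality_assoc]
  rw [reassoc_of% h]

theorem rightUnitor_inv_scalar {X : C} (w : 𝟙_ C ⟶ 𝟙_ C) (g : 𝟙_ C ⟶ X) :
    g ≫ (ρ_ X).inv ≫ X ◁ w = w ≫ g ≫ (ρ_ X).inv := by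
  rw [rightUnitor_inv_naturality_assoc, ← whisker_exchange, ← unitors_inv_equal,
    ← leftUnitor_inv_naturality_assoc, unitors_inv_equal, ← rightUnitor_inv_naturality]

variable (C) in
/-- The monoid `volMonoid C` is commutative. -/
instance : CommMonoid (volMonoid C) :=
  { (inferInstance : Monoid (volMonoid C)) with
    mul_comm := fun a b => Subtype.ext (end_unit_comm (b : End (𝟙_ C)) (a : End (𝟙_ C))) }

/-- `volMonoid C` contains the inverses of invertible inverse volumes by construction, and scalars
commute, so a one-sided inverse among all scalars suffices. -/
theorem isUnit_vol_iff {X : BicommHopf C} (h : bismall C X) :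
    IsUnit (vol X h) ↔ ∃ w : 𝟙_ C ⟶ 𝟙_ C, w ≫ IsBismall.invVol h = 𝟙 _ := by
  constructor
  · rintro ⟨u, hu⟩
    refine ⟨((u⁻¹ : (volMonoid C)ˣ) : volMonoid C).1, ?_⟩
    have h1 : vol X h * ((u⁻¹ : (volMonoid C)ˣ) : volMonoid C) = 1 := by rw [← hu, Units.mul_inv]
    exact congrArg Subtype.val h1
  · rintro ⟨w, hw⟩
    have hw' : IsBismall.invVol h ≫ w = 𝟙 _ := (end_unit_comm _ _).trans hw
    refine IsUnit.of_mul_eq_one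
      ⟨w, Submonoid.subset_closure ⟨X, h, Or.inr ⟨hw', hw⟩⟩⟩ (Subtype.ext hw)

namespace BicommHopf

section Sequence

variable {A B D : BicommHopf C} {i : A ⟶ B} {p : B ⟶ D}

/-- Invariance of τ turns t(p(b₁)) τ(b₂) into t(1) τ(b). -/
theorem restrictEnd_cointegral {τ : B.X ⟶ 𝟙_ C} (hτ : IsNormalizedCointegral τ)
    {t : D.X ⟶ 𝟙_ C} (ht : η[D.X] ≫ t = 𝟙 _) : restrictEnd p t ≫ τ = τ := by
  rw [restrictEnd, coact]
  simp only [Category.assoc]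
  rw [← leftUnitor_naturality, ← whisker_exchange_assoc, ← whisker_exchange_assoc,
    reassoc_of% hτ.comul_whiskerLeft, ← rightUnitor_inv_naturality_assoc,
    ← rightUnitor_inv_naturality_assoc, IsMonHom.one_hom_assoc, reassoc_of% ht]
  simp [unitors_equal]

theorem integral_normEnd {σ : 𝟙_ C ⟶ B.X} (hσ : IsNormalizedIntegral σ)
    {s : 𝟙_ C ⟶ A.X} (hs : s ≫ ε[A.X] = 𝟙 _) : σ ≫ normEnd i s = σ := by
  rw [normEnd, act, leftUnitor_inv_naturality_assoc, whisker_exchange_assoc,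
    whisker_exchange_assoc, hσ.whiskerLeft_mul, rightUnitor_naturality_assoc,
    rightUnitor_naturality_assoc, IsComonHom.hom_counit_assoc, reassoc_of% hs]
  simp [unitors_inv_equal]

variable [HasEqualizers C] [HasCoequalizers C]

/-- The inverse volume of a quotient `D` of a dualizable `B` is invertible. -/
theorem exists_inv_of_quotient (hC : IsBistable C)
    (hp : IsStableCoequalizer (act i) (trivLeftAct A.X B.X) p.hom)
    (hi : IsStableEqualizer (coact p) (trivLeftCoact D.X B.X) i.hom)
    {σ : 𝟙_ C ⟶ B.X} (hσ : IsNormalizedIntegral σ) {τ : B.X ⟶ 𝟙_ C} (hτ : IsNormalizedCointegral τ)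
    {w : 𝟙_ C ⟶ 𝟙_ C} (hw : w ≫ σ ≫ τ = 𝟙 _)
    {t : D.X ⟶ 𝟙_ C} (ht : IsNormalizedCointegral t) :
    ∃ w' : 𝟙_ C ⟶ 𝟙_ C, w' ≫ (σ ≫ p.hom) ≫ t = 𝟙 _ := by
  obtain ⟨m, hm⟩ := exists_restrict hi ht
  -- σ ≫ m is an integral of the kernel A, not necessarily normalized. Its pairing with the
  -- restricted cointegral i ≫ τ is σ ≫ τ, so A is self-dual, and so is B; hence D is dualizable.
  have hK := isPerfect_of_integral (w := w) (whiskerLeft_restrict_mul hp.w hi.stableMono hσ hm)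
    (comp_cointegral hi.stableMono hτ).comul_whiskerRight (by
      rw [Category.assoc, reassoc_of% hm, restrictEnd_cointegral hτ ht.normalized, hw])
  have hB := isPerfect_of_integral hσ.whiskerLeft_mul hτ.comul_whiskerRight hw
  obtain ⟨E, ev, c, h⟩ := exists_dual_of_isStableCoequalizer hC hK hB (isLeftAction_act i) hp
  have hs := integral_comp hp.stableEpi hσ
  exact ⟨_, exists_inv_of_dual h hs.whiskerLeft_mul hs.normalized ht.comul_whiskerRight
    ht.normalized⟩

end Sequence

variable [HasEqualizers C] [HasCoequalizers C]

theorem hasUnitVolume_iff {X : BicommHopf C} : HasUnitVolume (bismall C) vol X ↔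
    ∃ (σ : 𝟙_ C ⟶ X.X) (τ : X.X ⟶ 𝟙_ C) (w : 𝟙_ C ⟶ 𝟙_ C),
      IsNormalizedIntegral σ ∧ IsNormalizedCointegral τ ∧ w ≫ σ ≫ τ = 𝟙 _ := by
  constructor
  · rintro ⟨h, hu⟩
    obtain ⟨σ, hσ⟩ := IsSmall.exists_normalizedIntegral (IsBismall.small h)
    obtain ⟨τ, hτ⟩ := IsCosmall.exists_normalizedCointegral (IsBismall.cosmall h)
    obtain ⟨w, hw⟩ := (isUnit_vol_iff h).1 hu
    rw [IsBismall.invVol_eq h hσ hτ] at hw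
    exact ⟨σ, τ, w, hσ, hτ, hw⟩
  · rintro ⟨σ, τ, w, hσ, hτ, hw⟩
    have h : bismall C X := isBismall_of_integrals hσ hτ
    exact ⟨h, (isUnit_vol_iff h).2 ⟨w, by rw [IsBismall.invVol_eq h hσ hτ]; exact hw⟩⟩

section Sequence

variable {A B D : BicommHopf C} {i : A ⟶ B} {p : B ⟶ D}

/-- The integral σ ≫ m of A has counit (σ ≫ p) ≫ t, so w' normalizes it. Its pairing with i ≫ τ is
then w' ≫ σ ≫ τ, a product of invertible scalars. -/
theorem hasUnitVolume_sub
    (hp : IsStableCoequalizer (act i) (trivLeftAct A.X B.X) p.hom)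
    (hi : IsStableEqualizer (coact p) (trivLeftCoact D.X B.X) i.hom)
    {σ : 𝟙_ C ⟶ B.X} (hσ : IsNormalizedIntegral σ) {τ : B.X ⟶ 𝟙_ C} (hτ : IsNormalizedCointegral τ)
    {w : 𝟙_ C ⟶ 𝟙_ C} (hw : w ≫ σ ≫ τ = 𝟙 _) {t : D.X ⟶ 𝟙_ C} (ht : IsNormalizedCointegral t)
    {w' : 𝟙_ C ⟶ 𝟙_ C} (hw' : w' ≫ (σ ≫ p.hom) ≫ t = 𝟙 _) :
    HasUnitVolume (bismall C) vol A := by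
  obtain ⟨m, hm⟩ := exists_restrict hi ht
  refine hasUnitVolume_iff.2 ⟨w' ≫ σ ≫ m, i.hom ≫ τ, ((σ ≫ p.hom) ≫ t) ≫ w, ?_,
    comp_cointegral hi.stableMono hτ, ?_⟩
  · refine isNormalizedIntegral_of_comm ?_ ?_
    · rw [MonoidalCategory.whiskerLeft_comp, Category.assoc,
        whiskerLeft_restrict_mul hp.w hi.stableMono hσ hm, whiskerLeft_scalar]
    · rw [Category.assoc, Category.assoc, restrict_counit hm, ← hw', Category.assoc]
  · have h : (w' ≫ σ ≫ m) ≫ i.hom ≫ τ = w' ≫ σ ≫ τ := by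
      simp only [Category.assoc]
      rw [reassoc_of% hm, restrictEnd_cointegral hτ ht.normalized]
    rw [h, end_unit_mul_inv hw' hw]

/-- Dually, the cointegral n ≫ τ of D takes the value s ≫ i ≫ τ on the unit and is normalized by w'.
-/
theorem hasUnitVolume_quotient
    (hp : IsStableCoequalizer (act i) (trivLeftAct A.X B.X) p.hom)
    (hi : IsStableEqualizer (coact p) (trivLeftCoact D.X B.X) i.hom)
    {σ : 𝟙_ C ⟶ B.X} (hσ : IsNormalizedIntegral σ) {τ : B.X ⟶ 𝟙_ C} (hτ : IsNormalizedCointegral τ)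
    {w : 𝟙_ C ⟶ 𝟙_ C} (hw : w ≫ σ ≫ τ = 𝟙 _) {s : 𝟙_ C ⟶ A.X} (hs : IsNormalizedIntegral s)
    {w' : 𝟙_ C ⟶ 𝟙_ C} (hw' : w' ≫ s ≫ i.hom ≫ τ = 𝟙 _) :
    HasUnitVolume (bismall C) vol D := by
  obtain ⟨n, hn⟩ := exists_norm hp hs
  refine hasUnitVolume_iff.2 ⟨σ ≫ p.hom, (n ≫ τ) ≫ w', (s ≫ i.hom ≫ τ) ≫ w,
    integral_comp hp.stableEpi hσ, ?_, ?_⟩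
  · refine isNormalizedCointegral_of_comm ?_ ?_
    · rw [MonoidalCategory.whiskerLeft_comp,
        reassoc_of% comul_whiskerLeft_norm hi.w hp.stableEpi hτ hn, rightUnitor_inv_scalar]
      simp only [Category.assoc]
    · rw [Category.assoc, reassoc_of% one_norm hn, ← hw', end_unit_comm w']
      simp only [Category.assoc]
  · have h : (σ ≫ p.hom) ≫ (n ≫ τ) ≫ w' = (σ ≫ τ) ≫ w' := by
      simp only [Category.assoc]
      rw [reassoc_of% hn, reassoc_of% integral_normEnd hσ hs.normalized]
    rw [h, ← end_unit_comm w', end_unit_mul_inv hw' hw]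

end Sequence

variable [Abelian (BicommHopf C)]

theorem stable_sequences (hC : IsBistable C) {X Y : BicommHopf C} (f : X ⟶ Y) :
    IsStableCoequalizer (act (kernel.ι f)) (trivLeftAct (kernel f).X X.X)
      (Abelian.factorThruImage f).hom ∧
    IsStableEqualizer (coact (Abelian.factorThruImage f)) (trivLeftCoact (Abelian.image f).X X.X)
      (kernel.ι f).hom ∧
    IsStableCoequalizer (act (Abelian.image.ι f)) (trivLeftAct (Abelian.image f).X Y.X)
      (cokernel.π f).hom ∧
    IsStableEqualizer (coact (cokernel.π f)) (trivLeftCoact (cokernel f).X Y.X)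
      (Abelian.image.ι f).hom := by
  have s₁ := shortExact_kernel_factorThruImage f
  have s₂ := shortExact_image_cokernel f
  exact ⟨isStableCoequalizer_of_isColimit hC _ s₁.gIsCokernel,
    isStableEqualizer_of_isLimit hC _ s₁.fIsKernel,
    isStableCoequalizer_of_isColimit hC _ s₂.gIsCokernel,
    isStableEqualizer_of_isLimit hC _ s₂.fIsKernel⟩

theorem isVolume (hC : IsBistable C) : IsVolume (bismall C) (vol (C := C)) where
  of_isZero X hX := by
    -- On a zero object the identity is trivial, so the unit is an integral and the counit a
    -- cointegral.
    have h : 𝟙 X.X = ε[X.X] ≫ η[X.X] := by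
      rw [← zero_hom, ← hX.eq_of_src (𝟙 X) 0, id_hom]
    have hσ : IsNormalizedIntegral η[X.X] := by
      refine isNormalizedIntegral_of_comm ?_ (BimonObj.one_counit _)
      rw [← h]; simp
    have hτ : IsNormalizedCointegral ε[X.X] := by
      refine isNormalizedCointegral_of_comm ?_ (BimonObj.one_counit _)
      rw [← reassoc_of% h]; simp
    have hb : bismall C X := isBismall_of_integrals hσ hτ
    refine ⟨hb, Subtype.ext ?_⟩
    exact (IsBismall.invVol_eq hb hσ hτ).trans (BimonObj.one_counit _)
  of_shortExact S hS h₁ h₃ := by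
    have hp := isStableCoequalizer_of_isColimit hC S.zero hS.gIsCokernel
    have hi := isStableEqualizer_of_isLimit hC S.zero hS.fIsKernel
    obtain ⟨σ, hσ⟩ := IsSmall.exists_normalizedIntegral (IsBismall.small h₁)
    obtain ⟨τ, hτ⟩ := IsCosmall.exists_normalizedCointegral (IsBismall.cosmall h₁)
    obtain ⟨σ', hσ'⟩ := IsSmall.exists_normalizedIntegral (IsBismall.small h₃)
    obtain ⟨τ', hτ'⟩ := IsCosmall.exists_normalizedCointegral (IsBismall.cosmall h₃)
    obtain ⟨n, hn⟩ := exists_norm hp hσ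
    obtain ⟨m, hm⟩ := exists_restrict hi hτ'
    have hn' := integral_extension hp hσ hσ' hn
    have hm' := cointegral_extension hi hτ' hτ hm
    have h₂ : bismall C S.X₂ := isBismall_of_integrals hn' hm'
    refine ⟨h₂, Subtype.ext ?_⟩
    -- Multiplication in `End` is composition in the reverse order, which is the order produced by
    -- the integral through n and the cointegral through m.
    change IsBismall.invVol h₂ = IsBismall.invVol h₃ ≫ IsBismall.invVol h₁
    rw [IsBismall.invVol_eq h₂ hn' hm', IsBismall.invVol_eq h₁ hσ hτ,
      IsBismall.invVol_eq h₃ hσ' hτ', Category.assoc, ← Category.assoc n,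
      norm_comp_restrict hp hi hσ hn hm, Category.assoc, Category.assoc]
  kernel_mem f hX hY := by
    obtain ⟨hp, hi, hp', hi'⟩ := stable_sequences hC f
    obtain ⟨σ, τ, w, hσ, hτ, hw⟩ := hasUnitVolume_iff.1 hX
    obtain ⟨σ', τ', w', hσ', hτ', hw'⟩ := hasUnitVolume_iff.1 hY
    -- The image of f takes its cointegral from Y. This is the only use of Y for the kernel.
    have ht := comp_cointegral hi'.stableMono hτ'
    obtain ⟨v, hv⟩ := exists_inv_of_quotient hC hp hi hσ hτ hw ht
    exact hasUnitVolume_sub hp hi hσ hτ hw ht hv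
  cokernel_mem f hX hY := by
    obtain ⟨hp, hi, hp', hi'⟩ := stable_sequences hC f
    obtain ⟨σ, τ, w, hσ, hτ, hw⟩ := hasUnitVolume_iff.1 hX
    obtain ⟨σ', τ', w', hσ', hτ', hw'⟩ := hasUnitVolume_iff.1 hY
    -- The integral that the image gets from X pairs invertibly with the cointegral restricted from
    -- Y; this scalar normalizes the cointegral of the cokernel.
    obtain ⟨v, hv⟩ := exists_inv_of_quotient hC hp hi hσ hτ hw (comp_cointegral hi'.stableMono hτ')
    exact hasUnitVolume_quotient hp' hi' hσ' hτ' hw' (integral_comp hp.stableEpi hσ) hv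

theorem comp_conv {A B D : BicommHopf C} (k : D ⟶ A) (f g : A ⟶ B) :
    k ≫ conv f g = conv (k ≫ f) (k ≫ g) := by
  refine hom_ext ?_
  rw [comp_hom]
  dsimp only [conv]
  rw [IsComonHom.hom_comul_assoc, tensorHom_comp_tensorHom_assoc, comp_hom, comp_hom]

theorem conv_zero {A B : BicommHopf C} (f : A ⟶ B) : conv f 0 = f := by
  refine hom_ext ?_
  dsimp only [conv]
  rw [zero_hom, MonoidalCategory.tensorHom_def', MonoidalCategory.whiskerLeft_comp]
  simp only [Category.assoc]
  rw [ComonObj.comul_counit_assoc, whisker_exchange_assoc, MonObj.mul_one,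
    rightUnitor_naturality, Iso.inv_hom_id_assoc]

end BicommHopf

end VolumeOfHopf
end HopfFredholm

/-! ### The main theorem -/

theorem proposition202002271226 {C : Type u} [Category.{v} C] [MonoidalCategory C]
    [SymmetricCategory C] [HasEqualizers C] [HasCoequalizers C]
    (hC : HopfFredholm.IsBistable C) [Abelian (HopfFredholm.BicommHopf C)] :
    (∀ A : HopfFredholm.BicommHopf C, ∃ h : HopfFredholm.IsFredholmHom (𝟙 A),
      HopfFredholm.Ind h ∈ HopfFredholm.volUnits C ∧ HopfFredholm.Ind h = 𝟙 (𝟙_ C)) ∧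
    (∀ (A B D : HopfFredholm.BicommHopf C) (ξ : A ⟶ B) (ξ' : B ⟶ D)
      (h : HopfFredholm.IsFredholmHom ξ) (h' : HopfFredholm.IsFredholmHom ξ'),
      ∃ h'' : HopfFredholm.IsFredholmHom (ξ ≫ ξ'),
        HopfFredholm.Ind h'' ∈ HopfFredholm.volUnits C ∧
        HopfFredholm.Ind h'' = HopfFredholm.Ind h' * HopfFredholm.Ind h) ∧
    (∀ (A B : HopfFredholm.BicommHopf C) (ξ ζ : A ⟶ B)
      (h : HopfFredholm.IsFredholmHom ξ), HopfFredholm.IsFiniteHom ζ →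
      ∃ h' : HopfFredholm.IsFredholmHom (HopfFredholm.BicommHopf.conv ξ ζ),
        HopfFredholm.Ind h' ∈ HopfFredholm.volUnits C ∧
        HopfFredholm.Ind h' = HopfFredholm.Ind h) := by
  have hv := HopfFredholm.BicommHopf.isVolume hC
  have hmem : ∀ {A B : HopfFredholm.BicommHopf C} {ξ : A ⟶ B}
      (h : HopfFredholm.IsFredholmHom ξ), HopfFredholm.Ind h ∈ HopfFredholm.volUnits C := by
    intro A B ξ h
    refine ⟨h.index.2, ?_⟩
    have hu : IsUnit h.index := by
      rw [HopfFredholm.IsFredholm.index_eq]; exact Units.isUnit _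
    exact hu.map (HopfFredholm.volMonoid C).subtype
  refine ⟨fun A => ?_, fun A B D ξ ξ' h h' => ?_, fun A B ξ ζ h hζ => ?_⟩
  · obtain ⟨h, e⟩ := hv.isFredholm_id (X := A)
    exact ⟨h, hmem h, congrArg Subtype.val e⟩
  · obtain ⟨h'', e⟩ := hv.isFredholm_comp h h'
    exact ⟨h'', hmem h'', congrArg Subtype.val e⟩
  -- On the kernel of ζ the convolution with ζ is a convolution with the trivial homomorphism, which
  -- changes nothing.
  · have hk : kernel.ι ζ ≫ ξ = kernel.ι ζ ≫ HopfFredholm.BicommHopf.conv ξ ζ := by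
      rw [HopfFredholm.BicommHopf.comp_conv, kernel.condition, HopfFredholm.BicommHopf.conv_zero]
    obtain ⟨h', e⟩ := hv.isFredholm_of_finite_perturbation h hζ hk
    exact ⟨h', hmem h', congrArg Subtype.val e⟩
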